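/- Let $n \ge k \ge 1$ be integers and write $\bar t := 1-t$. Let $W(\mathcal B_k)$ be the set of signed permutations $g=(\pi,\varepsilon)$, with $\pi\in \mathcal S_k$ and $\varepsilon=(\varepsilon_1,\dots,\varepsilon_k)\in\{1,-1\}^k$, and put $\operatorname{sgn}(g)=\operatorname{sgn}(\pi)\,\varepsilon_1\cdots\varepsilon_k$. Such a $g$ acts on polynomials and rational functions in $x_1,\dots,x_k$ by $g f=\varepsilon(\pi f)$, where $\pi$ replaces each $x_i$ by $x_{\pi(i)}$, and $\varepsilon$ replaces each $x_i$ with $\varepsilon_i=-1$ by $\bar x_i$ and leaves the other variables unchanged. Define the polynomial $$\Phi_k(x_1,\dots,x_k)=(-1)^k\sum_{g\in W(\mathcal B_k)}\operatorname{sgn}(g)\; g\Big[\prod_{i=1}^k \bar x_i^{\,k-i}x_i^{\,k}\prod_{1\le i<j\le k}(1-x_i\bar x_j)(1-\bar x_i\bar x_j)\Big]$$ and the rational function $$F_{n,k}(x_1,\dots,x_k)=\frac{\Phi_k(x_1,\dots,x_k)}{\prod_{i=1}^k x_i^{\,n+1}\,\bar x_i^{\,n+i+1}\ \prod_{1\le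 i<j\le k}(1-x_ix_j)(1-\bar x_i x_j)} .$$ For a rational function $f$, let $\operatorname{Res}_{x_i} f$ be the coefficient of $x_i^{-1}$ in the formal Laurent expansion of $f$ (at $0$) as a rational function of the single variable $x_i$ with coefficients that are rational functions of the other variables, and let $\operatorname{Res}_{x_1,\dots,x_k} f=\operatorname{Res}_{x_1}[\operatorname{Res}_{x_2}[\cdots[\operatorname{Res}_{x_k} f]\cdots]]$. Let $m_k(n)$ be the number of $n\times k$ Gog trapezoids, that is, of arrays of integers $(d_{i,j})$, $1\le i\le n$, $1\le j\le \min(k,n+1-i)$, such that, whenever the entries involved exist, $d_{i,j}<d_{i,j+1}$, $d_{i,j}\le d_{i+1,j}$, $d_{i,j}\ge d_{i+1,j-1}$, $d_{1,j}=j$ and $d_{i,k}\le i+k-1$. Then for every $g\in W(\mathcal B_k)$, $$\operatorname{Res}_{x_1,\dots,x_k}[\,g F_{n,k}\,]=\operatorname{Res}_{x_1,\dots,x_k}[\,F_{n,k}\,]=m_k(n).$$ -/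

import Mathlib

open scoped BigOperators

noncomputable section

namespace Gog

/-! Rational functions in `x_1, …, x_k` with their iterated
residues, the action of signed permutations, the Gog residuand, and Gog trapezoids.
The variable `x_{i+1}` of the mathematics is the variable with index `i : Fin k`. -/

/-- Polynomials in `x_1, …, x_k` over `ℚ`. -/
abbrev Poly (k : ℕ) : Type := MvPolynomial (Fin k) ℚ

/-- Rational functions in `x_1, …, x_k` over `ℚ`. -/
abbrev RatFun (k : ℕ) : Type := FractionRing (Poly k)

/-- The variable `x_i` as a rational function. -/
def x {k : ℕ} (i : Fin k) : RatFun k := algebraMap (Poly k) (RatFun k) (MvPolynomial.X i)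

/-! ### Iterated residues -/

/-- A polynomial in `x_1, …, x_k`, written as a polynomial in the one variable `x_i` (which becomes
`Polynomial.X`) whose coefficients are polynomials in the other variables, seen in `RatFun k`. -/
def asPolyIn {k : ℕ} (i : Fin k) : Poly k →ₐ[ℚ] Polynomial (RatFun k) :=
  MvPolynomial.aeval fun j => if j = i then Polynomial.X else Polynomial.C (x j)

theorem eval_asPolyIn {k : ℕ} (i : Fin k) (p : Poly k) :
    Polynomial.eval (x i) (asPolyIn i p) = algebraMap (Poly k) (RatFun k) p := by
  induction p using MvPolynomial.induction_on with
  | C a =>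
    have h : asPolyIn i (MvPolynomial.C a : Poly k)
        = Polynomial.C (algebraMap ℚ (RatFun k) a) := (asPolyIn i).commutes a
    rw [h, Polynomial.eval_C]
    exact RingHom.congr_fun (RingHom.ext_rat (algebraMap ℚ (RatFun k))
      ((algebraMap (Poly k) (RatFun k)).comp MvPolynomial.C)) a
  | add p q hp hq => rw [map_add, Polynomial.eval_add, hp, hq, map_add]
  | mul_X p j hp =>
    rw [map_mul, Polynomial.eval_mul, hp, map_mul]
    congr 1
    rw [asPolyIn, MvPolynomial.aeval_X]
    split_ifs with h
    · rw [Polynomial.eval_X, h]; rfl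
    · rw [Polynomial.eval_C]; rfl

theorem asPolyIn_injective {k : ℕ} (i : Fin k) : Function.Injective (asPolyIn i) := by
  intro p q h
  apply IsFractionRing.injective (Poly k) (RatFun k)
  rw [← eval_asPolyIn i p, ← eval_asPolyIn i q, h]

/-- The ring homomorphism `Poly k → (RatFun k)((X))` sending `x_i` to the Laurent series variable and
every other `x_j` to the constant `x_j`. -/
def polyToLaurent {k : ℕ} (i : Fin k) : Poly k →+* LaurentSeries (RatFun k) :=
  (algebraMap (Polynomial (RatFun k)) (LaurentSeries (RatFun k))).comp (asPolyIn i).toRingHom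

theorem polyToLaurent_injective {k : ℕ} (i : Fin k) : Function.Injective (polyToLaurent i) :=
  (FaithfulSMul.algebraMap_injective (Polynomial (RatFun k)) (LaurentSeries (RatFun k))).comp
    (asPolyIn_injective i)

/-- The formal Laurent expansion (at `0`) of a rational function with respect to the one variable
`x_i`; the coefficients are rational functions of the other variables. -/
def laurentExpansion {k : ℕ} (i : Fin k) : RatFun k →+* LaurentSeries (RatFun k) :=
  IsFractionRing.lift (polyToLaurent_injective i)

/-- `Res_{x_i} f`: the coefficient of `x_i ^ (-1)` in the Laurent expansion of `f` in `x_i`. -/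
def res {k : ℕ} (i : Fin k) (f : RatFun k) : RatFun k :=
  (laurentExpansion i f).coeff (-1)

/-- `Res_{x_1, …, x_k} f = Res_{x_1} [Res_{x_2} [⋯ [Res_{x_k} f] ⋯ ]]`. -/
def iterRes {k : ℕ} (f : RatFun k) : RatFun k :=
  (List.finRange k).foldr res f

/-! ### Signed permutations -/

/-- The set `W(B_k)` of signed permutations: pairs of a permutation and a sign assignment. -/
abbrev SignedPerm (k : ℕ) : Type := Equiv.Perm (Fin k) × (Fin k → ℤˣ)

/-- `sgn (π, ε) = sgn π * ∏ ε_i`. -/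
def SignedPerm.sgn {k : ℕ} (g : SignedPerm k) : ℤˣ :=
  Equiv.Perm.sign g.1 * ∏ i, g.2 i

/-- The action of a sign assignment on polynomials: `x_i` is replaced by `1 - x_i` when
`ε_i = -1`. -/
def signSubst {k : ℕ} (ε : Fin k → ℤˣ) : Poly k →ₐ[ℚ] Poly k :=
  MvPolynomial.aeval fun i => if ε i = 1 then MvPolynomial.X i else 1 - MvPolynomial.X i

theorem signSubst_signSubst {k : ℕ} (ε : Fin k → ℤˣ) (p : Poly k) :
    signSubst ε (signSubst ε p) = p := by
  have h : (signSubst ε).comp (signSubst ε) = AlgHom.id ℚ (Poly k) := by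
    apply MvPolynomial.algHom_ext
    intro i
    by_cases hi : ε i = 1 <;> simp [signSubst, hi]
  exact DFunLike.congr_fun h p

/-- The action `(π, ε) p = ε (π p)` of a signed permutation on polynomials, where `π` replaces `x_i`
by `x_{π(i)}`. -/
def SignedPerm.actPoly {k : ℕ} (g : SignedPerm k) : Poly k →ₐ[ℚ] Poly k :=
  (signSubst g.2).comp (MvPolynomial.rename g.1)

theorem SignedPerm.actPoly_injective {k : ℕ} (g : SignedPerm k) :
    Function.Injective g.actPoly :=
  (Function.LeftInverse.injective (signSubst_signSubst g.2)).comp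
    (MvPolynomial.rename_injective g.1 g.1.injective)

/-- The action of a signed permutation on rational functions, by the same substitution. -/
def SignedPerm.act {k : ℕ} (g : SignedPerm k) : RatFun k →+* RatFun k :=
  IsFractionRing.map (j := g.actPoly.toRingHom) g.actPoly_injective

/-! ### The Gog residuand -/

open MvPolynomial in
/-- The polynomial that is antisymmetrized in `Phi`:
`∏ (1-x_i)^(k-i) x_i^k ∏_{i<j} (1 - x_i (1-x_j)) (1 - (1-x_i) (1-x_j))`. -/
def phiTerm (k : ℕ) : Poly k :=
  (∏ i : Fin k, (1 - X i) ^ (k - ((i : ℕ) + 1)) * X i ^ k) *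
    ∏ i : Fin k, ∏ j ∈ Finset.Ioi i,
      ((1 - X i * (1 - X j)) * (1 - (1 - X i) * (1 - X j)))

/-- `Φ_k = (-1)^k ∑_{g ∈ W(B_k)} sgn(g) · g [phiTerm k]`. -/
def Phi (k : ℕ) : Poly k :=
  (-1) ^ k * ∑ g : SignedPerm k, ((g.sgn : ℤ) : Poly k) * g.actPoly (phiTerm k)

/-- `F_{n,k} = Φ_k / (∏ x_i^(n+1) (1-x_i)^(n+i+1) ∏_{i<j} (1 - x_i x_j) (1 - (1-x_i) x_j))`. -/
def F (n k : ℕ) : RatFun k :=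
  algebraMap (Poly k) (RatFun k) (Phi k) /
    ((∏ i : Fin k, x i ^ (n + 1) * (1 - x i) ^ (n + ((i : ℕ) + 1) + 1)) *
      ∏ i : Fin k, ∏ j ∈ Finset.Ioi i, ((1 - x i * x j) * (1 - (1 - x i) * x j)))

/-! ### Gog trapezoids -/

/-- The positions `(i, j)` with `1 ≤ i ≤ n` and `1 ≤ j ≤ min (k, n + 1 - i)`. -/
abbrev Cell (n k : ℕ) : Type :=
  {c : ℕ × ℕ // 1 ≤ c.1 ∧ c.1 ≤ n ∧ 1 ≤ c.2 ∧ c.2 ≤ min k (n + 1 - c.1)}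

/-- `d` is an `n × k` Gog trapezoid. -/
structure IsGogTrapezoid (n k : ℕ) (d : Cell n k → ℤ) : Prop where
  /-- `d_{i,j} < d_{i,j+1}` -/
  row_lt : ∀ c c' : Cell n k, c'.1 = (c.1.1, c.1.2 + 1) → d c < d c'
  /-- `d_{i,j} ≤ d_{i+1,j}` -/
  col_le : ∀ c c' : Cell n k, c'.1 = (c.1.1 + 1, c.1.2) → d c ≤ d c'
  /-- `d_{i,j} ≥ d_{i+1,j-1}`, for `j > 1` -/
  diag_ge : ∀ c c' : Cell n k, c'.1.1 = c.1.1 + 1 → c'.1.2 + 1 = c.1.2 → d c' ≤ d c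
  /-- `d_{1,j} = j` -/
  first_row : ∀ c : Cell n k, c.1.1 = 1 → d c = c.1.2
  /-- `d_{i,k} ≤ i + k - 1` -/
  last_col : ∀ c : Cell n k, c.1.2 = k → d c ≤ (c.1.1 : ℤ) + (k : ℤ) - 1

/-- `m_k(n)`: the number of `n × k` Gog trapezoids. -/
def m (k n : ℕ) : ℕ := Set.ncard {d : Cell n k → ℤ | IsGogTrapezoid n k d}

end Gog

end

/-! The theorem splits into invariance of the iterated residue under flips x ↦ 1 - x of single
variables, invariance under permutations, and a count of Gog trapezoids by power series
coefficients.

Flips. As a function of one variable x_v, an image of `F` has poles at 0 and 1 and simple poles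
where a pair factor 1 - w w' vanishes, with w one of x_v, 1 - x_v and w' one of x_i, 1 - x_i.
Partial fractions (`exists_partial_fractions`) leave terms x_v^(-i) (1 - x_v)^(-j) with i + j ≥ 2,
whose residue does not change under the flip (`flipInvariant_monomial`), and multiples of w⁻¹ (1 - w
w')⁻¹, which turn out to have iterated residue zero before and after the flip. For the latter, the
coefficient at the pole has to be understood. There two coordinates are a and 1/a, and the
antisymmetry of `Phi` together with a wheel condition (`phiAt_eq_zero_of_wheel`) makes `Phi` vanish
at a = 1/2 and whenever a is one of the six anharmonic transforms of another coordinate. These zeros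
cancel all remaining pair factors, and exponent bounds control the quotient
(`exists_phiAt_div_offDen`). The coefficient is then a combination of powers (1 - w')^(-e) with e ≥
2, over functions free of x_v and x_i (`exists_poleCoeff_eq`), and `iterRes_mul_pow_mul_piece`
applies.

Permutations. At the origin `F` is a power series divided by ∏ x_i^(n+1), and the iterated residue
of such a function is a coefficient of the series (`iterRes_div_eq_coeff`). The monomial is
symmetric, so permuting the variables changes nothing, and the residue is the coefficient of
`gogSeries (n + 1) k` at (n+1, …, n+1).

Counting. The antidiagonals of a trapezoid form a chain of vectors, and chains are counted
recursively by their last member. Raising n by one divides the series by ∏ (1 - x_i), so the new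
coefficients are sums of the old ones over all smaller exponents (`revCoeff_succ`). Chains only
involve monotone vectors; the antisymmetry of `Phi` gives a linear relation at equal adjacent
exponents (`sum_cf_gogSeries_update`), which folds the unrestricted sum into one over monotone
vectors with `dec` applied (`sum_monotone`). Hence the chains ending in a are counted by the
coefficient at `dec a` (`chainsEq`). Two boundary facts make the recursion close: coefficients with
exponent n + 1 in the first variable and at most n in the others vanish, because the corresponding
function is both flip invariant and flip antisymmetric (`iterRes_phiAt_div_eq_zero`); and at n = k +
1 the passage from k to k + 1 variables is obtained by setting a variable to zero in the denominator
(`cf_gogSeries_cons`). -/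

open scoped BigOperators

noncomputable section

namespace Gog

/-! ### Calculus of iterated residues and flips -/

section

/-! ### Iterated residues and subfields of rational functions free of some variables -/

/-- The coefficientwise map of Laurent series. -/
def laurentMap {R S : Type*} [Field R] [Field S] (φ : R →+* S) :
    LaurentSeries R →+* LaurentSeries S where
  toFun f := HahnSeries.map f φ
  map_one' := HahnSeries.map_one φ.toMonoidWithZeroHom
  map_zero' := by ext; simp
  map_add' f g := by ext; simp
  map_mul' f g := HahnSeries.map_mul φ.toNonUnitalRingHom

theorem coeff_laurentMap {R S : Type*} [Field R] [Field S] (φ : R →+* S) (f : LaurentSeries R)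
    (n : ℤ) : (laurentMap φ f).coeff n = φ (f.coeff n) := rfl

variable {k : ℕ}

theorem laurentExpansion_algebraMap (j : Fin k) (p : Poly k) :
    laurentExpansion j (algebraMap (Poly k) (RatFun k) p) = polyToLaurent j p :=
  IsFractionRing.lift_algebraMap (polyToLaurent_injective j) p

theorem laurentExpansion_x_self (j : Fin k) :
    laurentExpansion j (x j) = HahnSeries.single 1 1 := by
  rw [x, laurentExpansion_algebraMap]
  simp [polyToLaurent, asPolyIn, HahnSeries.ofPowerSeries_X,
    Polynomial.algebraMap_hahnSeries_apply]

theorem laurentExpansion_x_of_ne {i j : Fin k} (h : i ≠ j) :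
    laurentExpansion j (x i) = HahnSeries.C (x i) := by
  rw [x, laurentExpansion_algebraMap]
  simp [polyToLaurent, asPolyIn, h, Polynomial.algebraMap_hahnSeries_apply, x]

/-- The rational functions that do not involve the variables with index in `S`. -/
def fr (S : Set (Fin k)) : Subfield (RatFun k) := Subfield.closure (x '' Sᶜ)

theorem x_mem_fr {S : Set (Fin k)} {i : Fin k} (h : i ∉ S) : x i ∈ fr S :=
  Subfield.subset_closure ⟨i, h, rfl⟩

theorem fr_mono {S T : Set (Fin k)} (h : S ⊆ T) : fr T ≤ fr S :=
  Subfield.closure_mono (Set.image_mono (Set.compl_subset_compl.2 h))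

theorem algebraMap_mem_of_x_mem (K : Subfield (RatFun k)) (h : ∀ i, x i ∈ K) (p : Poly k) :
    algebraMap (Poly k) (RatFun k) p ∈ K := by
  induction p using MvPolynomial.induction_on with
  | C a =>
    have : algebraMap (Poly k) (RatFun k) (MvPolynomial.C a) = ((a : ℚ) : RatFun k) :=
      RingHom.congr_fun (RingHom.ext_rat ((algebraMap (Poly k) (RatFun k)).comp MvPolynomial.C)
        (Rat.castHom (RatFun k))) a
    rw [this]
    exact SubfieldClass.ratCast_mem K a
  | add p q hp hq => rw [map_add]; exact K.add_mem hp hq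
  | mul_X p i hp => rw [map_mul]; exact K.mul_mem hp (h i)

theorem mem_of_x_mem (K : Subfield (RatFun k)) (h : ∀ i, x i ∈ K) (f : RatFun k) : f ∈ K := by
  obtain ⟨p, q, -, rfl⟩ := IsFractionRing.div_surjective (A := Poly k) f
  exact K.div_mem (algebraMap_mem_of_x_mem K h p) (algebraMap_mem_of_x_mem K h q)

theorem laurentExpansion_of_mem {S : Set (Fin k)} {j : Fin k} (hj : j ∈ S) {f : RatFun k}
    (hf : f ∈ fr S) : laurentExpansion j f = HahnSeries.C f := by
  have : fr S ≤ (laurentExpansion j).eqLocusField HahnSeries.C := by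
    refine Subfield.closure_le.2 ?_
    rintro _ ⟨i, hi, rfl⟩
    exact laurentExpansion_x_of_ne (fun h => hi (h ▸ hj))
  exact this hf

theorem res_add (j : Fin k) (f g : RatFun k) : res j (f + g) = res j f + res j g := by
  simp [res]

theorem res_zero (j : Fin k) : res j (0 : RatFun k) = 0 := by simp [res]

theorem res_mul_of_mem {S : Set (Fin k)} {j : Fin k} (hj : j ∈ S) {u : RatFun k}
    (hu : u ∈ fr S) (f : RatFun k) : res j (u * f) = u * res j f := by
  rw [res, map_mul, laurentExpansion_of_mem hj hu, HahnSeries.C_mul_eq_smul]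
  simp [res]

/-- The functions whose expansion in x_j has all coefficients in `fr (insert j S)` form a subfield,
so it is enough to look at the generating variables. -/
theorem res_mem {S : Set (Fin k)} (j : Fin k) {f : RatFun k} (hf : f ∈ fr S) :
    res j f ∈ fr (insert j S) := by
  have : fr S ≤ (laurentMap (fr (insert j S)).subtype).fieldRange.comap (laurentExpansion j) := by
    refine Subfield.closure_le.2 ?_
    rintro _ ⟨i, hi, rfl⟩
    change laurentExpansion j (x i) ∈ (laurentMap (fr (insert j S)).subtype).fieldRange
    by_cases h : i = j
    · subst h
      rw [laurentExpansion_x_self]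
      exact ⟨HahnSeries.single 1 1, by ext n; by_cases hn : n = 1 <;>
        simp [coeff_laurentMap, hn]⟩
    · rw [laurentExpansion_x_of_ne h]
      refine ⟨HahnSeries.C ⟨x i, x_mem_fr ?_⟩, ?_⟩
      · rintro (h' | h')
        · exact h h'
        · exact hi h'
      · exact HahnSeries.map_C _ (fr (insert j S)).subtype
  obtain ⟨g, hg⟩ := this hf
  rw [res, ← hg, coeff_laurentMap]
  exact (g.coeff (-1)).2

/-- Iterated residue along a list of variables. -/
def lres (l : List (Fin k)) (f : RatFun k) : RatFun k := l.foldr res f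

theorem lres_append (l₁ l₂ : List (Fin k)) (f : RatFun k) :
    lres (l₁ ++ l₂) f = lres l₁ (lres l₂ f) := List.foldr_append

theorem lres_cons (j : Fin k) (l : List (Fin k)) (f : RatFun k) :
    lres (j :: l) f = res j (lres l f) := rfl

theorem lres_add (l : List (Fin k)) (f g : RatFun k) : lres l (f + g) = lres l f + lres l g := by
  induction l with
  | nil => rfl
  | cons j l ih => rw [lres_cons, ih, res_add, lres_cons, lres_cons]

theorem lres_zero (l : List (Fin k)) : lres l (0 : RatFun k) = 0 := by
  induction l with
  | nil => rfl
  | cons j l ih => rw [lres_cons, ih, res_zero]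

theorem lres_mem {S : Set (Fin k)} (l : List (Fin k)) {f : RatFun k} (hf : f ∈ fr S) :
    lres l f ∈ fr S := by
  induction l with
  | nil => exact hf
  | cons j l ih => exact fr_mono (Set.subset_insert j S) (res_mem j ih)

theorem lres_mul {S : Set (Fin k)} (l : List (Fin k)) (hl : ∀ j ∈ l, j ∈ S) {u : RatFun k}
    (hu : u ∈ fr S) (f : RatFun k) : lres l (u * f) = u * lres l f := by
  induction l with
  | nil => rfl
  | cons j l ih =>
    rw [lres_cons, ih fun i hi => hl i (List.mem_cons_of_mem _ hi),
      res_mul_of_mem (hl j List.mem_cons_self) hu, lres_cons]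

theorem iterRes_eq_lres (f : RatFun k) : iterRes f = lres (List.finRange k) f := rfl

theorem iterRes_add (f g : RatFun k) : iterRes (f + g) = iterRes f + iterRes g :=
  lres_add _ f g

/-- `iterRes` as an additive homomorphism. -/
def iterResHom (k : ℕ) : RatFun k →+ RatFun k where
  toFun := iterRes
  map_zero' := lres_zero _
  map_add' := iterRes_add

theorem iterRes_neg (f : RatFun k) : iterRes (-f) = -iterRes f := map_neg (iterResHom k) f

theorem iterRes_sum {ι : Type*} (s : Finset ι) (f : ι → RatFun k) :
    iterRes (∑ i ∈ s, f i) = ∑ i ∈ s, iterRes (f i) := map_sum (iterResHom k) f s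

theorem iterRes_ratCast_mul (c : ℚ) (f : RatFun k) :
    iterRes ((c : RatFun k) * f) = c * iterRes f :=
  lres_mul (S := Set.univ) _ (fun _ _ => Set.mem_univ _) (SubfieldClass.ratCast_mem _ c) f

/-- The function `u` of x_v alone is a constant for the residues taken before the one in x_v, and
the cofactor `A` is a constant for that one. So the iterated residue sees `u` only through `res v
u`. -/
theorem iterRes_mul_congr {v : Fin k} {A u u' : RatFun k} (hA : A ∈ fr {v})
    (hu : u ∈ fr {v}ᶜ) (hu' : u' ∈ fr {v}ᶜ) (h : res v u = res v u') :
    iterRes (A * u) = iterRes (A * u') := by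
  obtain ⟨l₁, l₂, hl⟩ := List.append_of_mem (List.mem_finRange v)
  have hnd : (l₁ ++ v :: l₂).Nodup := hl ▸ List.nodup_finRange k
  have hv2 : v ∉ l₂ := (List.nodup_cons.1 (hnd.of_append_right)).1
  have key : ∀ w ∈ fr ({v}ᶜ : Set (Fin k)),
      iterRes (A * w) = lres l₁ (lres l₂ A * res v w) := by
    intro w hw
    rw [iterRes_eq_lres, hl, lres_append, lres_cons, mul_comm A w,
      lres_mul (S := {v}ᶜ) l₂ (fun j hj hjv => hv2 (hjv ▸ hj)) hw, mul_comm w,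
      res_mul_of_mem (Set.mem_singleton v) (lres_mem l₂ hA)]
  rw [key u hu, key u' hu', h]

/-- The residue in the larger index s is taken first, then that in t. All other residues act on the
cofactor `h` and carry `u` along as a constant. -/
theorem iterRes_mul_eq_zero_of_lt {s t : Fin k} (hts : t < s) {h u : RatFun k}
    (hh : h ∈ fr {s, t}) (hu : u ∈ fr {s, t}ᶜ) (hres : res t (res s u) = 0) :
    iterRes (h * u) = 0 := by
  have hsplit : ∃ l₁ l₂ l₃ : List (Fin k), List.finRange k = l₁ ++ t :: (l₂ ++ s :: l₃) := by
    obtain ⟨l₁, l, hl⟩ := List.append_of_mem (List.mem_finRange t)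
    have hs : s ∈ l := by
      have hp : (l₁ ++ t :: l).Pairwise (· < ·) := hl ▸ List.pairwise_lt_finRange k
      have hs' : s ∈ l₁ ++ t :: l := hl ▸ List.mem_finRange s
      rcases List.mem_append.1 hs' with h' | h'
      · exact absurd ((List.pairwise_append.1 hp).2.2 s h' t List.mem_cons_self) (not_lt.2 hts.le)
      · rcases List.mem_cons.1 h' with h'' | h''
        · exact absurd h'' hts.ne'
        · exact h''
    obtain ⟨l₂, l₃, hl'⟩ := List.append_of_mem hs
    exact ⟨l₁, l₂, l₃, by rw [hl, hl']⟩
  obtain ⟨l₁, l₂, l₃, hl⟩ := hsplit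
  have hnd : (l₁ ++ t :: (l₂ ++ s :: l₃)).Nodup := hl ▸ List.nodup_finRange k
  have hnd2 := hnd.of_append_right
  have ht : t ∉ l₂ ++ s :: l₃ := (List.nodup_cons.1 hnd2).1
  have hnd3 := (List.nodup_cons.1 hnd2).2
  have hs3 : s ∉ l₃ := (List.nodup_cons.1 hnd3.of_append_right).1
  have hs2 : s ∉ l₂ := fun hm => (List.disjoint_of_nodup_append hnd3) hm List.mem_cons_self
  have ht2 : t ∉ l₂ := fun hm => ht (List.mem_append_left _ hm)
  have ht3 : t ∉ l₃ := fun hm => ht (List.mem_append_right _ (List.mem_cons_of_mem _ hm))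
  have hru : res s u ∈ fr ({s, t}ᶜ : Set (Fin k)) :=
    fr_mono (Set.subset_insert _ _) (res_mem s hu)
  rw [iterRes_eq_lres, hl, lres_append, lres_cons, lres_append, lres_cons, mul_comm h u,
    lres_mul (S := {s, t}ᶜ) l₃ ?_ hu, mul_comm u,
    res_mul_of_mem (S := {s, t}) (by simp) (lres_mem l₃ hh), mul_comm,
    lres_mul (S := {s, t}ᶜ) l₂ ?_ hru, mul_comm,
    res_mul_of_mem (S := {s, t}) (by simp) (lres_mem l₂ (lres_mem l₃ hh)), hres, mul_zero, lres_zero]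
  · rintro j hj (rfl | rfl)
    exacts [hs2 hj, ht2 hj]
  · rintro j hj (rfl | rfl)
    exacts [hs3 hj, ht3 hj]

/-- With both orders of the two residues under control, it no longer matters which of the two
variables has the larger index. -/
theorem iterRes_mul_eq_zero {v i : Fin k} (hvi : v ≠ i) {h u : RatFun k}
    (hh : h ∈ fr {v, i}) (hu : u ∈ fr {v, i}ᶜ) (h1 : res i (res v u) = 0)
    (h2 : res v (res i u) = 0) : iterRes (h * u) = 0 := by
  rcases lt_or_gt_of_ne hvi with hlt | hlt
  · exact iterRes_mul_eq_zero_of_lt hlt (by rwa [Set.pair_comm]) (by rwa [Set.pair_comm]) h2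
  · exact iterRes_mul_eq_zero_of_lt hlt hh hu h1

end

section

variable {k : ℕ}

theorem field_identity₁ {K : Type*} [Field K] {y : K} (hy : y ≠ 0) (a : K) (e : ℕ) :
    a * (1 - y) * y⁻¹ ^ (e + 1) = a * y⁻¹ ^ (e + 1) + -(a * y⁻¹ ^ e) := by
  simp only [inv_pow]
  field_simp
  ring

theorem field_identity₂ {K : Type*} [Field K] {y A B : K} (hy : y ≠ 0) (hA : A ≠ 0)
    (h : A + B * y ≠ 0) (m : ℕ) :
    y⁻¹ ^ (m + 1 + 1) * (A + B * y)⁻¹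
        = A⁻¹ * y⁻¹ ^ (m + 2) + -(B / A) * (y⁻¹ ^ (m + 1) * (A + B * y)⁻¹) := by
  simp only [inv_pow]
  field_simp
  ring

theorem field_identity₃ {K : Type*} [Field K] {w : K} (hw : w ≠ 0) (hw1 : 1 - w ≠ 0) (m : ℕ) :
    w⁻¹ * ((1 - w)⁻¹ * (-(w / (1 - w))) ^ (m + 1))
      = (-1) ^ (m + 1) * (w ^ m * (1 - w)⁻¹ ^ (m + 2)) := by
  rw [neg_pow, div_pow, pow_succ w m, inv_pow]
  field_simp
  ring

theorem field_identity₄ {K : Type*} [Field K] {x : K} (hx : x ≠ 0) (hxy : 1 - x ≠ 0)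
    (A : K) (i j : ℤ) :
    A * (x ^ (-i) * (1 - x) ^ (-j)) = A * (x ^ (-(i - 1)) * (1 - x) ^ (-j)) +
          A * (x ^ (-i) * (1 - x) ^ (-(j - 1))) := by
  rw [show -(i - 1) = -i + 1 by ring, show -(j - 1) = -j + 1 by ring, zpow_add_one₀ hx,
    zpow_add_one₀ hxy]
  ring

theorem field_identity₅ {K : Type*} [Field K] (w y : K) (m : ℕ) :
    (1 - (1 - y))⁻¹ ^ (m + 2) * (w⁻¹ * (1 - w * (1 - y))⁻¹)
      = w⁻¹ * (y⁻¹ ^ (m + 1 + 1) * ((1 - w) + w * y)⁻¹) := by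
  rw [sub_sub_cancel, show 1 - w * (1 - y) = 1 - w + w * y by ring]
  ring

/-! ### Residues in one variable -/

/-- `f` has no pole at `x_v = 0`, and its value there is `c`. -/
def RegularAt (v : Fin k) (c f : RatFun k) : Prop :=
  ∃ p : PowerSeries (RatFun k),
    laurentExpansion v f = HahnSeries.ofPowerSeries ℤ (RatFun k) p ∧
      PowerSeries.constantCoeff p = c

namespace RegularAt

variable {v : Fin k} {c d f g : RatFun k}

theorem add (hf : RegularAt v c f) (hg : RegularAt v d g) : RegularAt v (c + d) (f + g) := by
  obtain ⟨p, hp, rfl⟩ := hf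
  obtain ⟨q, hq, rfl⟩ := hg
  exact ⟨p + q, by rw [map_add, map_add, hp, hq], map_add _ _ _⟩

theorem mul (hf : RegularAt v c f) (hg : RegularAt v d g) : RegularAt v (c * d) (f * g) := by
  obtain ⟨p, hp, rfl⟩ := hf
  obtain ⟨q, hq, rfl⟩ := hg
  exact ⟨p * q, by rw [map_mul, map_mul, hp, hq], map_mul _ _ _⟩

theorem neg (hf : RegularAt v c f) : RegularAt v (-c) (-f) := by
  obtain ⟨p, hp, rfl⟩ := hf
  exact ⟨-p, by rw [map_neg, map_neg, hp], map_neg _ _⟩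

theorem sub (hf : RegularAt v c f) (hg : RegularAt v d g) : RegularAt v (c - d) (f - g) := by
  rw [sub_eq_add_neg, sub_eq_add_neg]
  exact hf.add hg.neg

theorem one : RegularAt v (1 : RatFun k) 1 := ⟨1, by rw [map_one, map_one], map_one _⟩

theorem of_mem {S : Set (Fin k)} (hv : v ∈ S) (hf : f ∈ fr S) : RegularAt v f f :=
  ⟨PowerSeries.C f, by rw [laurentExpansion_of_mem hv hf, HahnSeries.ofPowerSeries_C],
    PowerSeries.constantCoeff_C f⟩

theorem x : RegularAt v 0 (x v) :=
  ⟨PowerSeries.X, by rw [laurentExpansion_x_self, HahnSeries.ofPowerSeries_X],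
    PowerSeries.constantCoeff_X⟩

theorem pow (hf : RegularAt v c f) (n : ℕ) : RegularAt v (c ^ n) (f ^ n) := by
  induction n with
  | zero => simpa using one
  | succ n ih => rw [pow_succ, pow_succ]; exact ih.mul hf

theorem inv (hf : RegularAt v c f) (hc : c ≠ 0) : RegularAt v c⁻¹ f⁻¹ := by
  obtain ⟨p, hp, rfl⟩ := hf
  refine ⟨p⁻¹, ?_, PowerSeries.constantCoeff_inv p⟩
  rw [map_inv₀, hp]
  refine inv_eq_of_mul_eq_one_right ?_
  rw [← map_mul, PowerSeries.mul_inv_cancel p hc, map_one]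

theorem res_eq_zero (hf : RegularAt v c f) : res v f = 0 := by
  obtain ⟨p, hp, -⟩ := hf
  rw [res, hp]
  exact (PowerSeries.coeff_coe p (-1)).trans (by simp)

theorem res_inv_mul (hf : RegularAt v c f) : res v ((Gog.x v)⁻¹ * f) = c := by
  obtain ⟨p, hp, rfl⟩ := hf
  rw [res, map_mul, map_inv₀, hp, laurentExpansion_x_self, HahnSeries.inv_single, inv_one]
  have h := HahnSeries.coeff_single_mul (r := (1 : RatFun k)) (a := (-1 : ℤ))
    (x := HahnSeries.ofPowerSeries ℤ (RatFun k) p) (b := -1)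
  rw [h, one_mul]
  simpa using PowerSeries.coeff_coe p 0

end RegularAt

theorem x_ne_zero (i : Fin k) : x i ≠ 0 := by
  intro h
  have h1 := laurentExpansion_x_self i
  rw [h, map_zero] at h1
  exact one_ne_zero (HahnSeries.single_eq_zero_iff.1 h1.symm)

theorem one_sub_x_ne_zero (i : Fin k) : 1 - x i ≠ 0 := by
  intro h
  have h1 : RegularAt i (1 - 0) (1 - x i) := RegularAt.one.sub RegularAt.x
  obtain ⟨p, hp, hc⟩ := h1
  rw [h, map_zero] at hp
  have : p = 0 := HahnSeries.ofPowerSeries_injective (Γ := ℤ) (by rw [← hp, map_zero])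
  rw [this] at hc
  simp at hc

theorem res_x_inv_pow (v : Fin k) {m : ℕ} (hm : m ≠ 1) : res v ((x v)⁻¹ ^ m) = 0 := by
  rw [res, map_pow, map_inv₀, laurentExpansion_x_self, HahnSeries.inv_single,
    HahnSeries.single_pow]
  refine HahnSeries.coeff_single_of_ne ?_
  simp only [nsmul_eq_mul]
  omega

theorem res_mul_ratCast (v : Fin k) (c : ℚ) (f : RatFun k) :
    res v ((c : RatFun k) * f) = c * res v f :=
  res_mul_of_mem (Set.mem_univ v) (SubfieldClass.ratCast_mem _ c) f

theorem res_neg (v : Fin k) (f : RatFun k) : res v (-f) = -res v f := by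
  simp [res]

/-- The polynomial (1 - x)^d has degree too small to contain x^(e-1). -/
theorem res_one_sub_pow_mul (v : Fin k) (d e : ℕ) (h : d + 2 ≤ e) :
    res v ((1 - x v) ^ d * (x v)⁻¹ ^ e) = 0 := by
  induction d generalizing e with
  | zero => rw [pow_zero, one_mul]; exact res_x_inv_pow v (by omega)
  | succ d ih =>
    obtain ⟨e, rfl⟩ : ∃ e', e = e' + 1 := ⟨e - 1, by omega⟩
    have : (1 - x v) ^ (d + 1) * (x v)⁻¹ ^ (e + 1)
        = (1 - x v) ^ d * (x v)⁻¹ ^ (e + 1) + -((1 - x v) ^ d * (x v)⁻¹ ^ e) := by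
      rw [pow_succ (1 - x v) d]
      exact field_identity₁ (x_ne_zero v) _ _
    rw [this, res_add, res_neg, ih _ (by omega), ih _ (by omega), neg_zero, add_zero]

/-- This reads off the coefficient of x^m in the geometric series of 1 / (A + B x). -/
theorem res_x_inv_pow_mul_inv {v : Fin k} {A B : RatFun k} (hA : A ∈ fr {v}) (hB : B ∈ fr {v})
    (hA0 : A ≠ 0) (m : ℕ) :
    res v ((x v)⁻¹ ^ (m + 1) * (A + B * x v)⁻¹) = A⁻¹ * (-(B / A)) ^ m := by
  have hv : v ∈ ({v} : Set (Fin k)) := rfl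
  have hreg : RegularAt v (A + B * 0) (A + B * x v) :=
    (RegularAt.of_mem hv hA).add ((RegularAt.of_mem hv hB).mul RegularAt.x)
  rw [mul_zero, add_zero] at hreg
  induction m with
  | zero => simpa using (hreg.inv hA0).res_inv_mul
  | succ m ih =>
    have hne : A + B * x v ≠ 0 := by
      intro h
      obtain ⟨p, hp, hc⟩ := hreg
      rw [h, map_zero] at hp
      have : p = 0 := HahnSeries.ofPowerSeries_injective (Γ := ℤ) (by rw [← hp, map_zero])
      rw [this, map_zero] at hc
      exact hA0 hc.symm
    have : (x v)⁻¹ ^ (m + 1 + 1) * (A + B * x v)⁻¹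
        = A⁻¹ * (x v)⁻¹ ^ (m + 2) + -(B / A) * ((x v)⁻¹ ^ (m + 1) * (A + B * x v)⁻¹) :=
      field_identity₂ (x_ne_zero v) hA0 hne m
    have hBA : -(B / A) ∈ fr {v} := neg_mem (div_mem hB hA)
    rw [this, res_add, res_mul_of_mem hv (inv_mem hA), res_mul_of_mem hv hBA, ih,
      res_x_inv_pow v (by omega)]
    ring

/-! ### Signed substitutions -/

/-- `t` or `1 - t`, according to a sign. -/
def sgnSub {R : Type*} [Ring R] (s : ℤˣ) (t : R) : R := if s = 1 then t else 1 - t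

section sgnSub
variable {R : Type*} [Ring R]

@[simp] theorem sgnSub_one (t : R) : sgnSub 1 t = t := if_pos rfl

@[simp] theorem sgnSub_neg_one (t : R) : sgnSub (-1) t = 1 - t := if_neg (by decide)

theorem sgnSub_neg (s : ℤˣ) (t : R) : sgnSub (-s) t = 1 - sgnSub s t := by
  rcases Int.units_eq_one_or s with rfl | rfl <;> simp

theorem sgnSub_mul (s s' : ℤˣ) (t : R) : sgnSub (s * s') t = sgnSub s (sgnSub s' t) := by
  rcases Int.units_eq_one_or s with rfl | rfl <;>
  rcases Int.units_eq_one_or s' with rfl | rfl <;> simp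

theorem sgnSub_sgnSub (s : ℤˣ) (t : R) : sgnSub s (sgnSub s t) = t := by
  rw [← sgnSub_mul, Int.units_mul_self, sgnSub_one]

theorem map_sgnSub {R' F : Type*} [Ring R'] [FunLike F R R'] [RingHomClass F R R'] (φ : F)
    (s : ℤˣ) (t : R) : φ (sgnSub s t) = sgnSub s (φ t) := by
  rcases Int.units_eq_one_or s with rfl | rfl <;> simp

end sgnSub

theorem sgnSub_mem (K : Subfield (RatFun k)) (s : ℤˣ) {t : RatFun k} (ht : t ∈ K) :
    sgnSub s t ∈ K := by
  rcases Int.units_eq_one_or s with rfl | rfl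
  · simpa using ht
  · simpa using sub_mem (one_mem K) ht

theorem act_algebraMap (g : SignedPerm k) (p : Poly k) :
    g.act (algebraMap (Poly k) (RatFun k) p) = algebraMap (Poly k) (RatFun k) (g.actPoly p) :=
  IsLocalization.map_eq (M := nonZeroDivisors (Poly k)) (T := nonZeroDivisors (Poly k))
    (S := RatFun k) (Q := RatFun k) (g := g.actPoly.toRingHom)
    (nonZeroDivisors_le_comap_nonZeroDivisors_of_injective _ g.actPoly_injective) p

theorem act_x (g : SignedPerm k) (i : Fin k) :
    g.act (x i) = sgnSub (g.2 (g.1 i)) (x (g.1 i)) := by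
  rw [x, act_algebraMap]
  simp only [SignedPerm.actPoly, AlgHom.comp_apply, MvPolynomial.rename_X, signSubst,
    MvPolynomial.aeval_X, sgnSub]
  split_ifs
  · rfl
  · rw [map_sub, map_one]; rfl

theorem ringHom_ext_x {R : Type*} [Field R] {φ ψ : RatFun k →+* R}
    (h : ∀ i, φ (x i) = ψ (x i)) (f : RatFun k) : φ f = ψ f :=
  mem_of_x_mem (φ.eqLocusField ψ) h f

/-- The substitution of `1 - x_v` for `x_v`. -/
def flip (v : Fin k) : RatFun k →+* RatFun k := SignedPerm.act (1, Pi.mulSingle v (-1))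

theorem flip_x_self (v : Fin k) : flip v (x v) = 1 - x v := by
  simp [flip, act_x]

theorem flip_x_of_ne {v i : Fin k} (h : i ≠ v) : flip v (x i) = x i := by
  simp [flip, act_x, h]

theorem flip_of_mem {v : Fin k} {S : Set (Fin k)} (hv : v ∈ S) {f : RatFun k} (hf : f ∈ fr S) :
    flip v f = f := by
  have : fr S ≤ (flip v).eqLocusField (RingHom.id _) := by
    refine Subfield.closure_le.2 ?_
    rintro _ ⟨i, hi, rfl⟩
    exact flip_x_of_ne (fun h => hi (h ▸ hv))
  exact this hf

theorem flip_act (v : Fin k) (g : SignedPerm k) (f : RatFun k) :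
    flip v (g.act f) = SignedPerm.act (g.1, Pi.mulSingle v (-1) * g.2) f := by
  refine ringHom_ext_x (φ := (flip v).comp g.act) (fun i => ?_) f
  rw [RingHom.comp_apply, act_x, act_x, map_sgnSub]
  by_cases h : g.1 i = v
  · subst h
    rw [flip_x_self, ← sgnSub_neg_one (x (g.1 i)), ← sgnSub_mul, mul_comm]
    simp
  · simp [flip_x_of_ne h, h]

/-! ### Functions whose iterated residue is unchanged by a flip -/

/-- The iterated residue of `f` is unchanged when `x_v` is replaced by `1 - x_v`. -/
def FlipInvariant (v : Fin k) (f : RatFun k) : Prop := iterRes (flip v f) = iterRes f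

theorem FlipInvariant.add {v : Fin k} {f g : RatFun k} (hf : FlipInvariant v f)
    (hg : FlipInvariant v g) : FlipInvariant v (f + g) := by
  rw [FlipInvariant, map_add, iterRes_add, iterRes_add, hf, hg]

theorem FlipInvariant.sum {v : Fin k} {ι : Type*} (s : Finset ι) {f : ι → RatFun k}
    (hf : ∀ i ∈ s, FlipInvariant v (f i)) : FlipInvariant v (∑ i ∈ s, f i) := by
  rw [FlipInvariant, map_sum, iterRes_sum, iterRes_sum]
  exact Finset.sum_congr rfl hf

theorem x_mem_compl {v : Fin k} {S : Set (Fin k)} (hv : v ∈ S) : x v ∈ fr Sᶜ :=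
  x_mem_fr (fun h => h hv)

/-- For i ≤ 0 there is no pole at 0; for i ≥ 2 the numerator is a polynomial of degree i - 2, which
has no term x^(i-1). -/
theorem res_monomial_eq_zero (v : Fin k) {i : ℤ} (hi : i ≠ 1) :
    res v (x v ^ (-i) * (1 - x v) ^ (i - 2)) = 0 := by
  have h1 : RegularAt v (1 - 0) (1 - x v) := RegularAt.one.sub RegularAt.x
  rw [sub_zero] at h1
  rcases lt_or_gt_of_ne hi with h | h
  · obtain ⟨m, hm⟩ := Int.eq_ofNat_of_zero_le (show 0 ≤ -i by omega)
    obtain ⟨n, hn⟩ := Int.eq_ofNat_of_zero_le (show 0 ≤ 2 - i by omega)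
    rw [hm, show i - 2 = -(n : ℤ) by omega, zpow_neg, zpow_natCast, zpow_natCast]
    exact ((RegularAt.x.pow m).mul ((h1.pow n).inv (by simp))).res_eq_zero
  · obtain ⟨m, hm⟩ := Int.eq_ofNat_of_zero_le (show 0 ≤ i - 2 by omega)
    rw [hm, show -i = -((m + 2 : ℕ) : ℤ) by push_cast; omega, zpow_neg, zpow_natCast,
      zpow_natCast, ← inv_pow, mul_comm]
    exact res_one_sub_pow_mul v m (m + 2) le_rfl

/-- The flip exchanges i and j. Writing 1 = x + (1 - x) lowers i + j by one, which reduces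
everything to i + j = 2. There both residues vanish, except for i = j = 1, where the function is
symmetric under the flip. -/
theorem flipInvariant_monomial {v : Fin k} {A : RatFun k} (hA : A ∈ fr {v}) (i j : ℤ)
    (hij : 2 ≤ i + j) : FlipInvariant v (A * (x v ^ (-i) * (1 - x v) ^ (-j))) := by
  obtain ⟨n, hn⟩ := Int.eq_ofNat_of_zero_le (show 0 ≤ i + j - 2 by omega)
  induction n generalizing i j with
  | zero =>
    obtain rfl : j = 2 - i := by
      have : (Int.ofNat 0) = 0 := rfl
      omega
    have hx : ∀ a b : ℤ, x v ^ a * (1 - x v) ^ b ∈ fr ({v}ᶜ : Set (Fin k)) := fun a b =>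
      (fr ({v}ᶜ : Set (Fin k))).mul_mem (zpow_mem (x_mem_compl (Set.mem_singleton _)) a)
        (zpow_mem (sub_mem (one_mem _) (x_mem_compl (Set.mem_singleton _))) b)
    rw [FlipInvariant, map_mul, map_mul, map_zpow₀, map_zpow₀, map_sub, map_one, flip_x_self,
      flip_of_mem (Set.mem_singleton v) hA, sub_sub_cancel]
    refine iterRes_mul_congr hA ?_ (hx _ _) ?_
    · rw [mul_comm]
      exact hx _ _
    · by_cases hi : i = 1
      · subst hi
        rw [mul_comm]
        norm_num
      · rw [show -(2 - i) = i - 2 by ring, res_monomial_eq_zero v hi, mul_comm,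
          show i - 2 = -(2 - i) by ring, show -i = (2 - i) - 2 by ring,
          res_monomial_eq_zero v (by omega)]
  | succ n ih =>
    have hn' : ((n + 1 : ℕ) : ℤ) = n + 1 := by push_cast; rfl
    have hn'' : Int.ofNat (n + 1) = n + 1 := rfl
    rw [field_identity₄ (x_ne_zero v) (one_sub_x_ne_zero v)]
    exact (ih _ _ (by omega) (by omega)).add
      (ih _ _ (by omega) (by omega))

/-- The elementary function with a simple pole along `w w' = 1`. -/
def piece (v i : Fin k) (s s' : ℤˣ) : RatFun k :=
  (sgnSub s (x v))⁻¹ * (1 - sgnSub s (x v) * sgnSub s' (x i))⁻¹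

theorem flip_piece {v i : Fin k} (h : i ≠ v) (s s' : ℤˣ) :
    flip v (piece v i s s') = piece v i (-s) s' := by
  simp only [piece, map_mul, map_inv₀, map_sub, map_one, map_sgnSub, flip_x_self, flip_x_of_ne h]
  rw [← sgnSub_neg_one (x v), ← sgnSub_mul, mul_neg, mul_one]

theorem regularAt_sgnSub_neg_one (v : Fin k) : RegularAt v 1 (sgnSub (-1) (x v)) := by
  rw [sgnSub_neg_one]
  simpa using RegularAt.one.sub (RegularAt.x (v := v))

theorem mem_pair_of_singleton {v i : Fin k} {f : RatFun k} (hf : f ∈ fr ({i}ᶜ : Set (Fin k)))  :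
    f ∈ fr ({v, i}ᶜ : Set (Fin k)) :=
  fr_mono (Set.compl_subset_compl.2 (by simp)) hf

theorem x_mem_singleton {v i : Fin k} (h : i ≠ v) : x i ∈ fr ({v} : Set (Fin k)) :=
  x_mem_fr h

theorem piece_mem (v i : Fin k) (s s' : ℤˣ) : piece v i s s' ∈ fr ({v, i}ᶜ : Set (Fin k)) := by
  have h1 := sgnSub_mem (fr ({v, i}ᶜ : Set (Fin k))) s (x_mem_compl (v := v) (by simp))
  have h2 := sgnSub_mem (fr ({v, i}ᶜ : Set (Fin k))) s' (x_mem_compl (v := i) (by simp))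
  exact mul_mem (inv_mem h1) (inv_mem (sub_mem (one_mem _) (mul_mem h1 h2)))

theorem one_sub_sgnSub_x_ne_zero (s : ℤˣ) (i : Fin k) : 1 - sgnSub s (x i) ≠ 0 := by
  rcases Int.units_eq_one_or s with rfl | rfl
  · simpa using one_sub_x_ne_zero i
  · simpa using x_ne_zero i

theorem sgnSub_x_ne_zero (s : ℤˣ) (i : Fin k) : sgnSub s (x i) ≠ 0 := by
  have := one_sub_sgnSub_x_ne_zero (-s) i
  rwa [sgnSub_neg, sub_sub_cancel] at this

theorem mem_fr_of_mem_compl {v i : Fin k} (h : v ≠ i) {f : RatFun k}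
    (hf : f ∈ fr ({i}ᶜ : Set (Fin k))) : f ∈ fr ({v} : Set (Fin k)) :=
  fr_mono (by simpa using h.symm) hf

theorem res_v_mul_piece {v i : Fin k} (hvi : v ≠ i) (s s' : ℤˣ) {ρ : RatFun k}
    (hρ : ρ ∈ fr ({i}ᶜ : Set (Fin k))) :
    res v (ρ * piece v i s s') = if s = 1 then ρ else 0 := by
  have hρ' := mem_fr_of_mem_compl hvi hρ
  have hv : v ∈ ({v} : Set (Fin k)) := rfl
  have hw' : sgnSub s' (x i) ∈ fr ({v} : Set (Fin k)) := sgnSub_mem _ _ (x_mem_singleton hvi.symm)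
  rw [res_mul_of_mem hv hρ']
  rcases Int.units_eq_one_or s with rfl | rfl
  · have h1 := RegularAt.one.sub ((RegularAt.x (v := v)).mul (RegularAt.of_mem hv hw'))
    rw [zero_mul, sub_zero] at h1
    rw [piece, sgnSub_one, (h1.inv one_ne_zero).res_inv_mul]
    simp
  · have h1 := RegularAt.one.sub
      ((regularAt_sgnSub_neg_one v).mul (RegularAt.of_mem hv hw'))
    rw [one_mul] at h1
    rw [piece, (((regularAt_sgnSub_neg_one v).inv one_ne_zero).mul
      (h1.inv (one_sub_sgnSub_x_ne_zero s' i))).res_eq_zero]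
    simp [show (-1 : ℤˣ) ≠ 1 by decide]

theorem res_i_mul_piece_one {v i : Fin k} (hvi : v ≠ i) (s : ℤˣ) {ρ c : RatFun k}
    (hρ : RegularAt i c ρ) : res i (ρ * piece v i s 1) = 0 := by
  have hi : i ∈ ({i} : Set (Fin k)) := rfl
  have hw : sgnSub s (x v) ∈ fr ({i} : Set (Fin k)) := sgnSub_mem _ _ (x_mem_singleton hvi)
  have h1 := RegularAt.one.sub ((RegularAt.of_mem hi hw).mul (RegularAt.x (v := i)))
  rw [mul_zero, sub_zero] at h1
  rw [piece, sgnSub_one]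
  exact (hρ.mul ((RegularAt.of_mem hi (inv_mem hw)).mul (h1.inv one_ne_zero))).res_eq_zero

/-- With w' = x_i the piece has no pole at x_i = 0. Its residue in x_v is ρ or 0, again without a
pole at x_i = 0, so both orders of the residues give zero. -/
theorem iterRes_mul_piece_one {v i : Fin k} (hvi : v ≠ i) (s : ℤˣ) {h ρ c : RatFun k}
    (hh : h ∈ fr {v, i}) (hρ : ρ ∈ fr ({i}ᶜ : Set (Fin k))) (hreg : RegularAt i c ρ) :
    iterRes (h * (ρ * piece v i s 1)) = 0 := by
  refine iterRes_mul_eq_zero hvi hh ((fr ({v, i}ᶜ : Set (Fin k))).mul_mem (mem_pair_of_singleton hρ) (piece_mem v i _ _)) ?_ ?_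
  · rw [res_v_mul_piece hvi _ _ hρ]
    split_ifs
    · exact hreg.res_eq_zero
    · exact res_zero i
  · rw [res_i_mul_piece_one hvi s hreg, res_zero]

/-- The critical case is w' = 1 - x_i, where the power is x_i^(-(m+2)). Taking the residue in x_v
first leaves this power or 0, without residue because m + 2 ≥ 2. Taking it in x_i first gives, up to
sign, w^m / (1 - w)^(m+2): this has no pole at x_v = 0 if w = x_v, and is (1 - x_v)^m x_v^(-(m+2)),
again without residue, if w = 1 - x_v. -/
theorem iterRes_mul_pow_mul_piece {v i : Fin k} (hvi : v ≠ i) (s s' : ℤˣ) {h : RatFun k}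
    (hh : h ∈ fr {v, i}) (m : ℕ) :
    iterRes (h * ((1 - sgnSub s' (x i))⁻¹ ^ (m + 2) * piece v i s s')) = 0 := by
  have hρ : (1 - sgnSub s' (x i))⁻¹ ^ (m + 2) ∈ fr ({i}ᶜ : Set (Fin k)) :=
    pow_mem (inv_mem (sub_mem (one_mem _) (sgnSub_mem _ _ (x_mem_compl (Set.mem_singleton _))))) _
  rcases Int.units_eq_one_or s' with rfl | rfl
  · refine iterRes_mul_piece_one hvi s hh hρ
      (c := 1⁻¹ ^ (m + 2)) (((RegularAt.inv ?_ one_ne_zero)).pow _)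
    simpa using regularAt_sgnSub_neg_one i
  · refine iterRes_mul_eq_zero hvi hh ((fr ({v, i}ᶜ : Set (Fin k))).mul_mem (mem_pair_of_singleton hρ) (piece_mem v i _ _)) ?_ ?_
    · rw [res_v_mul_piece hvi _ _ hρ]
      split_ifs
      · rw [sgnSub_neg_one, sub_sub_cancel]
        exact res_x_inv_pow i (by omega)
      · exact res_zero i
    · have hw : sgnSub s (x v) ∈ fr ({i} : Set (Fin k)) := sgnSub_mem _ _ (x_mem_singleton hvi)
      have hw0 := sgnSub_x_ne_zero s v
      have hw1 := one_sub_sgnSub_x_ne_zero s v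
      have e1 : (1 - sgnSub (-1) (x i))⁻¹ ^ (m + 2) * piece v i s (-1)
          = (sgnSub s (x v))⁻¹ * ((x i)⁻¹ ^ (m + 1 + 1) *
            ((1 - sgnSub s (x v)) + sgnSub s (x v) * x i)⁻¹) := by
        rw [piece, sgnSub_neg_one]
        exact field_identity₅ _ _ m
      rw [e1, res_mul_of_mem (Set.mem_singleton i) (inv_mem hw),
        res_x_inv_pow_mul_inv (sub_mem (one_mem _) hw) hw hw1]
      have e2 : (sgnSub s (x v))⁻¹ * ((1 - sgnSub s (x v))⁻¹ *
          (-(sgnSub s (x v) / (1 - sgnSub s (x v)))) ^ (m + 1))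
          = (((-1) ^ (m + 1) : ℚ) : RatFun k) *
            ((sgnSub s (x v)) ^ m * (1 - sgnSub s (x v))⁻¹ ^ (m + 2)) := by
        push_cast
        exact field_identity₃ hw0 hw1 m
      rw [e2, res_mul_ratCast]
      rcases Int.units_eq_one_or s with rfl | rfl
      · have h2 := regularAt_sgnSub_neg_one v
        rw [sgnSub_neg_one] at h2
        rw [sgnSub_one, ((RegularAt.x.pow m).mul ((h2.inv one_ne_zero).pow _)).res_eq_zero, mul_zero]
      · rw [sgnSub_neg_one, sub_sub_cancel, res_one_sub_pow_mul v m (m + 2) le_rfl, mul_zero]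

end

/-! ### Zeros and exponent bounds of the numerator -/

section

variable {k : ℕ}

/-! ### Products over pairs -/

/-- The product of `Q i j` over the pairs `i < j` in `S`. -/
def pairProd {M : Type*} [CommMonoid M] (S : Finset (Fin k)) (Q : Fin k → Fin k → M) : M :=
  ∏ i ∈ S, ∏ j ∈ S.filter (i < ·), Q i j

/-- `Q` evaluated at the increasing rearrangement of `i, j`. -/
def sortPair {M : Type*} (Q : Fin k → Fin k → M) (i j : Fin k) : M :=
  if i < j then Q i j else Q j i

theorem prod_Ioi_eq_pairProd {M : Type*} [CommMonoid M] (Q : Fin k → Fin k → M) :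
    ∏ i, ∏ j ∈ Finset.Ioi i, Q i j = pairProd Finset.univ Q := by
  refine Finset.prod_congr rfl fun i _ => Finset.prod_congr ?_ fun _ _ => rfl
  ext j
  simp

theorem pairProd_insert {M : Type*} [CommMonoid M] {S : Finset (Fin k)} {p : Fin k} (hp : p ∉ S)
    (Q : Fin k → Fin k → M) :
    pairProd (insert p S) Q = (∏ l ∈ S, sortPair Q p l) * pairProd S Q := by
  have h1 : ∀ i ∈ S, ∏ j ∈ (insert p S).filter (i < ·), Q i j
      = (if p < i then 1 else Q i p) * ∏ j ∈ S.filter (i < ·), Q i j := by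
    intro i hi
    have hne : i ≠ p := fun h => hp (h ▸ hi)
    rw [Finset.filter_insert]
    by_cases h : i < p
    · rw [if_pos h, Finset.prod_insert (by simp [hp]), if_neg (not_lt.2 h.le)]
    · rw [if_neg h, if_pos (lt_of_le_of_ne (not_lt.1 h) hne.symm), one_mul]
  rw [pairProd, Finset.prod_insert hp, Finset.prod_congr rfl h1, Finset.prod_mul_distrib,
    ← mul_assoc, pairProd, Finset.filter_insert, if_neg (lt_irrefl p), Finset.prod_filter,
    ← Finset.prod_mul_distrib]
  congr 1
  refine Finset.prod_congr rfl fun l _ => ?_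
  by_cases h : p < l <;> simp [sortPair, h]

theorem pairProd_univ_split {M : Type*} [CommMonoid M] (p : Fin k) (Q : Fin k → Fin k → M) :
    pairProd Finset.univ Q
      = (∏ l ∈ Finset.univ.erase p, sortPair Q p l) * pairProd (Finset.univ.erase p) Q := by
  conv_lhs => rw [← Finset.insert_erase (Finset.mem_univ p)]
  exact pairProd_insert (by simp) Q

theorem pairProd_univ_split₂ {M : Type*} [CommMonoid M] {p s : Fin k} (hps : p ≠ s)
    (Q : Fin k → Fin k → M) :
    pairProd Finset.univ Q
      = sortPair Q p s * (∏ l ∈ (Finset.univ.erase p).erase s, sortPair Q p l) *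
        (∏ l ∈ (Finset.univ.erase p).erase s, sortPair Q s l) *
          pairProd ((Finset.univ.erase p).erase s) Q := by
  have hs : s ∈ Finset.univ.erase p := by simpa using hps.symm
  rw [pairProd_univ_split p, ← Finset.mul_prod_erase _ _ hs]
  conv_lhs => rw [← Finset.insert_erase hs, pairProd_insert (Finset.notMem_erase _ _)]
  simp only [mul_assoc, Finset.insert_erase hs]

theorem pairProd_congr {M : Type*} [CommMonoid M] {S : Finset (Fin k)} {Q Q' : Fin k → Fin k → M}
    (h : ∀ i ∈ S, ∀ j ∈ S, Q i j = Q' i j) : pairProd S Q = pairProd S Q' :=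
  Finset.prod_congr rfl fun i hi => Finset.prod_congr rfl fun j hj =>
    h i hi j (Finset.mem_filter.1 hj).1

theorem map_pairProd {M N F : Type*} [CommMonoid M] [CommMonoid N] [FunLike F M N]
    [MonoidHomClass F M N] (φ : F) (S : Finset (Fin k)) (Q : Fin k → Fin k → M) :
    φ (pairProd S Q) = pairProd S fun i j => φ (Q i j) := by
  simp only [pairProd, map_prod]

theorem prod_univ_split₂ {M : Type*} [CommMonoid M] {p s : Fin k} (hps : p ≠ s) (f : Fin k → M) :
    ∏ i, f i = f p * f s * ∏ l ∈ (Finset.univ.erase p).erase s, f l := by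
  have hs : s ∈ Finset.univ.erase p := by simpa using hps.symm
  rw [← Finset.mul_prod_erase _ _ (Finset.mem_univ p), ← Finset.mul_prod_erase _ _ hs, mul_assoc]

/-! ### Values of `Phi` -/

/-- The action of a signed permutation on points. -/
def SignedPerm.pt {A : Type*} [Ring A] (g : SignedPerm k) (u : Fin k → A) (i : Fin k) : A :=
  sgnSub (g.2 (g.1 i)) (u (g.1 i))

/-- The pair factor in `phiTerm`. -/
def phiPair {A : Type*} [CommRing A] (u : Fin k → A) (i j : Fin k) : A :=
  (1 - u i * (1 - u j)) * (1 - (1 - u i) * (1 - u j))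

/-- The value of `phiTerm` at a point. -/
def phiTermAt {A : Type*} [CommRing A] (u : Fin k → A) : A :=
  (∏ i : Fin k, (1 - u i) ^ (k - ((i : ℕ) + 1)) * u i ^ k) * pairProd Finset.univ (phiPair u)

/-- The value of `Phi` at a point. -/
def phiAt {A : Type*} [CommRing A] (u : Fin k → A) : A :=
  (-1) ^ k * ∑ g : SignedPerm k, ((g.sgn : ℤ) : A) * phiTermAt (g.pt u)

section
variable {A : Type*} [CommRing A] [Algebra ℚ A]

theorem aeval_phiTerm (u : Fin k → A) : MvPolynomial.aeval u (phiTerm k) = phiTermAt u := by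
  simp [phiTerm, phiTermAt, ← prod_Ioi_eq_pairProd, phiPair]

theorem aeval_actPoly (g : SignedPerm k) (u : Fin k → A) (p : Poly k) :
    MvPolynomial.aeval u (g.actPoly p) = MvPolynomial.aeval (g.pt u) p := by
  have : (MvPolynomial.aeval u).comp g.actPoly = MvPolynomial.aeval (g.pt u) := by
    refine MvPolynomial.algHom_ext fun i => ?_
    simp only [SignedPerm.actPoly, AlgHom.comp_apply, MvPolynomial.rename_X, signSubst,
      MvPolynomial.aeval_X, SignedPerm.pt, sgnSub]
    split_ifs <;> simp
  exact DFunLike.congr_fun this p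

theorem aeval_Phi (u : Fin k → A) : MvPolynomial.aeval u (Phi k) = phiAt u := by
  simp [Phi, phiAt, aeval_actPoly, aeval_phiTerm]

end

section
variable {A : Type*} [CommRing A]

/-- Left multiplication by `h` in the group of signed permutations, spelled out as the bijection
`e`, reindexes the sum and multiplies every sign by that of `h`. -/
theorem phiAt_pt (h : SignedPerm k) (u : Fin k → A) :
    phiAt (h.pt u) = ((h.sgn : ℤ) : A) * phiAt u := by
  let e : SignedPerm k ≃ SignedPerm k :=
    Equiv.prodCongr (Equiv.mulLeft h.1)
      ((Equiv.arrowCongr h.1 (Equiv.refl ℤˣ)).trans (Equiv.mulLeft h.2))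
  have he1 : ∀ g, (e g).1 = h.1 * g.1 := fun _ => rfl
  have he2 : ∀ g m, (e g).2 m = h.2 m * g.2 (h.1.symm m) := fun _ _ => rfl
  have hpt : ∀ g : SignedPerm k, g.pt (h.pt u) = (e g).pt u := by
    intro g
    funext i
    simp only [SignedPerm.pt, he1, he2, Equiv.Perm.mul_apply, Equiv.symm_apply_apply]
    rw [← sgnSub_mul, mul_comm]
  have hsgn : ∀ g : SignedPerm k, ((g.sgn : ℤ) : A) = ((h.sgn : ℤ) : A) * (((e g).sgn : ℤ) : A) := by
    intro g
    have h1 : (e g).sgn = h.sgn * g.sgn := by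
      simp only [SignedPerm.sgn, he1, he2, Equiv.Perm.sign_mul, Finset.prod_mul_distrib]
      rw [Equiv.prod_comp h.1.symm g.2, mul_mul_mul_comm]
    rw [h1, ← Int.cast_mul, ← Units.val_mul, ← mul_assoc, Int.units_mul_self, one_mul]
  rw [phiAt, phiAt, mul_left_comm]
  congr 1
  rw [Finset.mul_sum, ← Equiv.sum_comp e fun g => ((h.sgn : ℤ) : A) * (((g.sgn : ℤ) : A) * phiTermAt (g.pt u))]
  refine Finset.sum_congr rfl fun g _ => ?_
  rw [hpt, hsgn, mul_assoc]

theorem phiAt_update_sgnSub (u : Fin k → A) (v : Fin k) (s : ℤˣ) (a : A) :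
    phiAt (Function.update u v (sgnSub s a)) = ((s : ℤ) : A) * phiAt (Function.update u v a) := by
  have : Function.update u v (sgnSub s a)
      = SignedPerm.pt (1, Pi.mulSingle v s) (Function.update u v a) := by
    funext i
    by_cases h : i = v
    · subst h; simp [SignedPerm.pt]
    · simp [SignedPerm.pt, h]
  rw [this, phiAt_pt]
  simp [SignedPerm.sgn]

theorem map_phiAt {B F : Type*} [CommRing B] [FunLike F A B] [RingHomClass F A B] (φ : F)
    (u : Fin k → A) : φ (phiAt u) = phiAt (φ ∘ u) := by
  have hpt : ∀ g : SignedPerm k, (g.pt (φ ∘ u) : Fin k → B) = φ ∘ g.pt u := fun g => by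
    funext i
    simp [SignedPerm.pt, map_sgnSub]
  have hterm : ∀ w : Fin k → A, φ (phiTermAt w) = phiTermAt (φ ∘ w) := fun w => by
    simp [phiTermAt, map_pairProd, phiPair]
    rfl
  simp [phiAt, hpt, hterm]

end

section
variable {A : Type*} [Field A]

/-- For positions i < j the pair factor vanishes as soon as u_i or 1 - u_i is inverse to 1 - u_j.
Only the later coordinate has to be flipped, hence the free sign `s` on the earlier one. -/
theorem phiTermAt_pt_eq_zero {u : Fin k → A} (g : SignedPerm k) {m m' : Fin k}
    (hlt : g.1.symm m < g.1.symm m') (s : ℤˣ)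
    (h : sgnSub s (u m) * sgnSub (-g.2 m') (u m') = 1) : phiTermAt (g.pt u) = 0 := by
  rw [phiTermAt, ← prod_Ioi_eq_pairProd]
  refine mul_eq_zero_of_right _ ?_
  refine Finset.prod_eq_zero (Finset.mem_univ (g.1.symm m)) ?_
  refine Finset.prod_eq_zero (Finset.mem_Ioi.2 hlt) ?_
  simp only [phiPair, SignedPerm.pt, Equiv.apply_symm_apply, ← sgnSub_neg]
  rcases Int.units_eq_one_or (s * g.2 m) with hs | hs
  · have : s = g.2 m := by
      rw [← mul_one s, ← Int.units_mul_self (g.2 m), ← mul_assoc, hs, one_mul]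
    rw [← this, h, sub_self, zero_mul]
  · have : s = -g.2 m := by
      rw [← mul_one s, ← Int.units_mul_self (g.2 m), ← mul_assoc, hs, neg_one_mul]
    rw [← this, h, sub_self, mul_zero]

/-- Every summand vanishes separately. Whichever of the three coordinates a signed permutation puts
in the last place, it occurs in two of the relations with opposite signs, and one of these is the
relation that kills a pair factor. -/
theorem phiAt_eq_zero_of_wheel {u : Fin k → A} {i j l : Fin k} (hij : i ≠ j) (hil : i ≠ l)
    (hjl : j ≠ l) {s t r : ℤˣ} (h1 : sgnSub s (u i) * sgnSub t (u j) = 1)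
    (h2 : sgnSub (-s) (u i) * sgnSub r (u l) = 1)
    (h3 : sgnSub (-t) (u j) * sgnSub (-r) (u l) = 1) : phiAt u = 0 := by
  rw [phiAt]
  refine mul_eq_zero_of_right _ (Finset.sum_eq_zero fun g _ => mul_eq_zero_of_right _ ?_)
  have key : ∀ {a b c : Fin k} {p q : ℤˣ}, g.1.symm b < g.1.symm a → g.1.symm c < g.1.symm a →
      ∀ w : ℤˣ, sgnSub p (u b) * sgnSub w (u a) = 1 → sgnSub q (u c) * sgnSub (-w) (u a) = 1 →
      phiTermAt (g.pt u) = 0 := by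
    intro a b c p q hb hc w hp hq
    rcases Int.units_eq_one_or (w * g.2 a) with hs | hs
    · have : w = g.2 a := by
        rw [← mul_one w, ← Int.units_mul_self (g.2 a), ← mul_assoc, hs, one_mul]
      exact phiTermAt_pt_eq_zero g hc q (by rwa [← this])
    · have : -g.2 a = w := by
        rw [← mul_one w, ← Int.units_mul_self (g.2 a), ← mul_assoc, hs, neg_one_mul]
      exact phiTermAt_pt_eq_zero g hb p (by rwa [this])
  have nij : g.1.symm i ≠ g.1.symm j := fun h => hij (g.1.symm.injective h)
  have nil : g.1.symm i ≠ g.1.symm l := fun h => hil (g.1.symm.injective h)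
  have njl : g.1.symm j ≠ g.1.symm l := fun h => hjl (g.1.symm.injective h)
  rcases lt_or_gt_of_ne nij with hlt | hlt
  · rcases lt_or_gt_of_ne njl with hlt' | hlt'
    · exact key (a := l) (hlt.trans hlt') hlt' r h2 h3
    · exact key (a := j) hlt hlt' t h1 (by rwa [mul_comm])
  · rcases lt_or_gt_of_ne nil with hlt' | hlt'
    · exact key (a := l) hlt' (hlt.trans hlt') r h2 h3
    · exact key (a := i) hlt hlt' s (by rwa [mul_comm]) (by rwa [mul_comm])

variable [CharZero A]

theorem phiAt_eq_zero_of_pt_eq {u : Fin k → A} (h : SignedPerm k) (hs : h.sgn = -1)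
    (hu : h.pt u = u) : phiAt u = 0 := by
  have := phiAt_pt h u
  rw [hu, hs] at this
  push_cast at this
  linear_combination (1 / 2 : A) * this

theorem phiAt_eq_zero_of_half {u : Fin k → A} {i : Fin k} (h : u i = 1 - u i) : phiAt u = 0 := by
  refine phiAt_eq_zero_of_pt_eq (1, Pi.mulSingle i (-1)) (by simp [SignedPerm.sgn]) ?_
  funext m
  by_cases hm : m = i
  · subst hm; simpa [SignedPerm.pt] using h.symm
  · simp [SignedPerm.pt, hm]

theorem phiAt_eq_zero_of_coincidence {u : Fin k → A} {i j : Fin k} (hij : i ≠ j) {s : ℤˣ}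
    (h : u i = sgnSub s (u j)) : phiAt u = 0 := by
  have h' : u j = sgnSub s (u i) := by rw [h, sgnSub_sgnSub]
  refine phiAt_eq_zero_of_pt_eq (Equiv.swap i j, Pi.mulSingle i s * Pi.mulSingle j s) ?_ ?_
  · simp [SignedPerm.sgn, Equiv.Perm.sign_swap hij, Finset.prod_mul_distrib]
  · funext m
    by_cases hmi : m = i
    · subst hmi
      simp [SignedPerm.pt, hij.symm, ← h]
    · by_cases hmj : m = j
      · subst hmj
        simp [SignedPerm.pt, hij, ← h']
      · simp [SignedPerm.pt, Equiv.swap_apply_of_ne_of_ne hmi hmj, hmi, hmj]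

/-- If u_i enters both relations with the same sign, then u_j and u_l agree up to a flip and
antisymmetry applies. If it enters with opposite signs, the partners are 1/a and 1/(1-a), whose
complements multiply to 1; this is the third relation of the wheel. -/
theorem phiAt_eq_zero_of_two_pairs {u : Fin k → A} {i j l : Fin k} (hij : i ≠ j) (hil : i ≠ l)
    (hjl : j ≠ l) {s t s' r : ℤˣ} (h1 : sgnSub s (u i) * sgnSub t (u j) = 1)
    (h2 : sgnSub s' (u i) * sgnSub r (u l) = 1) : phiAt u = 0 := by
  rcases Int.units_eq_one_or (s' * s) with hs | hs
  · have : s' = s := by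
      rw [← mul_one s', ← Int.units_mul_self s, ← mul_assoc, hs, one_mul]
    subst this
    have h0 : sgnSub s' (u i) ≠ 0 := left_ne_zero_of_mul_eq_one h1
    have h3 : sgnSub t (u j) = sgnSub r (u l) := mul_left_cancel₀ h0 (h1.trans h2.symm)
    refine phiAt_eq_zero_of_coincidence hjl (s := t * r) ?_
    rw [sgnSub_mul, ← h3, sgnSub_sgnSub]
  · have : s' = -s := by
      rw [← mul_one s', ← Int.units_mul_self s, ← mul_assoc, hs, neg_one_mul]
    subst this
    refine phiAt_eq_zero_of_wheel hij hil hjl h1 h2 ?_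
    rw [sgnSub_neg] at h2
    rw [sgnSub_neg, sgnSub_neg]
    generalize sgnSub s (u i) = a at *
    generalize sgnSub t (u j) = b at *
    generalize sgnSub r (u l) = c at *
    have ha : a ≠ 0 := left_ne_zero_of_mul_eq_one h1
    have ha1 : 1 - a ≠ 0 := left_ne_zero_of_mul_eq_one h2
    have e1 : b = 1 / a := by rw [eq_div_iff ha, mul_comm]; exact h1
    have e2 : c = 1 / (1 - a) := by rw [eq_div_iff ha1, mul_comm]; exact h2
    rw [e1, e2]
    field_simp
    ring

end

end

section

variable {k : ℕ}

/-! ### Laurent polynomial functions with bounded exponents -/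

open Polynomial in
/-- `f` is on `E \ {0}` a Laurent polynomial function over `K` with exponents in `[e, t]`. -/
def LaurentBdd (K : Type*) {E : Type*} [Field K] [Field E] [Algebra K E] (e t : ℤ) (f : E → E) :
    Prop :=
  ∃ P : K[X], (P.natDegree : ℤ) ≤ t - e ∧ ∀ a, a ≠ 0 → f a = a ^ e * aeval a P

namespace LaurentBdd

open Polynomial

variable {K E : Type*} [Field K] [Field E] [Algebra K E] {e t e' t' : ℤ} {f g : E → E}

theorem const (c : K) : LaurentBdd K 0 0 (fun _ : E => algebraMap K E c) :=
  ⟨C c, by simp, fun a _ => by simp⟩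

theorem one : LaurentBdd K 0 0 (fun _ : E => (1 : E)) := by simpa using const (E := E) (1 : K)

theorem congr (hf : LaurentBdd K e t f) (h : ∀ a, a ≠ 0 → g a = f a) : LaurentBdd K e t g := by
  obtain ⟨P, hP, hf⟩ := hf
  exact ⟨P, hP, fun a ha => (h a ha).trans (hf a ha)⟩

theorem mul (hf : LaurentBdd K e t f) (hg : LaurentBdd K e' t' g) :
    LaurentBdd K (e + e') (t + t') (fun a => f a * g a) := by
  obtain ⟨P, hP, hf⟩ := hf
  obtain ⟨Q, hQ, hg⟩ := hg
  refine ⟨P * Q, ?_, fun a ha => ?_⟩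
  · have := natDegree_mul_le (p := P) (q := Q)
    omega
  · dsimp only
    rw [hf a ha, hg a ha, map_mul, zpow_add₀ ha]
    ring

theorem mono (hf : LaurentBdd K e t f) (he : e' ≤ e) (ht : t ≤ t') : LaurentBdd K e' t' f := by
  obtain ⟨P, hP, hf⟩ := hf
  refine ⟨P * X ^ (e - e').toNat, ?_, fun a ha => ?_⟩
  · have h1 := natDegree_mul_le (p := P) (q := X ^ (e - e').toNat)
    have h2 := natDegree_X_pow_le (R := K) (e - e').toNat
    omega
  · rw [hf a ha, map_mul, map_pow, aeval_X, ← zpow_natCast, Int.toNat_of_nonneg (by omega),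
      mul_left_comm, mul_comm, ← zpow_add₀ ha]
    congr 2
    omega

theorem add (hf : LaurentBdd K e t f) (hg : LaurentBdd K e t g) :
    LaurentBdd K e t (fun a => f a + g a) := by
  obtain ⟨P, hP, hf⟩ := hf
  obtain ⟨Q, hQ, hg⟩ := hg
  refine ⟨P + Q, ?_, fun a ha => ?_⟩
  · have := natDegree_add_le P Q
    omega
  · dsimp only
    rw [hf a ha, hg a ha, map_add, mul_add]

theorem sum {ι : Type*} (s : Finset ι) {f : ι → E → E} (h : e ≤ t)
    (hf : ∀ i ∈ s, LaurentBdd K e t (f i)) : LaurentBdd K e t (fun a => ∑ i ∈ s, f i a) := by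
  classical
  induction s using Finset.induction_on with
  | empty => exact ⟨0, by simp; omega, by simp⟩
  | insert i s hi ih =>
    simp only [Finset.sum_insert hi]
    exact (hf i (Finset.mem_insert_self i s)).add
      (ih fun j hj => hf j (Finset.mem_insert_of_mem hj))

theorem prod {ι : Type*} (s : Finset ι) {f : ι → E → E} {e t : ι → ℤ}
    (hf : ∀ i ∈ s, LaurentBdd K (e i) (t i) (f i)) :
    LaurentBdd K (∑ i ∈ s, e i) (∑ i ∈ s, t i) (fun a => ∏ i ∈ s, f i a) := by
  classical
  induction s using Finset.induction_on with
  | empty => simpa using one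
  | insert i s hi ih =>
    simp only [Finset.prod_insert hi, Finset.sum_insert hi]
    exact (hf i (Finset.mem_insert_self i s)).mul
      (ih fun j hj => hf j (Finset.mem_insert_of_mem hj))

theorem prod_const (s : Finset (Fin k)) {f : Fin k → E → E} 
    (hf : ∀ i ∈ s, LaurentBdd K e t (f i)) :
    LaurentBdd K (s.card * e) (s.card * t) (fun a => ∏ i ∈ s, f i a) := by
  have := prod s (e := fun _ => e) (t := fun _ => t) hf
  simpa using this

theorem pow (hf : LaurentBdd K e t f) (n : ℕ) :
    LaurentBdd K (n * e) (n * t) (fun a => f a ^ n) := by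
  induction n with
  | zero => simpa using one
  | succ n ih =>
    have := ih.mul hf
    simp only [pow_succ]
    refine this.mono (le_of_eq ?_) (le_of_eq ?_) <;> push_cast <;> ring

theorem one_sub (hf : LaurentBdd K e t f) (he : e ≤ 0) (ht : 0 ≤ t) :
    LaurentBdd K e t (fun a => 1 - f a) := by
  have := ((one (K := K) (E := E)).mono he ht).add
    (((const (E := E) (-1 : K)).mul hf).mono (by omega) (by omega))
  refine this.congr fun a _ => ?_
  rw [map_neg, map_one]
  ring

theorem id : LaurentBdd K 1 1 (fun a : E => a) := ⟨1, by simp, fun a _ => by simp⟩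

theorem inv : LaurentBdd K (-1) (-1) (fun a : E => a⁻¹) := ⟨1, by simp, fun a _ => by simp⟩

theorem one_sub_id : LaurentBdd K 0 1 (fun a : E => 1 - a) :=
  (id.mono (by omega) le_rfl).one_sub le_rfl (by omega)

theorem one_sub_inv : LaurentBdd K (-1) 0 (fun a : E => 1 - a⁻¹) :=
  (inv.mono le_rfl (by omega)).one_sub (by omega) le_rfl

theorem sgnSub (hf : LaurentBdd K e t f) (he : e ≤ 0) (ht : 0 ≤ t) (s : ℤˣ) :
    LaurentBdd K e t (fun a => sgnSub s (f a)) := by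
  rcases Int.units_eq_one_or s with rfl | rfl
  · simpa using hf
  · simpa using hf.one_sub he ht

end LaurentBdd

section
variable {K E : Type*} [Field K] [Field E] [Algebra K E]

theorem laurentBdd_phiPair {u w : E → E} {e t e' t' : ℤ}
    (hu : LaurentBdd K e t u) (hw : LaurentBdd K e' t' w) (he : e ≤ 0) (he' : e' ≤ 0)
    (ht : 0 ≤ t) (ht' : 0 ≤ t') :
    LaurentBdd K (2 * (e + e')) (2 * (t + t'))
      (fun a => (1 - u a * (1 - w a)) * (1 - (1 - u a) * (1 - w a))) := by
  have h1 := (hu.mul (hw.one_sub he' ht')).one_sub (by omega) (by omega)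
  have h2 := ((hu.one_sub he ht).mul (hw.one_sub he' ht')).one_sub (by omega) (by omega)
  exact (h1.mul h2).mono (by omega) (by omega)

theorem laurentBdd_sortPair {X : E → Fin k → E} {i j : Fin k} {e t e' t' : ℤ}
    (hu : LaurentBdd K e t (fun a => X a i)) (hw : LaurentBdd K e' t' (fun a => X a j))
    (he : e ≤ 0) (he' : e' ≤ 0) (ht : 0 ≤ t) (ht' : 0 ≤ t') :
    LaurentBdd K (2 * (e + e')) (2 * (t + t')) (fun a => sortPair (phiPair (X a)) i j) := by
  by_cases h : i < j
  · simp only [sortPair, h, if_true]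
    exact laurentBdd_phiPair hu hw he he' ht ht'
  · simp only [sortPair, h, if_false, add_comm e, add_comm t]
    exact laurentBdd_phiPair hw hu he' he ht' ht

theorem laurentBdd_pairProd {X : E → Fin k → E} (S : Finset (Fin k))
    (hX : ∀ i ∈ S, LaurentBdd K 0 0 (fun a => X a i)) :
    LaurentBdd K 0 0 (fun a => pairProd S (phiPair (X a))) := by
  have h1 : ∀ i ∈ S, ∀ j ∈ S.filter (i < ·), LaurentBdd K 0 0 (fun a => phiPair (X a) i j) :=
    fun i hi j hj => laurentBdd_phiPair (hX i hi) (hX j (Finset.mem_filter.1 hj).1) le_rfl le_rfl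
      le_rfl le_rfl
  have := LaurentBdd.prod_const S (f := fun i a => ∏ j ∈ S.filter (i < ·), phiPair (X a) i j)
    (e := 0) (t := 0) fun i hi => by simpa using LaurentBdd.prod_const _ (h1 i hi)
  simp only [mul_zero] at this
  exact this

/-- The factor of position p has degree at most 2k - 1 in the variable, and the k - 1 pair factors
containing p have degree at most 2 each. -/
theorem laurentBdd_phiTermAt_one {X : E → Fin k → E} (p : Fin k) {s : ℤˣ}
    (hp : ∀ a, X a p = sgnSub s a)
    (hX : ∀ i, i ≠ p → LaurentBdd K 0 0 (fun a => X a i)) :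
    LaurentBdd K 0 (4 * k - 3) (fun a => phiTermAt (X a)) := by
  have hXp : LaurentBdd K 0 1 (fun a => X a p) := by
    simp only [hp]
    exact (LaurentBdd.id.mono (by omega) le_rfl).sgnSub le_rfl (by omega) s
  have hk : ((k - 1 : ℕ) : ℤ) = k - 1 := by have := p.pos; omega
  have h1 : LaurentBdd K 0 0 (fun a => ∏ i ∈ Finset.univ.erase p,
      ((1 - X a i) ^ (k - ((i : ℕ) + 1)) * X a i ^ k)) := by
    simpa using LaurentBdd.prod_const (Finset.univ.erase p) (e := 0) (t := 0) fun i hi => by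
      have := hX i (Finset.ne_of_mem_erase hi)
      simpa using ((this.one_sub le_rfl le_rfl).pow (k - ((i : ℕ) + 1))).mul (this.pow k)
  have h2 := ((hXp.one_sub le_rfl (by omega)).pow (k - ((p : ℕ) + 1))).mul (hXp.pow k)
  have h3 := LaurentBdd.prod_const (Finset.univ.erase p)
    (f := fun l a => sortPair (phiPair (X a)) p l) (e := 0) (t := 2) fun l hl => by
      simpa using laurentBdd_sortPair hXp (hX l (Finset.ne_of_mem_erase hl)) le_rfl le_rfl
        (by omega) le_rfl
  have h4 := laurentBdd_pairProd (Finset.univ.erase p) fun i hi =>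
    hX i (Finset.ne_of_mem_erase hi)
  rw [Finset.card_erase_of_mem (Finset.mem_univ p), Finset.card_univ, Fintype.card_fin, hk] at h3
  have hp' := p.isLt
  refine (((h2.mul h1).mul (h3.mul h4)).mono ?_ ?_).congr fun a _ => ?_
  · simp
  · push_cast [Nat.cast_sub (show (p : ℕ) + 1 ≤ k by omega)]
    omega
  · rw [phiTermAt, pairProd_univ_split p, Finset.mul_prod_erase Finset.univ
      (fun i => (1 - X a i) ^ (k - ((i : ℕ) + 1)) * X a i ^ k) (Finset.mem_univ p)]

theorem laurentBdd_phiAt_one (y : Fin k → K) (v : Fin k) :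
    LaurentBdd K 0 (4 * k - 3)
      (fun a : E => phiAt (Function.update (fun i => algebraMap K E (y i)) v a)) := by
  have hk : (1 : ℤ) ≤ k := by have := v.pos; omega
  have h := LaurentBdd.sum (K := K) (E := E) (e := 0) (t := 4 * k - 3)
    (Finset.univ : Finset (SignedPerm k))
    (f := fun g a => algebraMap K E (((g.sgn : ℤ) : K)) *
      phiTermAt (g.pt (Function.update (fun i => algebraMap K E (y i)) v a))) (by omega)
    fun g _ => by
      refine ((LaurentBdd.const _).mul (laurentBdd_phiTermAt_one (g.1.symm v) (s := g.2 v)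
        (fun a => by simp [SignedPerm.pt]) fun i hi => ?_)).mono (by omega) (by omega)
      have : g.1 i ≠ v := fun h => hi (by rw [← h, Equiv.symm_apply_apply])
      simp only [SignedPerm.pt, Function.update_of_ne this, ← map_sgnSub]
      exact LaurentBdd.const _
  refine (((LaurentBdd.const ((-1) ^ k : K)).mul h).mono (by omega) (by omega)).congr fun a _ => ?_
  simp [phiAt]

/-- The bound for one summand, on the locus where two coordinates are inverse to each other. -/
theorem laurentBdd_phiTermAt_two {X : E → Fin k → E} {p s : Fin k} (hps : p ≠ s) {ep es : ℤˣ}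
    (hp : ∀ a, X a p = sgnSub ep a) (hs : ∀ a, X a s = sgnSub es a⁻¹)
    (hX : ∀ i, i ≠ p → i ≠ s → LaurentBdd K 0 0 (fun a => X a i))
    (h : if p < s then es = 1 else ep = 1) :
    LaurentBdd K (-(3 * k - 3)) (3 * k - 3) (fun a => phiTermAt (X a)) := by
  have hXp : LaurentBdd K 0 1 (fun a => X a p) := by
    simp only [hp]
    exact (LaurentBdd.id.mono (by omega) le_rfl).sgnSub le_rfl (by omega) ep
  have hXs : LaurentBdd K (-1) 0 (fun a => X a s) := by
    simp only [hs]
    exact (LaurentBdd.inv.mono le_rfl (by omega)).sgnSub (by omega) le_rfl es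
  set R := (Finset.univ.erase p).erase s with hR
  have hRp : ∀ i ∈ R, i ≠ p := fun i hi => Finset.ne_of_mem_erase (Finset.mem_of_mem_erase hi)
  have hRs : ∀ i ∈ R, i ≠ s := fun i hi => Finset.ne_of_mem_erase hi
  have hcard : (R.card : ℤ) = k - 2 := by
    have h1 : R.card = k - 1 - 1 := by
      rw [hR, Finset.card_erase_of_mem (by simpa using hps.symm),
        Finset.card_erase_of_mem (Finset.mem_univ p), Finset.card_univ, Fintype.card_fin]
    have h2 : (p : ℕ) ≠ s := fun h => hps (Fin.ext h)
    have := p.isLt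
    have := s.isLt
    omega
  have h1 : LaurentBdd K 0 0 (fun a => ∏ i ∈ R,
      ((1 - X a i) ^ (k - ((i : ℕ) + 1)) * X a i ^ k)) := by
    simpa using LaurentBdd.prod_const R (e := 0) (t := 0) fun i hi => by
      have := hX i (hRp i hi) (hRs i hi)
      simpa using ((this.one_sub le_rfl le_rfl).pow (k - ((i : ℕ) + 1))).mul (this.pow k)
  have h3 := LaurentBdd.prod_const R
    (f := fun l a => sortPair (phiPair (X a)) p l) (e := 0) (t := 2) fun l hl => by
      simpa using laurentBdd_sortPair hXp (hX l (hRp l hl) (hRs l hl)) le_rfl le_rfl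
        (by omega) le_rfl
  have h4 := LaurentBdd.prod_const R
    (f := fun l a => sortPair (phiPair (X a)) s l) (e := -2) (t := 0) fun l hl => by
      simpa using laurentBdd_sortPair hXs (hX l (hRp l hl) (hRs l hl)) (by omega) le_rfl
        le_rfl le_rfl
  have h5 := laurentBdd_pairProd R fun i hi => hX i (hRp i hi) (hRs i hi)
  rw [hcard] at h3 h4
  have hp' := p.isLt
  have hs' := s.isLt
  have cp : ((k - ((p : ℕ) + 1) : ℕ) : ℤ) = k - p - 1 := by omega
  have cs : ((k - ((s : ℕ) + 1) : ℕ) : ℤ) = k - s - 1 := by omega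
  -- The k - 2 other coordinates contribute exponents between -2(k-2) and 2(k-2); what remains are
  -- the two one-variable factors and the pair factor of p and s.
  have main : ∃ e1 t1 e2 t2 e3 t3 : ℤ,
      LaurentBdd K e1 t1 (fun a => (1 - X a p) ^ (k - ((p : ℕ) + 1)) * X a p ^ k) ∧
      LaurentBdd K e2 t2 (fun a => (1 - X a s) ^ (k - ((s : ℕ) + 1)) * X a s ^ k) ∧
      LaurentBdd K e3 t3 (fun a => sortPair (phiPair (X a)) p s) ∧
      -(3 * k - 3) ≤ e1 + e2 + e3 - 2 * (k - 2) ∧ t1 + t2 + t3 + 2 * (k - 2) ≤ 3 * (k : ℤ) - 3 := by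
    -- Since a · a⁻¹ = 1, the pair factor of p and s simplifies to a product of two of these three
    -- functions. Treating its coordinates as independent would give too wide a range of exponents.
    have q1 : LaurentBdd K 0 1 (fun a : E => 1 + (1 - a)) := by
      simpa using ((LaurentBdd.one (K := K) (E := E)).mono le_rfl (by omega)).add
        (LaurentBdd.one_sub_id (K := K) (E := E))
    have q2 : LaurentBdd K (-1) 1 (fun a : E => 1 - (1 - a) * (1 - a⁻¹)) :=
      (LaurentBdd.one_sub_id.mul LaurentBdd.one_sub_inv).one_sub (by omega) (by omega)
    have q3 : LaurentBdd K (-1) 0 (fun a : E => 1 - a⁻¹ * (1 - a)) :=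
      (LaurentBdd.inv.mul LaurentBdd.one_sub_id).one_sub (by omega) (by omega)
    split_ifs at h with hlt
    · subst h
      have hlt' : (p : ℕ) < s := hlt
      refine ⟨k - p - 1, 2 * k - p - 1, -(2 * k - s - 1), -k, -1, 2, ?_, ?_, ?_, by omega, by omega⟩
      · simp only [hp]
        rcases Int.units_eq_one_or ep with rfl | rfl
        · simp only [sgnSub_one]
          refine ((LaurentBdd.one_sub_id.pow _).mul (LaurentBdd.id.pow k)).mono ?_ ?_ <;>
            rw [cp] <;> omega
        · simp only [sgnSub_neg_one, sub_sub_cancel]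
          refine ((LaurentBdd.id.pow _).mul (LaurentBdd.one_sub_id.pow k)).mono ?_ ?_ <;>
            rw [cp] <;> omega
      · simp only [hs, sgnSub_one]
        refine ((LaurentBdd.one_sub_inv.pow _).mul (LaurentBdd.inv.pow k)).mono ?_ ?_ <;>
          rw [cs] <;> omega
      · refine ((q1.mul q2).mono (by omega) (by omega)).congr fun a ha => ?_
        simp only [sortPair, hlt, if_true, phiPair, hp, hs, sgnSub_one]
        rcases Int.units_eq_one_or ep with rfl | rfl
        · simp only [sgnSub_one]
          rw [mul_sub a, mul_inv_cancel₀ ha]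
          ring
        · simp only [sgnSub_neg_one, sub_sub_cancel]
          rw [mul_sub a, mul_inv_cancel₀ ha]
          ring
    · subst h
      have hlt' : (s : ℕ) < p := lt_of_le_of_ne (not_lt.1 hlt) (fun h => hps (Fin.ext h.symm))
      refine ⟨k, 2 * k - p - 1, -(2 * k - s - 1), -(k - s - 1), -2, 1, ?_, ?_, ?_, by omega,
        by omega⟩
      · simp only [hp, sgnSub_one]
        refine ((LaurentBdd.one_sub_id.pow _).mul (LaurentBdd.id.pow k)).mono ?_ ?_ <;>
          rw [cp] <;> omega
      · simp only [hs]
        rcases Int.units_eq_one_or es with rfl | rfl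
        · simp only [sgnSub_one]
          refine ((LaurentBdd.one_sub_inv.pow _).mul (LaurentBdd.inv.pow k)).mono ?_ ?_ <;>
            rw [cs] <;> omega
        · simp only [sgnSub_neg_one, sub_sub_cancel]
          refine ((LaurentBdd.inv.pow _).mul (LaurentBdd.one_sub_inv.pow k)).mono ?_ ?_ <;>
            rw [cs] <;> omega
      · refine ((q3.mul q2).mono (by omega) (by omega)).congr fun a ha => ?_
        simp only [sortPair, hlt, if_false, phiPair, hp, hs, sgnSub_one]
        rcases Int.units_eq_one_or es with rfl | rfl
        · simp only [sgnSub_one]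
          ring
        · simp only [sgnSub_neg_one, sub_sub_cancel]
          ring
  obtain ⟨e1, t1, e2, t2, e3, t3, m1, m2, m3, he, ht⟩ := main
  refine ((((m1.mul m2).mul h1).mul (((m3.mul h3).mul h4).mul h5)).mono ?_ ?_).congr fun a _ => ?_
  · linarith
  · linarith
  · rw [phiTermAt, pairProd_univ_split₂ hps, prod_univ_split₂ hps]

theorem laurentBdd_phiAt_two [CharZero E] (y : Fin k → K) {p s : Fin k} (hps : p ≠ s) :
    LaurentBdd K (-(3 * k - 3)) (3 * k - 3)
      (fun a : E => phiAt (Function.update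
        (Function.update (fun i => algebraMap K E (y i)) p a) s a⁻¹)) := by
  have hk : (1 : ℤ) ≤ k := by have := p.pos; omega
  set U : E → Fin k → E := fun a => Function.update
        (Function.update (fun i => algebraMap K E (y i)) p a) s a⁻¹ with hU
  have hUp : ∀ a, U a p = a := fun a => by simp [hU, hps]
  have hUs : ∀ a, U a s = a⁻¹ := fun a => by simp [hU]
  have h := LaurentBdd.sum (K := K) (E := E) (e := -(3 * k - 3)) (t := 3 * k - 3)
    (Finset.univ : Finset (SignedPerm k))
    (f := fun g a => algebraMap K E (((g.sgn : ℤ) : K)) * phiTermAt (g.pt (U a))) (by omega)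
    fun g _ => by
      have hne : g.1.symm p ≠ g.1.symm s := fun h => hps (g.1.symm.injective h)
      have hgp : ∀ a, g.pt (U a) (g.1.symm p) = sgnSub (g.2 p) a := fun a => by
        simp [SignedPerm.pt, hUp]
      have hgs : ∀ a, g.pt (U a) (g.1.symm s) = sgnSub (g.2 s) a⁻¹ := fun a => by
        simp [SignedPerm.pt, hUs]
      have hgi : ∀ i, i ≠ g.1.symm p → i ≠ g.1.symm s →
          LaurentBdd K 0 0 (fun a => g.pt (U a) i) := by
        intro i hi hi'
        have h1 : g.1 i ≠ p := fun h => hi (by rw [← h, Equiv.symm_apply_apply])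
        have h2 : g.1 i ≠ s := fun h => hi' (by rw [← h, Equiv.symm_apply_apply])
        simp only [SignedPerm.pt, hU, Function.update_of_ne h1, Function.update_of_ne h2,
          ← map_sgnSub]
        exact LaurentBdd.const _
      suffices hg : LaurentBdd K (-(3 * k - 3)) (3 * k - 3) (fun a => phiTermAt (g.pt (U a))) from
        ((LaurentBdd.const _).mul hg).mono (by omega) (by omega)
      -- If the later of the two special coordinates is flipped, then its complement is inverse to
      -- the earlier one or to the complement of that, and the summand is identically zero. All
      -- other summands satisfy the sign condition needed for the bound.
      by_cases h : if g.1.symm p < g.1.symm s then g.2 s = 1 else g.2 p = 1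
      · exact laurentBdd_phiTermAt_two hne hgp hgs hgi h
      · refine ((LaurentBdd.const (0 : K)).mono (by omega) (by omega)).congr fun a ha => ?_
        rw [map_zero]
        split_ifs at h with hlt
        · have h' : g.2 s = -1 := (Int.units_eq_one_or _).resolve_left h
          exact phiTermAt_pt_eq_zero g hlt 1 (by simp [h', hUp, hUs, ha])
        · have h' : g.2 p = -1 := (Int.units_eq_one_or _).resolve_left h
          exact phiTermAt_pt_eq_zero g (lt_of_le_of_ne (not_lt.1 hlt) hne.symm) 1
            (by simp [h', hUp, hUs, ha])
  refine (((LaurentBdd.const ((-1) ^ k : K)).mul h).mono (by omega) (by omega)).congr fun a _ => ?_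
  simp [phiAt, hU]

end

end

section

variable {k : ℕ}

/-! ### Divisibility of `Phi` on the locus where two coordinates are inverse to each other -/

open Polynomial

/-- The six anharmonic functions. -/
def mob {K : Type*} [Field K] (t : Fin 6) (y : K) : K :=
  match t with
  | 0 => y
  | 1 => 1 - y
  | 2 => y⁻¹
  | 3 => (1 - y)⁻¹
  | 4 => 1 - (1 - y)⁻¹
  | 5 => 1 - y⁻¹

theorem map_mob {K E : Type*} [Field K] [Field E] (φ : K →+* E) (t : Fin 6) (y : K) :
    φ (mob t y) = mob t (φ y) := by
  fin_cases t <;> simp [mob]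

/-- The anharmonic transforms of the `y l`, for `l ∈ R`, are all distinct and not `1/2`. -/
structure GenericOn {K : Type*} [Field K] (R : Finset (Fin k)) (y : Fin k → K) : Prop where
  ne_zero : ∀ l ∈ R, y l ≠ 0
  ne_one : ∀ l ∈ R, 1 - y l ≠ 0
  ne_half : ∀ l ∈ R, ∀ t, mob t (y l) ≠ 2⁻¹
  inj : ∀ l ∈ R, ∀ l' ∈ R, ∀ t t', mob t (y l) = mob t' (y l') → l = l' ∧ t = t'

theorem mob_ne_zero {K : Type*} [Field K] {y : K} (h0 : y ≠ 0) (h1 : 1 - y ≠ 0) (t : Fin 6) :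
    mob t y ≠ 0 := by
  fin_cases t
  · exact h0
  · exact h1
  · exact inv_ne_zero h0
  · exact inv_ne_zero h1
  · change 1 - (1 - y)⁻¹ ≠ 0
    intro h
    rw [sub_eq_zero, eq_comm, inv_eq_one] at h
    exact h0 (by linear_combination -h)
  · change 1 - y⁻¹ ≠ 0
    intro h
    rw [sub_eq_zero, eq_comm, inv_eq_one] at h
    exact h1 (by linear_combination -h)

/-- If a is an anharmonic transform of u_l, then one of a, 1 - a, 1/a is inverse to u_l or 1 - u_l.
Together with the relation between a and 1/a, this makes one coordinate occur in two relations. -/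
theorem phiAt_eq_zero_of_mob {A : Type*} [Field A] [CharZero A] {u : Fin k → A} {p s l : Fin k}
    (hps : p ≠ s) (hpl : p ≠ l) (hsl : s ≠ l) (h0 : u l ≠ 0) (h1 : 1 - u l ≠ 0) {t : Fin 6}
    (hp : u p = mob t (u l)) (hs : u s = (u p)⁻¹) : phiAt u = 0 := by
  have hp0 : u p ≠ 0 := hp ▸ mob_ne_zero h0 h1 t
  have e1 : sgnSub 1 (u p) * sgnSub 1 (u s) = 1 := by simp [hs, hp0]
  have e2 : sgnSub 1 (u s) * sgnSub 1 (u p) = 1 := by simp [hs, hp0]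
  fin_cases t
  · refine phiAt_eq_zero_of_two_pairs hps.symm hsl hpl e2 (s' := 1) (r := 1) ?_
    rw [hs, hp]
    simp [mob, h0]
  · refine phiAt_eq_zero_of_two_pairs hps.symm hsl hpl e2 (s' := 1) (r := -1) ?_
    rw [hs, hp]
    simp [mob, h1]
  · refine phiAt_eq_zero_of_two_pairs hps hpl hsl e1 (s' := 1) (r := 1) ?_
    rw [hp]
    simp [mob, h0]
  · refine phiAt_eq_zero_of_two_pairs hps hpl hsl e1 (s' := 1) (r := -1) ?_
    rw [hp]
    simp [mob, h1]
  · refine phiAt_eq_zero_of_two_pairs hps hpl hsl e1 (s' := -1) (r := -1) ?_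
    rw [hp]
    simp [mob, h1]
  · refine phiAt_eq_zero_of_two_pairs hps hpl hsl e1 (s' := -1) (r := 1) ?_
    rw [hp]
    simp [mob, h0]

theorem exists_eq_prod_mul_of_roots {K ι : Type*} [Field K] (T : Finset ι) (r : ι → K)
    (hr : Set.InjOn r T) (P : K[X]) (hP : ∀ i ∈ T, P.eval (r i) = 0) :
    ∃ N : K[X], P = (∏ i ∈ T, (X - C (r i))) * N ∧ (N = 0 ∨ N.natDegree + T.card = P.natDegree) := by
  have hdvd : (∏ i ∈ T, (X - C (r i))) ∣ P := by
    refine Finset.prod_dvd_of_coprime (fun i hi j hj hij => ?_) fun i hi =>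
      dvd_iff_isRoot.2 (hP i hi)
    exact isCoprime_X_sub_C_of_isUnit_sub (sub_ne_zero.2 fun h => hij (hr hi hj h)).isUnit
  obtain ⟨N, rfl⟩ := hdvd
  refine ⟨N, rfl, ?_⟩
  by_cases hN : N = 0
  · exact Or.inl hN
  · right
    rw [natDegree_mul (Finset.prod_ne_zero_iff.2 fun i _ => X_sub_C_ne_zero _) hN,
      natDegree_prod _ _ fun i _ => X_sub_C_ne_zero _]
    simp [add_comm]

section
variable {K E : Type*} [Field K] [Field E] [Algebra K E] [CharZero E]

/-- The point with coordinates `y`, except that the coordinates `p` and `s` are `a` and `1/a`. -/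
def locusPt (y : Fin k → K) (p s : Fin k) (a : E) : Fin k → E :=
  Function.update (Function.update (fun i => algebraMap K E (y i)) p a) s a⁻¹

/-- The zeros at 1/2 and at anharmonic transforms of the other coordinates are split off. `Phi`
vanishes at all six transforms; only four per coordinate are used, and `T` leaves the choice open so
that it can be matched with the denominator. -/
theorem exists_phiAt_locusPt [CharZero K] (y : Fin k → K) {p s : Fin k} (hps : p ≠ s)
    (hy : GenericOn ((Finset.univ.erase p).erase s) y) (T : Fin k → Finset (Fin 6))
    (hT : ∀ l ∈ (Finset.univ.erase p).erase s, (T l).card = 4) :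
    ∃ N : K[X], N.natDegree ≤ 2 * k + 1 ∧ ∀ a : E, a ≠ 0 →
      phiAt (locusPt y p s a) = a ^ (-(3 * k - 3) : ℤ) * ((a - 2⁻¹) *
        ∏ l ∈ (Finset.univ.erase p).erase s, ∏ t ∈ T l, (a - algebraMap K E (mob t (y l)))) *
          aeval a N := by
  set R := (Finset.univ.erase p).erase s with hR
  have hcard : R.card + 2 = k := by
    have h1 : R.card = k - 1 - 1 := by
      rw [hR, Finset.card_erase_of_mem (by simpa using hps.symm),
        Finset.card_erase_of_mem (Finset.mem_univ p), Finset.card_univ, Fintype.card_fin]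
    have h2 : (p : ℕ) ≠ s := fun h => hps (Fin.ext h)
    have := p.isLt
    have := s.isLt
    omega
  obtain ⟨P, hPd, hP⟩ := laurentBdd_phiAt_two (E := E) y hps
  have hroot : ∀ r : K, r ≠ 0 → phiAt (locusPt y p s (algebraMap K E r)) = 0 → P.eval r = 0 := by
    intro r hr h
    have hr' : algebraMap K E r ≠ 0 := by simpa using hr
    have h2 : phiAt (locusPt y p s (algebraMap K E r)) = _ := hP _ hr'
    rw [h, eq_comm, mul_eq_zero, or_iff_right (zpow_ne_zero _ hr'), aeval_algebraMap_apply,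
      map_eq_zero] at h2
    simpa using h2
  have hval_p : ∀ a : E, locusPt y p s a p = a := fun a => by simp [locusPt, hps]
  have hval_s : ∀ a : E, locusPt y p s a s = a⁻¹ := fun a => by simp [locusPt]
  have hval : ∀ (a : E) (l), l ∈ R → locusPt y p s a l = algebraMap K E (y l) := fun a l hl => by
    rw [locusPt, Function.update_of_ne (Finset.ne_of_mem_erase hl),
      Function.update_of_ne (Finset.ne_of_mem_erase (Finset.mem_of_mem_erase hl))]
  obtain ⟨N₁, hN₁, hdeg₁⟩ := exists_eq_prod_mul_of_roots (R.sigma T) (fun z => mob z.2 (y z.1))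
    (fun z hz z' hz' h => by
      obtain ⟨h1, h2⟩ := hy.inj _ (Finset.mem_sigma.1 hz).1 _ (Finset.mem_sigma.1 hz').1 _ _ h
      exact Sigma.ext h1 (heq_of_eq h2)) P
    (fun z hz => by
      have hl := (Finset.mem_sigma.1 hz).1
      refine hroot _ (mob_ne_zero (hy.ne_zero _ hl) (hy.ne_one _ hl) _) ?_
      refine phiAt_eq_zero_of_mob (t := z.2) (l := z.1) hps
        (Finset.ne_of_mem_erase (Finset.mem_of_mem_erase hl)).symm
        (Finset.ne_of_mem_erase hl).symm ?_ ?_ ?_ ?_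
      · rw [hval _ _ hl]; simpa using hy.ne_zero _ hl
      · rw [hval _ _ hl, ← map_one (algebraMap K E), ← map_sub]
        exact (_root_.map_ne_zero _).2 (hy.ne_one _ hl)
      · rw [hval_p, hval _ _ hl, map_mob]
      · rw [hval_p, hval_s])
  -- At a = 1/2 the coordinate p equals its own complement.
  have hhalf : N₁.eval 2⁻¹ = 0 := by
    have h1 : P.eval 2⁻¹ = 0 := by
      refine hroot _ (by norm_num) (phiAt_eq_zero_of_half (i := p) ?_)
      rw [hval_p, map_inv₀, map_ofNat]
      norm_num
    rw [hN₁, eval_mul, eval_prod, mul_eq_zero] at h1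
    refine h1.resolve_left (Finset.prod_ne_zero_iff.2 fun z hz => ?_)
    rw [eval_sub, eval_X, eval_C, sub_ne_zero]
    exact (hy.ne_half _ (Finset.mem_sigma.1 hz).1 _).symm
  obtain ⟨N, rfl⟩ := dvd_iff_isRoot.2 hhalf
  refine ⟨N, ?_, fun a ha => ?_⟩
  · by_cases hN : N = 0
    · simp [hN]
    · have hc : (R.sigma T).card = 4 * R.card := by
        rw [Finset.card_sigma, Finset.sum_congr rfl hT]
        simp [mul_comm]
      -- The polynomial has degree at most 6k - 6, and 4(k-2) + 1 linear factors are removed.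
      have h1 := hdeg₁.resolve_left (mul_ne_zero (X_sub_C_ne_zero _) hN)
      rw [natDegree_mul (X_sub_C_ne_zero _) hN, natDegree_X_sub_C, hc] at h1
      omega
  · have h1 : phiAt (locusPt y p s a) = _ := hP a ha
    rw [hN₁] at h1
    rw [h1]
    simp only [map_mul, map_prod, map_sub, aeval_X, aeval_C, Finset.prod_sigma, map_inv₀, map_ofNat]
    ring

end

end

/-! ### Poles of the residuand and invariance under flips -/

section

variable {k : ℕ}

/-! ### The denominator of the residuand near its poles -/

open Polynomial

/-- The pair factor in the denominator of `F`. -/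
def gogPair {A : Type*} [CommRing A] (u : Fin k → A) (i j : Fin k) : A :=
  (1 - u i * u j) * (1 - (1 - u i) * u j)

/-- The factor of the denominator of `F` belonging to one variable. -/
def gogOne {A : Type*} [CommRing A] (n : ℕ) (u : Fin k → A) (i : Fin k) : A :=
  u i ^ (n + 1) * (1 - u i) ^ (n + ((i : ℕ) + 1) + 1)

/-- The denominator of `F`. -/
def gogDen {A : Type*} [CommRing A] (n : ℕ) (u : Fin k → A) : A :=
  (∏ i, gogOne n u i) * pairProd Finset.univ (gogPair u)

/-- The denominator of `F`, with the pair factor of `i, j` replaced by `c`. -/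
def offDen {A : Type*} [CommRing A] (n : ℕ) (u : Fin k → A) (i j : Fin k) (c : A) : A :=
  (∏ l, gogOne n u l) * (c * (∏ l ∈ (Finset.univ.erase i).erase j, sortPair (gogPair u) i l) *
    (∏ l ∈ (Finset.univ.erase i).erase j, sortPair (gogPair u) j l) *
      pairProd ((Finset.univ.erase i).erase j) (gogPair u))

theorem offDen_comm {A : Type*} [CommRing A] (n : ℕ) (u : Fin k → A) (i j : Fin k) (c : A) :
    offDen n u i j c = offDen n u j i c := by
  rw [offDen, offDen, Finset.erase_right_comm]
  ring

section
variable {K E : Type*} [Field K] [Field E] [Algebra K E]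

/-- With coordinates a (or 1 - a) at i and 1/a at j, the four linear factors that involve l vanish
exactly when a is one of four anharmonic transforms of y. Which four depends on the place of l
relative to i and j and, for l before i, on σ. -/
theorem exists_sortPair_mul_sortPair {i j l : Fin k} (hij : i < j)
    (σ : ℤˣ) {y : K} (h0 : y ≠ 0) (h1 : 1 - y ≠ 0) :
    ∃ (c : K) (T : Finset (Fin 6)), T.card = 4 ∧ ∀ (a : E) (u : Fin k → E), a ≠ 0 →
      u i = sgnSub σ a → u j = a⁻¹ → u l = algebraMap K E y →
        sortPair (gogPair u) i l * sortPair (gogPair u) j l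
          = algebraMap K E c * (a ^ 2)⁻¹ * ∏ t ∈ T, (a - algebraMap K E (mob t y)) := by
  have h0' : algebraMap K E y ≠ 0 := by simpa using h0
  have h1' : 1 - algebraMap K E y ≠ 0 := by
    rw [← map_one (algebraMap K E), ← map_sub]
    exact (_root_.map_ne_zero _).2 h1
  by_cases hli : i < l
  · by_cases hlj : j < l
    · refine ⟨-y ^ 2 * (1 - y), {2, 5, 0, 4}, by decide, fun a u ha hi hj hl => ?_⟩
      simp only [sortPair, if_pos hli, if_pos hlj, gogPair, hi, hj, hl, map_mob]
      rw [Finset.prod_insert (by decide), Finset.prod_insert (by decide),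
        Finset.prod_insert (by decide), Finset.prod_singleton]
      simp only [mob, map_neg, map_mul, map_pow, map_sub, map_one]
      rcases Int.units_eq_one_or σ with rfl | rfl
      · rw [sgnSub_one]; field_simp; ring
      · rw [sgnSub_neg_one]; field_simp; ring
    · refine ⟨-y ^ 2, {2, 5, 0, 1}, by decide, fun a u ha hi hj hl => ?_⟩
      simp only [sortPair, if_pos hli, if_neg hlj, gogPair, hi, hj, hl, map_mob]
      rw [Finset.prod_insert (by decide), Finset.prod_insert (by decide),
        Finset.prod_insert (by decide), Finset.prod_singleton]
      simp only [mob, map_neg, map_pow]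
      rcases Int.units_eq_one_or σ with rfl | rfl
      · rw [sgnSub_one]; field_simp; ring
      · rw [sgnSub_neg_one]; field_simp; ring
  · have hlj : ¬ j < l := fun h => hli (hij.trans h)
    rcases Int.units_eq_one_or σ with rfl | rfl
    · refine ⟨y * (1 - y), {2, 3, 0, 1}, by decide, fun a u ha hi hj hl => ?_⟩
      simp only [sortPair, if_neg hli, if_neg hlj, gogPair, hi, hj, hl, map_mob]
      rw [Finset.prod_insert (by decide), Finset.prod_insert (by decide),
        Finset.prod_insert (by decide), Finset.prod_singleton]
      simp only [mob, map_mul, map_sub, map_one, sgnSub_one]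
      field_simp; ring
    · refine ⟨y * (1 - y), {4, 5, 0, 1}, by decide, fun a u ha hi hj hl => ?_⟩
      simp only [sortPair, if_neg hli, if_neg hlj, gogPair, hi, hj, hl, map_mob]
      rw [Finset.prod_insert (by decide), Finset.prod_insert (by decide),
        Finset.prod_insert (by decide), Finset.prod_singleton]
      simp only [mob, map_mul, map_sub, map_one, sgnSub_neg_one]
      field_simp; ring

theorem field_identity₆ {a h P D C v N : E} (hv : v ≠ 0) (ha : a ≠ 0)
    (h2 : 2 * a - 1 ≠ 0) (h20 : (2 : E) ≠ 0) {Q : E} (hQ : Q ≠ 0)  :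
    (h * (P * ((a - 2⁻¹) * Q) * N)) / (D * ((2 * a - 1) / a * (v * Q) * C))
      = h * 2⁻¹ * N * (P * a / (D * v)) * C⁻¹ := by
  have e : a - 2⁻¹ = (2 * a - 1) * 2⁻¹ := by field_simp
  rw [e]
  by_cases hD : D = 0
  · simp [hD]
  by_cases hC : C = 0
  · simp [hC]
  field_simp

/-- All powers of a are collected, using 1 - a⁻¹ = -(1 - a) a⁻¹; the hypothesis `he` is their
balance. Here r = k - 2 counts the coordinates that are not special. -/
theorem field_identity₇ {a : E} (ha : a ≠ 0) (h1a : 1 - a ≠ 0) {r n A b B e : ℕ}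
    (he : e + A + r + 1 = n + B) :
    a ^ (-(3 * (r + 2 : ℕ) - 3) : ℤ) * a / ((a ^ A * (1 - a) ^ b) *
        (a⁻¹ ^ (n + 1) * (1 - a⁻¹) ^ B) * ((a ^ 2)⁻¹) ^ r)
      = (-1) ^ B * (a ^ e / (1 - a) ^ (b + B)) := by
  have e1 : 1 - a⁻¹ = (-1) * ((1 - a) * a⁻¹) := by field_simp; ring
  have e2 : a ^ (-(3 * (r + 2 : ℕ) - 3) : ℤ) = (a ^ (3 * r + 3))⁻¹ := by
    rw [← zpow_natCast, ← zpow_neg]; congr 1; push_cast; ring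
  have e3 : ((-1) ^ B : E) * (-1) ^ B = 1 := by rw [← mul_pow]; simp
  have e4 : a ^ e * a ^ A * a ^ r * a = a ^ n * a ^ B := by
    rw [← pow_add, ← pow_add, ← pow_add, ← he]; ring
  have e5 : ((-1) ^ B : E) ≠ 0 := pow_ne_zero _ (by simp)
  rw [e1, e2, mul_pow, mul_pow]
  simp only [inv_pow]
  rw [mul_div_assoc', div_eq_div_iff (by positivity) (by positivity)]
  field_simp
  linear_combination (-(a ^ (2 * r + 2) * (1 - a) ^ (b + B))) * e4
    - (a ^ (2 * r + 2) * (1 - a) ^ (b + B)) * (a ^ e * a ^ A * a ^ r * a) * e3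

/-- At a pole one of the two linear factors of the pair i, j vanishes and the other equals (2a -
1)/a, whence the constant in `offDen`. The zero of `Phi` at 1/2 cancels it, the anharmonic zeros
cancel the pair factors of the other coordinates, and only powers of a and 1 - a remain. The
assumption k ≤ n makes the power of a positive and that of 1 - a large enough. -/
theorem exists_phiAt_div_offDen [CharZero K] [CharZero E] {n : ℕ} (hkn : k ≤ n) {i j : Fin k} (hij : i < j) (σ : ℤˣ)
    (y : Fin k → K) (hy : GenericOn ((Finset.univ.erase i).erase j) y) :
    ∃ (N : K[X]) (e M : ℕ), 1 ≤ e ∧ e + (2 * k + 1) + 1 ≤ M ∧ N.natDegree ≤ 2 * k + 1 ∧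
      ∀ (a : E) (u : Fin k → E), a ≠ 0 → 1 - a ≠ 0 → 2 * a - 1 ≠ 0 →
        (∀ l ∈ (Finset.univ.erase i).erase j, ∀ t, a ≠ algebraMap K E (mob t (y l))) →
        u i = sgnSub σ a → u j = a⁻¹ →
        (∀ l ∈ (Finset.univ.erase i).erase j, u l = algebraMap K E (y l)) →
        phiAt u / offDen n u i j ((2 * a - 1) / a) = aeval a N * (a ^ e / (1 - a) ^ M) := by
  set R := (Finset.univ.erase i).erase j with hR
  have hcard : R.card + 2 = k := by
    have h1 : R.card = k - 1 - 1 := by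
      rw [hR, Finset.card_erase_of_mem (by simpa using hij.ne'),
        Finset.card_erase_of_mem (Finset.mem_univ i), Finset.card_univ, Fintype.card_fin]
    have h2 : (i : ℕ) < j := hij
    have := i.isLt
    have := j.isLt
    omega
  have hex : ∀ l : Fin k, ∃ (c : K) (T : Finset (Fin 6)), l ∈ R → T.card = 4 ∧ ∀ (a : E) (u : Fin k → E), a ≠ 0 →
      u i = sgnSub σ a → u j = a⁻¹ → u l = algebraMap K E (y l) →
        sortPair (gogPair u) i l * sortPair (gogPair u) j l
          = algebraMap K E c * (a ^ 2)⁻¹ * ∏ t ∈ T, (a - algebraMap K E (mob t (y l))) := by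
    intro l
    by_cases hl : l ∈ R
    · obtain ⟨c, T, h⟩ := exists_sortPair_mul_sortPair (E := E) hij σ
        (hy.ne_zero l hl) (hy.ne_one l hl)
      exact ⟨c, T, fun _ => h⟩
    · exact ⟨0, ∅, fun h => absurd h hl⟩
  choose c T hcT using hex
  obtain ⟨N, hN, hphi⟩ := exists_phiAt_locusPt (E := E) y hij.ne hy T fun l hl => (hcT l hl).1
  set C₀ : K := (∏ l ∈ R, gogOne n y l) * ((∏ l ∈ R, c l) * pairProd R (gogPair y)) with hC₀
  -- the exponents
  obtain ⟨e, M, he, hM, heM⟩ : ∃ e M : ℕ, 1 ≤ e ∧ e + (2 * k + 1) + 1 ≤ M ∧ ∃ δ : K, ∀ a : E, a ≠ 0 → 1 - a ≠ 0 →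
      a ^ (-(3 * k - 3) : ℤ) * a / ((sgnSub σ a ^ (n + 1) * (1 - sgnSub σ a) ^ (n + ((i : ℕ) + 1) + 1)) *
        (a⁻¹ ^ (n + 1) * (1 - a⁻¹) ^ (n + ((j : ℕ) + 1) + 1)) * ((a ^ 2)⁻¹) ^ R.card)
        = algebraMap K E δ * (a ^ e / (1 - a) ^ M) := by
    obtain ⟨d, hd⟩ := Nat.exists_eq_add_of_le hkn
    obtain ⟨q, hq⟩ := Nat.exists_eq_add_of_lt (show (i : ℕ) < j from hij)
    have hcast : ((-1) ^ (n + ((j : ℕ) + 1) + 1) : E)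
        = algebraMap K E ((-1) ^ (n + ((j : ℕ) + 1) + 1)) := by simp
    rcases Int.units_eq_one_or σ with rfl | rfl
    -- Here n = k + d, and the exponent of a is n + B - A - (k - 2) - 1 with A = n + 1 and B = n + j
    -- + 2, counting j from 0.
    · refine ⟨d + j + 2, n + ((i : ℕ) + 1) + 1 + (n + ((j : ℕ) + 1) + 1), by omega, by omega,
        (-1) ^ (n + ((j : ℕ) + 1) + 1), fun a ha h1a => ?_⟩
      rw [sgnSub_one, ← hcast, ← field_identity₇ (r := R.card) (n := n) (A := n + 1) ha h1a (by omega), hcard]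
    -- Now u_i = 1 - a, so A = n + i + 2 comes from the factor 1 - u_i, and j = i + q + 1.
    · refine ⟨d + q + 2, (n + 1) + (n + ((j : ℕ) + 1) + 1), by omega, by omega,
        (-1) ^ (n + ((j : ℕ) + 1) + 1), fun a ha h1a => ?_⟩
      rw [sgnSub_neg_one, sub_sub_cancel, ← hcast, ← field_identity₇ (r := R.card) (n := n)
        (A := n + ((i : ℕ) + 1) + 1) ha h1a (by omega), hcard, mul_comm ((1 - a) ^ (n + 1))]
  obtain ⟨δ, heM⟩ := heM
  refine ⟨Polynomial.C (((σ : ℤ) : K) * 2⁻¹ * δ * C₀⁻¹) * N, e, M, he, hM,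
    (natDegree_C_mul_le _ _).trans hN, fun a u ha h1a h2a hroots hi hj hl => ?_⟩
  have hu : u = Function.update (locusPt y i j a) i (sgnSub σ a) := by
    funext m
    by_cases hm : m = i
    · subst hm; simp [hi]
    · by_cases hm' : m = j
      · subst hm'; simp [hj, locusPt, hm]
      · simp [hl m (by simp [hR, hm, hm']), locusPt, hm, hm']
  have hself : Function.update (locusPt y i j a) i a = locusPt y i j a := by
    rw [Function.update_eq_self_iff]
    simp [locusPt, hij.ne]
  have e1 : phiAt u = ((σ : ℤ) : E) * (a ^ (-(3 * k - 3) : ℤ) * ((a - 2⁻¹) *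
        ∏ l ∈ R, ∏ t ∈ T l, (a - algebraMap K E (mob t (y l)))) * aeval a N) := by
    rw [hu, phiAt_update_sgnSub, hself, hphi a ha]
  have e2 : offDen n u i j ((2 * a - 1) / a) =
      ((sgnSub σ a ^ (n + 1) * (1 - sgnSub σ a) ^ (n + ((i : ℕ) + 1) + 1)) *
        (a⁻¹ ^ (n + 1) * (1 - a⁻¹) ^ (n + ((j : ℕ) + 1) + 1))) * ((2 * a - 1) / a *
        (((a ^ 2)⁻¹) ^ R.card * ∏ l ∈ R, ∏ t ∈ T l, (a - algebraMap K E (mob t (y l)))) *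
          algebraMap K E C₀) := by
    have e3 : pairProd R (gogPair u) = algebraMap K E (pairProd R (gogPair y)) := by
      rw [map_pairProd]
      refine pairProd_congr fun l h l' h' => ?_
      simp [gogPair, hl l h, hl l' h']
    have e4 : ∏ l ∈ R, gogOne n u l = algebraMap K E (∏ l ∈ R, gogOne n y l) := by
      rw [map_prod]
      refine Finset.prod_congr rfl fun l h => ?_
      simp [gogOne, hl l h]
    have e5 : (∏ l ∈ R, sortPair (gogPair u) i l) * (∏ l ∈ R, sortPair (gogPair u) j l) =
        algebraMap K E (∏ l ∈ R, c l) * (((a ^ 2)⁻¹) ^ R.card *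
          ∏ l ∈ R, ∏ t ∈ T l, (a - algebraMap K E (mob t (y l)))) := by
      rw [← Finset.prod_mul_distrib, Finset.prod_congr rfl fun l h =>
        (hcT l h).2 a u ha hi hj (hl l h), Finset.prod_mul_distrib, Finset.prod_mul_distrib,
        Finset.prod_const, map_prod, mul_assoc]
    rw [offDen, prod_univ_split₂ hij.ne, ← hR, e3, e4, mul_assoc ((2 * a - 1) / a), e5, hC₀, gogOne,
      gogOne, hi, hj, map_mul, map_mul]
    ring
  rw [e1, e2, field_identity₆ (pow_ne_zero _ (inv_ne_zero (pow_ne_zero _ ha))) ha h2a two_ne_zero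
    (Finset.prod_ne_zero_iff.2 fun l h => Finset.prod_ne_zero_iff.2 fun t _ =>
      sub_ne_zero.2 (hroots l h t)), heM a ha h1a]
  simp only [map_mul, aeval_C, map_inv₀, map_intCast, map_ofNat]
  ring

end

end

section

variable {k : ℕ}

/-! ### Partial fractions -/

open Polynomial

section
variable {K E : Type*} [Field K] [Field E] [Algebra K E]

/-- The coefficient at a simple pole in the partial fraction expansion. -/
def pfCoeff {ι : Type*} [DecidableEq ι] (T : Finset ι) (s : ι → ℤˣ) (w : ι → K) (A B : ℕ)
    (P : K[X]) (t : ι) : K :=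
  P.eval (sgnSub (s t) (w t)⁻¹) / (w t * (sgnSub (s t) (w t)⁻¹ ^ (A + 1) *
    (1 - sgnSub (s t) (w t)⁻¹) ^ (B + 1) *
      ∏ t' ∈ T.erase t, (1 - sgnSub (s t') (sgnSub (s t) (w t)⁻¹) * w t')))

theorem sgnSub_mul_one_sub (s : ℤˣ) (a : E) : sgnSub s a * (1 - sgnSub s a) = a * (1 - a) := by
  rcases Int.units_eq_one_or s with rfl | rfl
  · simp
  · simp [mul_comm]

/-- The simple poles are subtracted with w⁻¹ (1 - w w')⁻¹ instead of (1 - w w')⁻¹. These functions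
decay to order two at infinity, as does the left side by the degree bound on P, so the rest does too
and P₀ has degree at most A + B. -/
theorem exists_partial_fractions {ι : Type*} [DecidableEq ι] (T : Finset ι) (s : ι → ℤˣ)
    (w : ι → K) (h0 : ∀ t ∈ T, w t ≠ 0) (h1 : ∀ t ∈ T, 1 - w t ≠ 0)
    (hinj : Set.InjOn (fun t => sgnSub (s t) (w t)⁻¹) T) (A B : ℕ) (P : K[X])
    (hP : P.natDegree ≤ A + B + T.card) :
    ∃ P₀ : K[X], P₀.natDegree ≤ A + B ∧ ∀ a : E, a ≠ 0 → 1 - a ≠ 0 →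
      (∀ t ∈ T, 1 - sgnSub (s t) a * algebraMap K E (w t) ≠ 0) →
      aeval a P / (a ^ (A + 1) * (1 - a) ^ (B + 1) *
          ∏ t ∈ T, (1 - sgnSub (s t) a * algebraMap K E (w t)))
        = aeval a P₀ / (a ^ (A + 1) * (1 - a) ^ (B + 1)) +
          ∑ t ∈ T, algebraMap K E (pfCoeff T s w A B P t) *
            ((sgnSub (s t) a)⁻¹ * (1 - sgnSub (s t) a * algebraMap K E (w t))⁻¹) := by
  set r : ι → K := fun t => sgnSub (s t) (w t)⁻¹ with hr
  set ρ : ι → K := pfCoeff T s w A B P with hρ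
  set ℓ : ι → K[X] := fun t => 1 - sgnSub (s t) X * C (w t) with hℓ
  have hℓeval : ∀ t b, (ℓ t).eval b = 1 - sgnSub (s t) b * w t := fun t b => by
    rcases Int.units_eq_one_or (s t) with h | h
    · simp [hℓ, h]
      ring
    · simp [hℓ, h]
  have hℓaeval : ∀ t (b : E), aeval b (ℓ t) = 1 - sgnSub (s t) b * algebraMap K E (w t) :=
    fun t b => by
      rcases Int.units_eq_one_or (s t) with h | h
      · simp [hℓ, h]
        ring
      · simp [hℓ, h]
  have hℓr : ∀ t ∈ T, ℓ t = C (-((s t : ℤ) : K) * w t) * (X - C (r t)) := by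
    intro t ht
    have hw : C (w t)⁻¹ * C (w t) = 1 := by rw [← C_mul, inv_mul_cancel₀ (h0 t ht), C_1]
    rcases Int.units_eq_one_or (s t) with h | h
    · simp only [hℓ, hr, h, sgnSub_one, Units.val_one, Int.cast_one, C_mul, C_neg, C_1]
      linear_combination -hw
    · simp only [hℓ, hr, h, sgnSub_neg_one, Units.val_neg, Units.val_one, Int.cast_neg,
        Int.cast_one, neg_neg, C_mul, C_1, C_sub]
      linear_combination -hw
  have hsdeg : ∀ t, (sgnSub (s t) (X : K[X])).natDegree ≤ 1 ∧
      (1 - sgnSub (s t) (X : K[X])).natDegree ≤ 1 := by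
    intro t
    have h2 : (1 - (X : K[X])).natDegree ≤ 1 := by compute_degree
    rcases Int.units_eq_one_or (s t) with h | h
    · simpa [h] using h2
    · simpa [h] using h2
  have hℓdeg : ∀ t, (ℓ t).natDegree ≤ 1 := fun t => by
    refine (natDegree_sub_le _ _).trans (max_le (by simp) ?_)
    exact (natDegree_mul_C_le _ _).trans (hsdeg t).1
  have hr0 : ∀ t ∈ T, r t ≠ 0 ∧ 1 - r t ≠ 0 := by
    intro t ht
    have h2 : 1 - (w t)⁻¹ ≠ 0 := by
      rw [sub_ne_zero]
      intro h
      rw [eq_comm, inv_eq_one] at h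
      exact h1 t ht (by rw [h, sub_self])
    rcases Int.units_eq_one_or (s t) with h | h
    · simpa [hr, h] using ⟨h0 t ht, h2⟩
    · simpa [hr, h] using ⟨h2, h0 t ht⟩
  -- The numerator of the piece at t over the common denominator: by `sgnSub_mul_one_sub`, w⁻¹ = (1
  -- - w) / (a (1 - a)).
  set S : ι → K[X] := fun t => X ^ A * (1 - X) ^ B * (1 - sgnSub (s t) X) * ∏ t' ∈ T.erase t, ℓ t'
    with hS
  have hSdeg : ∀ t ∈ T, (S t).natDegree ≤ A + B + T.card := by
    intro t ht
    have h2 : (1 - (X : K[X])).natDegree ≤ 1 := by compute_degree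
    have h3 : (∏ t' ∈ T.erase t, ℓ t').natDegree ≤ (T.erase t).card :=
      (natDegree_prod_le _ _).trans ((Finset.sum_le_card_nsmul _ _ 1 fun i _ => hℓdeg i).trans
        (by simp))
    have h4 := Finset.card_erase_add_one ht
    refine (natDegree_mul_le.trans (add_le_add (natDegree_mul_le.trans (add_le_add
      (natDegree_mul_le.trans (add_le_add (natDegree_X_pow_le A) (natDegree_pow_le_of_le B h2)))
        (hsdeg t).2)) h3)).trans ?_
    omega
  have hSeval : ∀ t ∈ T, ∀ t' ∈ T, t' ≠ t → (S t').eval (r t) = 0 := by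
    intro t ht t' _ htt'
    rw [hS, eval_mul, eval_prod, Finset.prod_eq_zero (Finset.mem_erase.2 ⟨htt'.symm, ht⟩), mul_zero]
    rw [hℓr t ht]
    simp
  -- The coefficients ρ make Q vanish at every simple pole, so that the product of the linear
  -- factors divides it.
  set Q : K[X] := P - ∑ t ∈ T, C (ρ t) * S t with hQ
  have hQdeg : Q.natDegree ≤ A + B + T.card :=
    (natDegree_sub_le _ _).trans (max_le hP (natDegree_sum_le_of_forall_le _ _ fun t ht =>
      (natDegree_C_mul_le _ _).trans (hSdeg t ht)))
  have hprodne : ∀ t ∈ T, (∏ t' ∈ T.erase t, (1 - sgnSub (s t') (r t) * w t')) ≠ 0 := by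
    intro t ht
    refine Finset.prod_ne_zero_iff.2 fun t' ht' => ?_
    obtain ⟨hne, ht'⟩ := Finset.mem_erase.1 ht'
    rw [← hℓeval, hℓr t' ht']
    simp only [eval_mul, eval_C, eval_sub, eval_X]
    refine mul_ne_zero (mul_ne_zero ?_ (h0 t' ht')) (sub_ne_zero.2 fun h => hne (hinj ht' ht h.symm))
    rcases Int.units_eq_one_or (s t') with h | h <;> simp [h]
  have hQr : ∀ t ∈ T, Q.eval (r t) = 0 := by
    intro t ht
    have h5 : w t * (1 - (w t)⁻¹) = -(1 - w t) := by
      have := mul_inv_cancel₀ (h0 t ht)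
      linear_combination -this
    rw [hQ, eval_sub, eval_finsetSum, Finset.sum_eq_single t, eval_mul, eval_C]
    · simp only [hS, eval_mul, eval_pow, eval_X, eval_sub, eval_one, eval_prod, hℓeval]
      have e1 : (sgnSub (s t) (X : K[X])).eval (r t) = (w t)⁻¹ := by
        rcases Int.units_eq_one_or (s t) with h | h <;> simp [hr, h]
      rw [e1]
      have e2 : ρ t = P.eval (r t) / (w t * (r t ^ (A + 1) * (1 - r t) ^ (B + 1) *
        ∏ t' ∈ T.erase t, (1 - sgnSub (s t') (r t) * w t'))) := rfl
      have e3 := sgnSub_mul_one_sub (s t) (r t)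
      have e4 : sgnSub (s t) (r t) = (w t)⁻¹ := sgnSub_sgnSub _ _
      rw [e4] at e3
      rw [e2]
      have hp := hprodne t ht
      obtain ⟨ha, hb⟩ := hr0 t ht
      have hw := h0 t ht
      have e5 : w t * (r t ^ (A + 1) * (1 - r t) ^ (B + 1) *
        ∏ t' ∈ T.erase t, (1 - sgnSub (s t') (r t) * w t')) = r t ^ A * (1 - r t) ^ B *
          (1 - (w t)⁻¹) * ∏ t' ∈ T.erase t, (1 - sgnSub (s t') (r t) * w t') := by
        rw [pow_succ, pow_succ]
        linear_combination -(w t * r t ^ A * (1 - r t) ^ B *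
          ∏ t' ∈ T.erase t, (1 - sgnSub (s t') (r t) * w t')) * e3 +
          r t ^ A * (1 - r t) ^ B * (1 - (w t)⁻¹) *
          (∏ t' ∈ T.erase t, (1 - sgnSub (s t') (r t) * w t')) * mul_inv_cancel₀ hw
      rw [← e5, div_mul_cancel₀, sub_self]
      exact mul_ne_zero hw (mul_ne_zero (mul_ne_zero (pow_ne_zero _ ha) (pow_ne_zero _ hb)) hp)
    · intro t' ht' hne
      rw [eval_mul, hSeval t ht t' ht' hne, mul_zero]
    · exact fun h => absurd ht h
  obtain ⟨N, hN, hNdeg⟩ := exists_eq_prod_mul_of_roots T r hinj Q hQr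
  have hc : (∏ t ∈ T, (-((s t : ℤ) : K) * w t)) ≠ 0 := by
    refine Finset.prod_ne_zero_iff.2 fun t ht => mul_ne_zero ?_ (h0 t ht)
    rcases Int.units_eq_one_or (s t) with h | h <;> simp [h]
  refine ⟨C (∏ t ∈ T, (-((s t : ℤ) : K) * w t))⁻¹ * N, ?_, fun a ha h1a hla => ?_⟩
  · refine (natDegree_C_mul_le _ _).trans ?_
    rcases hNdeg with h | h
    · simp [h]
    · omega
  · have e1 : aeval a Q = aeval a (C (∏ t ∈ T, (-((s t : ℤ) : K) * w t))⁻¹ * N) *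
        ∏ t ∈ T, (1 - sgnSub (s t) a * algebraMap K E (w t)) := by
      have e2 : Q = C (∏ t ∈ T, (-((s t : ℤ) : K) * w t))⁻¹ * N * ∏ t ∈ T, ℓ t := by
        have e3 : ∏ t ∈ T, ℓ t = C (∏ t ∈ T, (-((s t : ℤ) : K) * w t)) * ∏ t ∈ T, (X - C (r t)) := by
          rw [map_prod, ← Finset.prod_mul_distrib]
          exact Finset.prod_congr rfl hℓr
        rw [e3, hN]
        have : C (∏ t ∈ T, (-((s t : ℤ) : K) * w t))⁻¹ * C (∏ t ∈ T, (-((s t : ℤ) : K) * w t)) = 1 := by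
          rw [← C_mul, inv_mul_cancel₀ hc, C_1]
        linear_combination (-(∏ t ∈ T, (X - C (r t))) * N) * this
      conv_lhs => rw [e2]
      rw [map_mul, map_prod]
      exact congrArg _ (Finset.prod_congr rfl fun t _ => hℓaeval t a)
    have e2 : aeval a P = aeval a Q + ∑ t ∈ T, algebraMap K E (ρ t) * aeval a (S t) := by
      rw [hQ, map_sub, map_sum]
      simp only [map_mul, aeval_C, sub_add_cancel]
    have hX : a ^ (A + 1) * (1 - a) ^ (B + 1) ≠ 0 := mul_ne_zero (pow_ne_zero _ ha) (pow_ne_zero _ h1a)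
    have hℓne : (∏ t ∈ T, (1 - sgnSub (s t) a * algebraMap K E (w t))) ≠ 0 :=
      Finset.prod_ne_zero_iff.2 hla
    rw [e2, add_div, e1, mul_div_mul_right _ _ hℓne, Finset.sum_div]
    congr 1
    refine Finset.sum_congr rfl fun t ht => ?_
    have e3 : aeval a (S t) = a ^ A * (1 - a) ^ B * (1 - sgnSub (s t) a) *
        ∏ t' ∈ T.erase t, (1 - sgnSub (s t') a * algebraMap K E (w t')) := by
      rw [hS, map_mul, map_prod, Finset.prod_congr rfl fun t' _ => hℓaeval t' a]
      congr 1
      rcases Int.units_eq_one_or (s t) with h | h <;> simp [h]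
    have e4 := sgnSub_mul_one_sub (s t) a
    have hs0 : sgnSub (s t) a ≠ 0 := fun h => by
      rw [h, zero_mul] at e4
      exact mul_ne_zero ha h1a e4.symm
    rw [mul_div_assoc, e3, ← Finset.mul_prod_erase T _ ht]
    congr 1
    have hle := Finset.prod_ne_zero_iff.2 fun t' (h : t' ∈ T.erase t) =>
      hla t' (Finset.mem_of_mem_erase h)
    have hl := hla t ht
    rw [div_eq_iff (mul_ne_zero hX (mul_ne_zero hl hle)), pow_succ, pow_succ]
    field_simp
    linear_combination e4

end

end

section

variable {k : ℕ}

/-! ### Genericity of the variables -/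

open Polynomial

theorem RegularAt.ne_zero {v : Fin k} {c f : RatFun k} (h : RegularAt v c f) (hc : c ≠ 0) :
    f ≠ 0 := by
  rintro rfl
  have := h.res_inv_mul
  rw [mul_zero, res_zero] at this
  exact hc this.symm

theorem mob_injective {K : Type*} [Field K] {y : K} (h0 : y ≠ 0) (h1 : 1 - y ≠ 0) (h2 : 1 + y ≠ 0)
    (h3 : 2 - y ≠ 0) (h4 : 1 - 2 * y ≠ 0) (h5 : 1 - y + y ^ 2 ≠ 0) :
    Function.Injective fun t => mob t y := by
  have hi : y * y⁻¹ = 1 := mul_inv_cancel₀ h0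
  have hj : (1 - y) * (1 - y)⁻¹ = 1 := mul_inv_cancel₀ h1
  intro t t' h
  fin_cases t <;> fin_cases t' <;> first | rfl | (exfalso; simp only [mob] at h; grind)

theorem mob_ne_half {K : Type*} [Field K] [CharZero K] {y : K} (h0 : y ≠ 0) (h1 : 1 - y ≠ 0)
    (h2 : 1 + y ≠ 0) (h3 : 2 - y ≠ 0) (h4 : 1 - 2 * y ≠ 0) (t : Fin 6) : mob t y ≠ 2⁻¹ := by
  have hi : y * y⁻¹ = 1 := mul_inv_cancel₀ h0
  have hj : (1 - y) * (1 - y)⁻¹ = 1 := mul_inv_cancel₀ h1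
  have hk : (2 : K) * 2⁻¹ = 1 := mul_inv_cancel₀ two_ne_zero
  intro h
  fin_cases t <;> simp only [mob] at h <;> grind

theorem mem_of_mob_mem (K : Subfield (RatFun k)) {y : RatFun k}
    (t : Fin 6) (h : mob t y ∈ K) : y ∈ K := by
  have key : ∀ z : RatFun k, 1 - z ∈ K → z ∈ K := fun z hz => by
    have := sub_mem (one_mem K) hz
    rwa [sub_sub_cancel] at this
  have key' : ∀ z : RatFun k, z⁻¹ ∈ K → z ∈ K := fun z hz => by
    have := inv_mem hz
    rwa [inv_inv] at this
  fin_cases t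
  · exact h
  · exact key _ h
  · exact key' _ h
  · exact key _ (key' _ h)
  · exact key _ (key' _ (key _ h))
  · exact key' _ (key _ h)

theorem x_not_mem_fr (i : Fin k) : x i ∉ fr ({i} : Set (Fin k)) := by
  intro h
  have h1 := laurentExpansion_of_mem (Set.mem_singleton i) h
  rw [laurentExpansion_x_self] at h1
  have h2 := congrArg (fun f => HahnSeries.coeff f 1) h1
  simp at h2

theorem generic_sgnSub_x (s : ℤˣ) (i : Fin k) (y : RatFun k) (hy : y = sgnSub s (x i)) :
    y ≠ 0 ∧ 1 - y ≠ 0 ∧ 1 + y ≠ 0 ∧ 2 - y ≠ 0 ∧ 1 - 2 * y ≠ 0 ∧ 1 - y + y ^ 2 ≠ 0 := by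
  have hx : RegularAt i 0 (x i) := RegularAt.x
  have h1 : RegularAt i 1 (1 : RatFun k) := RegularAt.one
  have e1 : RegularAt i (1 + 0) (1 + x i) := h1.add hx
  have e2 : RegularAt i (1 + 1 - 0) (1 + 1 - x i) := (h1.add h1).sub hx
  have e3 : RegularAt i (1 - (1 + 1) * 0) (1 - (1 + 1) * x i) := h1.sub ((h1.add h1).mul hx)
  have e4 : RegularAt i (1 - 0 + 0 ^ 2) (1 - x i + x i ^ 2) := (h1.sub hx).add (hx.pow 2)
  have f1 := e1.ne_zero (by norm_num)
  have f2 := e2.ne_zero (by norm_num)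
  have f3 := e3.ne_zero (by norm_num)
  have f4 := e4.ne_zero (by norm_num)
  rw [one_add_one_eq_two] at f2 f3
  have f5 := x_ne_zero i
  have f6 := one_sub_x_ne_zero i
  rcases Int.units_eq_one_or s with rfl | rfl
  · rw [sgnSub_one] at hy
    subst hy
    exact ⟨f5, f6, f1, f2, f3, f4⟩
  · rw [sgnSub_neg_one] at hy
    subst hy
    refine ⟨f6, ?_, ?_, ?_, ?_, ?_⟩
    · rwa [sub_sub_cancel]
    · rwa [show 1 + (1 - x i) = 2 - x i by ring]
    · rwa [show 2 - (1 - x i) = 1 + x i by ring]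
    · rw [show 1 - 2 * (1 - x i) = -(1 - 2 * x i) by ring]
      exact neg_ne_zero.2 f3
    · rwa [show 1 - (1 - x i) + (1 - x i) ^ 2 = 1 - x i + x i ^ 2 by ring]

/-- For one variable, coincidences are excluded by regularity at 0 of a few polynomials with nonzero
constant term. For two different variables, an equality of transforms would put one variable into
the field generated by the others. -/
theorem genericOn_x (R : Finset (Fin k)) (ε : Fin k → ℤˣ) (π : Equiv.Perm (Fin k)) :
    GenericOn R fun l => sgnSub (ε l) (x (π l)) where
  ne_zero l _ := (generic_sgnSub_x _ _ _ rfl).1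
  ne_one l _ := (generic_sgnSub_x _ _ _ rfl).2.1
  ne_half l _ t := by
    obtain ⟨h0, h1, h2, h3, h4, _⟩ := generic_sgnSub_x (ε l) (π l) _ rfl
    exact mob_ne_half h0 h1 h2 h3 h4 t
  inj l _ l' _ t t' h := by
    obtain ⟨h0, h1, h2, h3, h4, h5⟩ := generic_sgnSub_x (ε l) (π l) _ rfl
    by_cases hl : l = l'
    · subst hl
      exact ⟨rfl, mob_injective h0 h1 h2 h3 h4 h5 h⟩
    · exfalso
      have hK : mob t' (sgnSub (ε l') (x (π l'))) ∈ fr ({π l} : Set (Fin k)) := by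
        have hy : sgnSub (ε l') (x (π l')) ∈ fr ({π l} : Set (Fin k)) :=
          sgnSub_mem _ _ (x_mem_singleton fun h => hl (π.injective h).symm)
        have := map_mob (fr ({π l} : Set (Fin k))).subtype t' ⟨_, hy⟩
        exact this ▸ SetLike.coe_mem _
      rw [← h] at hK
      have h6 := mem_of_mob_mem _ t hK
      have h7 := sgnSub_mem _ (ε l) h6
      rw [sgnSub_sgnSub] at h7
      exact x_not_mem_fr _ h7

/-- Genericity of the variables passes to the subfields over which the coefficients of the
polynomials must lie. -/
theorem GenericOn.of_map {K E : Type*} [Field K] [Field E] (φ : K →+* E) {R : Finset (Fin k)}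
    {y : Fin k → K} {z : Fin k → E} (hz : GenericOn R z) (h : ∀ l ∈ R, φ (y l) = z l) :
    GenericOn R y where
  ne_zero l hl h0 := hz.ne_zero l hl (by rw [← h l hl, h0, map_zero])
  ne_one l hl h0 := hz.ne_one l hl (by rw [← h l hl, ← map_one φ, ← map_sub, h0, map_zero])
  ne_half l hl t h0 := hz.ne_half l hl t (by
    rw [← h l hl, ← map_mob, h0, map_inv₀, map_ofNat])
  inj l hl l' hl' t t' h0 := hz.inj l hl l' hl' t t' (by
    rw [← h l hl, ← h l' hl', ← map_mob, ← map_mob, h0])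

theorem GenericOn.mono {K : Type*} [Field K] {R R' : Finset (Fin k)} {y : Fin k → K}
    (h : GenericOn R y) (hR : R' ⊆ R) : GenericOn R' y where
  ne_zero l hl := h.ne_zero l (hR hl)
  ne_one l hl := h.ne_one l (hR hl)
  ne_half l hl := h.ne_half l (hR hl)
  inj l hl l' hl' := h.inj l (hR hl) l' (hR hl')

end

section

variable {k : ℕ}

/-! ### Flip invariance from the partial fraction expansion -/

open Polynomial

/-- The sign of the variable of position `p` in the factors of the denominator that belong to the
positions `p` and `z.1`. -/
def outSign (p : Fin k) (z : Fin k × ℤˣ) : ℤˣ := if p < z.1 then z.2 else 1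

/-- The sign of the variable of position `z.1` in the factors of the denominator that belong to the
positions `p` and `z.1`. -/
def inSign (p : Fin k) (z : Fin k × ℤˣ) : ℤˣ := if p < z.1 then 1 else z.2

theorem prod_sign {M : Type*} [CommMonoid M] (f : ℤˣ → M) : ∏ b : ℤˣ, f b = f 1 * f (-1) := by
  rw [show (Finset.univ : Finset ℤˣ) = {1, -1} by decide, Finset.prod_insert (by decide),
    Finset.prod_singleton]

theorem sortPair_gogPair_eq_prod {A : Type*} [CommRing A] (u : Fin k → A) (p l : Fin k) :
    sortPair (gogPair u) p l
      = ∏ b : ℤˣ, (1 - sgnSub (outSign p (l, b)) (u p) * sgnSub (inSign p (l, b)) (u l)) := by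
  rw [prod_sign]
  by_cases h : p < l
  · simp [sortPair, gogPair, outSign, inSign, h]
  · simp [sortPair, gogPair, outSign, inSign, h, mul_comm]

/-- The functions whose products with the pieces have no iterated residue. -/
def Good (v i : Fin k) (s' : ℤˣ) (κ : RatFun k) : Prop :=
  ∀ s, iterRes (κ * piece v i s s') = 0

theorem Good.sum {v i : Fin k} {s' : ℤˣ} {ι : Type*} {t : Finset ι} {κ : ι → RatFun k}
    (h : ∀ j ∈ t, Good v i s' (κ j)) : Good v i s' (∑ j ∈ t, κ j) := fun s => by
  rw [Finset.sum_mul, iterRes_sum]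
  exact Finset.sum_eq_zero fun j hj => h j hj s

/-- The pairs of another position and a sign. -/
def poleIndex (p : Fin k) : Finset (Fin k × ℤˣ) := (Finset.univ.erase p) ×ˢ Finset.univ

theorem mem_poleIndex {p : Fin k} {z : Fin k × ℤˣ} : z ∈ poleIndex p ↔ z.1 ≠ p := by
  rw [poleIndex, Finset.mem_product, Finset.mem_erase, and_iff_left (Finset.mem_univ _),
    and_iff_left (Finset.mem_univ _)]

theorem card_poleIndex (p : Fin k) : (poleIndex p).card = 2 * (k - 1) := by
  rw [poleIndex, Finset.card_product, Finset.card_erase_of_mem (Finset.mem_univ p), Finset.card_univ,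
    Finset.card_univ, Fintype.card_fin, show Fintype.card ℤˣ = 2 from rfl, mul_comm]

/-- The residue of the residuand at one of its poles in the variable of position `p`. -/
def poleCoeff (p : Fin k) (A B : ℕ) (y : Fin k → RatFun k) (z : Fin k × ℤˣ) : RatFun k :=
  let w := sgnSub (inSign p z) (y z.1)
  let r := sgnSub (outSign p z) w⁻¹
  phiAt (Function.update y p r) / (w * (r ^ (A + 1) * (1 - r) ^ (B + 1) *
    ∏ z' ∈ (poleIndex p).erase z,
      (1 - sgnSub (outSign p z') r * sgnSub (inSign p z') (y z'.1))))

theorem mob_of_signs {K : Type*} [Field K] (p : Fin k) (y : Fin k → K) (z : Fin k × ℤˣ) :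
    sgnSub (outSign p z) (sgnSub (inSign p z) (y z.1))⁻¹
      = mob (if z.2 = 1 then 2 else if p < z.1 then 5 else 3) (y z.1) := by
  rcases Int.units_eq_one_or z.2 with h | h <;> by_cases hp : p < z.1 <;>
    simp [outSign, inSign, h, hp, mob]

theorem flipInvariant_polynomial {v : Fin k} {c : RatFun k} (hc : c ∈ fr {v}) {A B : ℕ}
    (P : (fr ({v} : Set (Fin k)))[X]) (hP : P.natDegree ≤ A + B) :
    FlipInvariant v (c * (aeval (x v) P / (x v ^ (A + 1) * (1 - x v) ^ (B + 1)))) := by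
  rw [aeval_eq_sum_range' (Nat.lt_succ_of_le hP), Finset.sum_div, Finset.mul_sum]
  refine FlipInvariant.sum _ fun m hm => ?_
  have e : c * (P.coeff m • x v ^ m / (x v ^ (A + 1) * (1 - x v) ^ (B + 1)))
      = c * (P.coeff m : RatFun k) * (x v ^ (-(A + 1 - m) : ℤ) * (1 - x v) ^ (-(B + 1) : ℤ)) := by
    have h1 : x v ^ (-(A + 1 - m) : ℤ) = x v ^ m * (x v ^ (A + 1))⁻¹ := by
      rw [show (-(A + 1 - m) : ℤ) = m + -((A + 1 : ℕ) : ℤ) by push_cast; ring,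
        zpow_add₀ (x_ne_zero v), zpow_neg, zpow_natCast, zpow_natCast]
    have h2 : (1 - x v) ^ (-(B + 1) : ℤ) = ((1 - x v) ^ (B + 1))⁻¹ := by
      rw [show (-(B + 1) : ℤ) = -((B + 1 : ℕ) : ℤ) by push_cast; ring, zpow_neg, zpow_natCast]
    rw [h1, h2, div_eq_mul_inv, mul_inv, Subfield.smul_def, smul_eq_mul]
    ring
  rw [e]
  refine flipInvariant_monomial ((fr ({v} : Set (Fin k))).mul_mem hc (SetLike.coe_mem _)) _ _ ?_
  have := Finset.mem_range.1 hm
  omega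

/-- The expansion in partial fractions is taken over the field of functions free of x_v. Its
polynomial part is a sum of monomials with i + j ≥ 2. A flip turns a piece into the piece with the
opposite sign and fixes its coefficient, so `Good`, which covers both signs, makes both iterated
residues zero. -/
theorem flipInvariant_of_good {p v : Fin k} {ε : Fin k → ℤˣ} {π : Equiv.Perm (Fin k)}
    (hv : π p = v) (hε : ε p = 1) {y : Fin k → RatFun k} (hy : y = fun l => sgnSub (ε l) (x (π l)))
    {c : RatFun k} (hc : c ∈ fr {v}) {A B : ℕ} (hAB : 2 * k ≤ A + B + 1)
    (hgood : ∀ z : Fin k × ℤˣ, z.1 ≠ p →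
      Good v (π z.1) (inSign p z * ε z.1) (c * poleCoeff p A B y z)) :
    FlipInvariant v (c * (phiAt y / (x v ^ (A + 1) * (1 - x v) ^ (B + 1) *
      ∏ l ∈ Finset.univ.erase p, sortPair (gogPair y) p l))) := by
  have hk := p.pos
  have hyp : y p = x v := by simp [hy, hε, hv]
  have hmem : ∀ l, l ≠ p → y l ∈ fr ({v} : Set (Fin k)) := fun l hl => by
    rw [hy]
    exact sgnSub_mem _ _ (x_mem_singleton fun h => hl (π.injective (h.trans hv.symm)))
  set K := fr ({v} : Set (Fin k)) with hK
  -- The entry at p is a dummy: that coordinate is x_v itself, which is not in K, and is always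
  -- overwritten.
  let yK : Fin k → K := fun l => if h : l ≠ p then ⟨y l, hmem l h⟩ else 0
  have hyK : ∀ l, l ≠ p → algebraMap K (RatFun k) (yK l) = y l := fun l hl => by
    simp only [yK, dif_pos hl]
    rfl
  have hgen : GenericOn (Finset.univ.erase p) yK :=
    (hy ▸ genericOn_x (Finset.univ.erase p) ε π : GenericOn _ y).of_map (algebraMap K (RatFun k))
      fun l hl => hyK l (Finset.ne_of_mem_erase hl)
  have hupd : ∀ a, Function.update (fun i => algebraMap K (RatFun k) (yK i)) p a
      = Function.update y p a := fun a => by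
    funext l
    by_cases hl : l = p
    · subst hl; simp
    · simp [hl, hyK l hl]
  obtain ⟨P, hPdeg, hP⟩ := laurentBdd_phiAt_one (E := RatFun k) yK p
  have hP' : ∀ a : RatFun k, a ≠ 0 → phiAt (Function.update y p a) = aeval a P := fun a ha => by
    have := hP a ha
    rw [zpow_zero, one_mul] at this
    rw [← this]
    dsimp only
    rw [hupd]
  set w : Fin k × ℤˣ → K := fun z => sgnSub (inSign p z) (yK z.1) with hw
  have hw' : ∀ z ∈ poleIndex p, algebraMap K (RatFun k) (w z) = sgnSub (inSign p z) (y z.1) :=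
    fun z hz => by rw [hw, map_sgnSub, hyK _ (mem_poleIndex.1 hz)]
  have hw'' : ∀ z ∈ poleIndex p, sgnSub (inSign p z) (y z.1)
      = sgnSub (inSign p z * ε z.1) (x (π z.1)) := fun z _ => by rw [hy, sgnSub_mul]
  have hwmob : ∀ z, sgnSub (outSign p z) (w z)⁻¹
      = mob (if z.2 = 1 then 2 else if p < z.1 then 5 else 3) (yK z.1) := fun z => mob_of_signs _ _ _
  have hw0 : ∀ z ∈ poleIndex p, w z ≠ 0 := fun z hz h => by
    have := hw' z hz
    rw [h, map_zero, hw'' z hz] at this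
    exact sgnSub_x_ne_zero _ _ this.symm
  have hw1 : ∀ z ∈ poleIndex p, 1 - w z ≠ 0 := fun z hz h => by
    have := congrArg (algebraMap K (RatFun k)) h
    rw [map_sub, map_one, map_zero, hw' z hz, hw'' z hz] at this
    exact one_sub_sgnSub_x_ne_zero _ _ this
  obtain ⟨P₀, hP₀, hpf⟩ := exists_partial_fractions (E := RatFun k) (poleIndex p) (outSign p) w hw0
    hw1 (fun z hz z' hz' h => by
      simp only [hwmob] at h
      obtain ⟨h1, h2⟩ := hgen.inj z.1 (by simpa using mem_poleIndex.1 hz) z'.1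
        (by simpa using mem_poleIndex.1 hz') _ _ h
      refine Prod.ext h1 ?_
      rw [h1] at h2
      rcases Int.units_eq_one_or z.2 with h3 | h3 <;> rcases Int.units_eq_one_or z'.2 with h4 | h4
      · rw [h3, h4]
      · exfalso; revert h2; by_cases h5 : p < z'.1 <;> simp [h3, h4, h5]
      · exfalso; revert h2; by_cases h5 : p < z'.1 <;> simp [h3, h4, h5]
      · rw [h3, h4]) A B P (by
        -- The numerator has degree at most 4k - 3 and there are 2(k - 1) simple poles, so A + B ≥
        -- 2k - 1 is what is needed.
        rw [card_poleIndex]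
        omega)
  have hcoeff : ∀ z ∈ poleIndex p,
      algebraMap K (RatFun k) (pfCoeff (poleIndex p) (outSign p) w A B P z) = poleCoeff p A B y z := by
    intro z hz
    have hr : sgnSub (outSign p z) (algebraMap K (RatFun k) (w z))⁻¹
        = algebraMap K (RatFun k) (sgnSub (outSign p z) (w z)⁻¹) := by
      rw [map_sgnSub (algebraMap K (RatFun k)) (outSign p z), map_inv₀]
    have hr0 : algebraMap K (RatFun k) (sgnSub (outSign p z) (w z)⁻¹) ≠ 0 := by
      rw [hwmob]
      exact (_root_.map_ne_zero _).2 (mob_ne_zero (hgen.ne_zero _ (by simpa using mem_poleIndex.1 hz))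
        (hgen.ne_one _ (by simpa using mem_poleIndex.1 hz)) _)
    rw [pfCoeff, poleCoeff]
    simp only [map_div₀, map_mul, map_pow, map_sub, map_one, map_prod]
    rw [← hw' z hz, hr, hP' _ hr0, aeval_algebraMap_apply]
    congr 3
    refine Finset.prod_congr rfl fun z' hz' => ?_
    rw [map_sgnSub, hw' z' (Finset.mem_of_mem_erase hz')]
  have hprod : ∏ l ∈ Finset.univ.erase p, sortPair (gogPair y) p l = ∏ z ∈ poleIndex p,
      (1 - sgnSub (outSign p z) (x v) * algebraMap K (RatFun k) (w z)) := by
    rw [poleIndex, Finset.prod_product]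
    refine Finset.prod_congr rfl fun l hl => ?_
    rw [sortPair_gogPair_eq_prod, hyp]
    refine Finset.prod_congr rfl fun b _ => ?_
    rw [hw' (l, b) (mem_poleIndex.2 (Finset.ne_of_mem_erase hl))]
  have hphi : phiAt y = aeval (x v) P := by
    rw [← hP' _ (x_ne_zero v), ← hyp, Function.update_eq_self]
  have hpole : ∀ z ∈ poleIndex p, 1 - sgnSub (outSign p z) (x v) * algebraMap K (RatFun k) (w z) ≠ 0 := by
    intro z hz h
    have h1 : sgnSub (outSign p z) (x v) = (algebraMap K (RatFun k) (w z))⁻¹ :=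
      eq_inv_of_mul_eq_one_left (sub_eq_zero.1 h).symm
    refine x_not_mem_fr v ?_
    rw [← sgnSub_sgnSub (outSign p z) (x v), h1]
    exact sgnSub_mem _ _ (inv_mem (SetLike.coe_mem _))
  rw [hprod, hphi, hpf _ (x_ne_zero v) (one_sub_x_ne_zero v) hpole, mul_add, Finset.mul_sum]
  refine (flipInvariant_polynomial hc P₀ hP₀).add (FlipInvariant.sum _ fun z hz => ?_)
  have hz' := mem_poleIndex.1 hz
  rw [hcoeff z hz, hw' z hz, hw'' z hz, ← mul_assoc]
  have hcK : c * poleCoeff p A B y z ∈ fr ({v} : Set (Fin k)) :=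
    (fr ({v} : Set (Fin k))).mul_mem hc (hcoeff z hz ▸ SetLike.coe_mem _)
  have hne : π z.1 ≠ v := fun h => hz' (π.injective (h.trans hv.symm))
  rw [FlipInvariant]
  -- Both sides are zero, one for each sign of x_v in the piece.
  refine Eq.trans ?_ (hgood z hz' (outSign p z)).symm
  have := hgood z hz' (-outSign p z)
  rwa [← flip_piece hne, ← flip_of_mem (Set.mem_singleton v) hcK, ← map_mul] at this

end

section

variable {k : ℕ}

/-! ### The residues of the residuand at its poles -/

open Polynomial

section
variable {K E : Type*} [Field K] [Field E] [Algebra K E]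

/-- The numerator is rewritten in powers of 1 - θ; since its degree is at most M - 2, all resulting
exponents of (1 - θ)⁻¹ are at least 2. -/
theorem exists_eq_sum_inv_pow (G : K[X]) {M : ℕ} (hG : G.natDegree + 2 ≤ M) :
    ∃ c : ℕ → K, ∀ θ : E, 1 - θ ≠ 0 → aeval θ G / (1 - θ) ^ M
      = ∑ d ∈ Finset.range (M - 1), algebraMap K E (c d) * (1 - θ)⁻¹ ^ (M - 2 - d + 2) := by
  refine ⟨(G.comp (1 - X)).coeff, fun θ hθ => ?_⟩
  have hdeg : (G.comp (1 - X)).natDegree < M - 1 := by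
    have h1 : (1 - X : K[X]).natDegree ≤ 1 := by compute_degree
    have h2 : (G.comp (1 - X)).natDegree ≤ G.natDegree * 1 :=
      natDegree_comp_le.trans (Nat.mul_le_mul_left _ h1)
    omega
  have e1 : aeval θ G = aeval (1 - θ) (G.comp (1 - X)) := by
    rw [aeval_comp]
    simp
  rw [e1, aeval_eq_sum_range' hdeg, Finset.sum_div]
  refine Finset.sum_congr rfl fun d hd => ?_
  have hd' := Finset.mem_range.1 hd
  have e2 : M = (M - 2 - d + 2) + d := by omega
  rw [Algebra.smul_def, mul_div_assoc]
  congr 1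
  nth_rewrite 1 [e2]
  rw [pow_add, inv_pow]
  field_simp

/-- Substituting a = θ⁻¹ reverses the coefficients of N. The numerator then has degree at most M - e
- 1, so e ≥ 1 is what gives the gap of two; in the companion case a = θ the gap comes from the bound
on M. -/
theorem exists_aeval_inv_eq (N : K[X]) {e M d : ℕ} (hN : N.natDegree ≤ d) (he : 1 ≤ e)
    (hM : e + d + 1 ≤ M) :
    ∃ G : K[X], G.natDegree + 2 ≤ M ∧ ∀ θ : E, θ ≠ 0 → 1 - θ ≠ 0 →
      θ⁻¹ * (aeval θ⁻¹ N * (θ⁻¹ ^ e / (1 - θ⁻¹) ^ M)) = aeval θ G / (1 - θ) ^ M := by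
  refine ⟨C ((-1) ^ M) * (N.reflect d * X ^ (M - e - 1 - d)), ?_, fun θ hθ h1 => ?_⟩
  · have h1 := natDegree_C_mul_le ((-1) ^ M : K) (N.reflect d * X ^ (M - e - 1 - d))
    have h2 := natDegree_mul_le (p := N.reflect d) (q := X ^ (M - e - 1 - d))
    have h3 := natDegree_X_pow_le (R := K) (M - e - 1 - d)
    have h4 := natDegree_reflect_le (p := N) (N := d)
    rw [max_eq_left hN] at h4
    omega
  · let _ := invertibleOfNonzero hθ
    let _ := invertibleOfNonzero (inv_ne_zero hθ)
    have e1 : aeval θ (N.reflect d) * θ⁻¹ ^ d = aeval θ⁻¹ N := by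
      have := eval₂_reflect_mul_pow (algebraMap K E) θ⁻¹ d N hN
      rwa [invOf_eq_inv, inv_inv] at this
    have e2 : 1 - θ⁻¹ = (-1) * ((1 - θ) * θ⁻¹) := by field_simp; ring
    have e3 : ((-1) ^ M : E) * (-1) ^ M = 1 := by rw [← mul_pow]; simp
    have e4 : ((-1) ^ M : E) ≠ 0 := pow_ne_zero _ (by simp)
    have e5 : θ ^ M = θ ^ (M - e - 1 - d) * (θ ^ d * θ ^ e * θ) := by
      rw [← pow_add, ← pow_succ, ← pow_add]
      congr 1
      omega
    rw [← e1, e2, mul_pow, mul_pow]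
    simp only [map_mul, map_pow, aeval_X, map_neg, map_one, inv_pow, e5]
    generalize aeval θ (N.reflect d) = R
    field_simp
    rw [pow_two, e3, mul_one]

theorem exists_aeval_eq (N : K[X]) {e M d : ℕ} (hN : N.natDegree ≤ d) (he : 1 ≤ e)
    (hM : e + d + 1 ≤ M) :
    ∃ G : K[X], G.natDegree + 2 ≤ M ∧ ∀ θ : E, θ ≠ 0 →
      θ⁻¹ * (aeval θ N * (θ ^ e / (1 - θ) ^ M)) = aeval θ G / (1 - θ) ^ M := by
  refine ⟨N * X ^ (e - 1), ?_, fun θ hθ => ?_⟩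
  · have h2 := natDegree_mul_le (p := N) (q := X ^ (e - 1))
    have h3 := natDegree_X_pow_le (R := K) (e - 1)
    omega
  · obtain ⟨e, rfl⟩ : ∃ e', e = e' + 1 := ⟨e - 1, by omega⟩
    simp only [map_mul, map_pow, aeval_X, Nat.add_sub_cancel, pow_succ]
    field_simp

end

/-- The part of the denominator of the residuand that does not involve position `p`. -/
def restDen {A : Type*} [CommRing A] (n : ℕ) (y : Fin k → A) (p : Fin k) : A :=
  (∏ l ∈ Finset.univ.erase p, gogOne n y l) * pairProd (Finset.univ.erase p) (gogPair y)

theorem gogDen_eq {A : Type*} [CommRing A] (n : ℕ) (y : Fin k → A) (p : Fin k) :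
    gogDen n y = restDen n y p * (y p ^ (n + 1) * (1 - y p) ^ (n + (p : ℕ) + 1 + 1) *
      ∏ l ∈ Finset.univ.erase p, sortPair (gogPair y) p l) := by
  rw [gogDen, restDen, pairProd_univ_split p, ← Finset.mul_prod_erase _ _ (Finset.mem_univ p), gogOne]
  ring

/-- The coordinate at a pole whose inverse is the coordinate of the position `max p z.1`. -/
def poleParam {K : Type*} [Field K] (p : Fin k) (z : Fin k × ℤˣ) (θ : K) : K :=
  if p < z.1 then θ⁻¹ else θ

/-- This is a regrouping of factors: the linear factor that vanishes at the pole is missing on both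
sides, and `poleParam` names a so that the later of the two positions always carries 1/a. -/
theorem restDen_inv_mul_poleCoeff (n : ℕ) {p : Fin k} {z : Fin k × ℤˣ} (hz : z.1 ≠ p)
    {y : Fin k → RatFun k} {θ : RatFun k} (hθ : θ = sgnSub (inSign p z) (y z.1)) (h0 : θ ≠ 0) :
    (restDen n y p)⁻¹ * poleCoeff p n (n + (p : ℕ) + 1) y z = θ⁻¹ *
      (phiAt (Function.update y p (sgnSub (outSign p z) θ⁻¹)) /
        offDen n (Function.update y p (sgnSub (outSign p z) θ⁻¹)) p z.1
          ((2 * poleParam p z θ - 1) / poleParam p z θ)) := by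
  set r := sgnSub (outSign p z) θ⁻¹ with hr
  set U := Function.update y p r with hU
  have hUp : U p = r := by simp [hU]
  have hUl : ∀ l, l ≠ p → U l = y l := fun l hl => by simp [hU, hl]
  have hzp : z.1 ∈ Finset.univ.erase p := by simpa using hz
  have hRp : ∀ l ∈ (Finset.univ.erase p).erase z.1, l ≠ p := fun l hl =>
    Finset.ne_of_mem_erase (Finset.mem_of_mem_erase hl)
  have e1 : ∏ l, gogOne n U l = r ^ (n + 1) * (1 - r) ^ (n + (p : ℕ) + 1 + 1) *
      ∏ l ∈ Finset.univ.erase p, gogOne n y l := by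
    rw [← Finset.mul_prod_erase _ _ (Finset.mem_univ p)]
    congr 1
    · rw [gogOne, hUp]
      ring
    · exact Finset.prod_congr rfl fun l hl => by rw [gogOne, gogOne, hUl l (Finset.ne_of_mem_erase hl)]
  have e2 : pairProd (Finset.univ.erase p) (gogPair y) =
      (∏ l ∈ (Finset.univ.erase p).erase z.1, sortPair (gogPair U) z.1 l) *
        pairProd ((Finset.univ.erase p).erase z.1) (gogPair U) := by
    conv_lhs => rw [← Finset.insert_erase hzp]
    rw [pairProd_insert (Finset.notMem_erase _ _)]
    congr 1
    · refine Finset.prod_congr rfl fun l hl => ?_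
      simp only [sortPair, gogPair, hUl l (hRp l hl), hUl z.1 hz]
    · refine pairProd_congr fun l hl l' hl' => ?_
      simp only [gogPair, hUl l (hRp l hl), hUl l' (hRp l' hl')]
  have e3 : ∏ z' ∈ (poleIndex p).erase z,
      (1 - sgnSub (outSign p z') r * sgnSub (inSign p z') (y z'.1)) =
      (2 * poleParam p z θ - 1) / poleParam p z θ *
        ∏ l ∈ (Finset.univ.erase p).erase z.1, sortPair (gogPair U) p l := by
    -- Apart from the pole itself, position `z.1` contributes the factor with the opposite sign; it
    -- survives and equals (2a - 1)/a.
    have e4 : (poleIndex p).erase z = insert (z.1, -z.2)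
        (((Finset.univ.erase p).erase z.1) ×ˢ Finset.univ) := by
      ext ⟨l, b⟩
      rcases Int.units_eq_one_or z.2 with h | h <;> rcases Int.units_eq_one_or b with rfl | rfl <;>
      by_cases hl : l = z.1 <;> simp [poleIndex, Prod.ext_iff, hl, hz, h, show (1 : ℤˣ) ≠ -1 by decide, show (-1 : ℤˣ) ≠ 1 by decide]
    rw [e4, Finset.prod_insert (by simp), Finset.prod_product]
    congr 1
    · by_cases hlt : p < z.1
      · simp only [outSign, inSign, poleParam, hlt, if_true] at hθ hr ⊢
        rw [sgnSub_one] at hθ ⊢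
        rw [sgnSub_neg, hr, sgnSub_sgnSub, ← hθ]
        field_simp
        ring
      · simp only [outSign, inSign, poleParam, hlt, if_false] at hθ hr ⊢
        rw [sgnSub_one] at hr ⊢
        rw [sgnSub_neg, hr, ← hθ]
        field_simp
        ring
    · refine Finset.prod_congr rfl fun l hl => ?_
      rw [sortPair_gogPair_eq_prod, hUp, hUl l (hRp l hl)]
  rw [poleCoeff, offDen]
  simp only [← hθ, ← hr, ← hU]
  rw [e3, restDen, e2, e1]
  simp only [div_eq_mul_inv, mul_inv]
  ring

/-- The coefficients of G must be free of both x_v and the variable of position `z.1`, since then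
the residues in these two variables can be isolated. Therefore all other coordinates are taken in
the subfield K, and the result near the pole is transported along a = θ or a = θ⁻¹. -/
theorem exists_poleCoeff_eq {n : ℕ} (hkn : k ≤ n) {p v : Fin k} {ε : Fin k → ℤˣ}
    {π : Equiv.Perm (Fin k)} (hv : π p = v) {y : Fin k → RatFun k}
    (hy : y = fun l => sgnSub (ε l) (x (π l))) {z : Fin k × ℤˣ} (hz : z.1 ≠ p)
    {θ : RatFun k} (hθ : θ = sgnSub (inSign p z) (y z.1)) :
    ∃ (G : (fr ({v, π z.1} : Set (Fin k)))[X]) (M : ℕ), G.natDegree + 2 ≤ M ∧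
      (restDen n y p)⁻¹ * poleCoeff p n (n + (p : ℕ) + 1) y z = aeval θ G / (1 - θ) ^ M := by
  have hgenL : GenericOn Finset.univ y := hy ▸ genericOn_x Finset.univ ε π
  have hθx : θ = sgnSub (inSign p z * ε z.1) (x (π z.1)) := by rw [hθ, hy, sgnSub_mul]
  have h0 : θ ≠ 0 := hθx ▸ sgnSub_x_ne_zero _ _
  have h1 : 1 - θ ≠ 0 := hθx ▸ one_sub_sgnSub_x_ne_zero _ _
  have hmem : ∀ l, l ≠ p → l ≠ z.1 → y l ∈ fr ({v, π z.1} : Set (Fin k)) := fun l hl hl' => by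
    rw [hy]
    refine sgnSub_mem _ _ (x_mem_fr ?_)
    rw [Set.mem_insert_iff, Set.mem_singleton_iff, ← hv, π.injective.eq_iff, π.injective.eq_iff]
    tauto
  set K := fr ({v, π z.1} : Set (Fin k)) with hK
  let yK : Fin k → K := fun l => if h : l ≠ p ∧ l ≠ z.1 then ⟨y l, hmem l h.1 h.2⟩ else 0
  have hyK : ∀ l, l ≠ p → l ≠ z.1 → algebraMap K (RatFun k) (yK l) = y l := fun l hl hl' => by
    simp only [yK, dif_pos (And.intro hl hl')]
    rfl
  have hR : ∀ l ∈ (Finset.univ.erase p).erase z.1, l ≠ p ∧ l ≠ z.1 := fun l hl =>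
    ⟨Finset.ne_of_mem_erase (Finset.mem_of_mem_erase hl), Finset.ne_of_mem_erase hl⟩
  have hgen : GenericOn ((Finset.univ.erase p).erase z.1) yK :=
    (hgenL.mono (Finset.subset_univ _)).of_map (algebraMap K (RatFun k))
      fun l hl => hyK l (hR l hl).1 (hR l hl).2
  rw [restDen_inv_mul_poleCoeff n hz hθ h0]
  set U := Function.update y p (sgnSub (outSign p z) θ⁻¹) with hU
  have hUp : U p = sgnSub (outSign p z) θ⁻¹ := by simp [hU]
  have hUl : ∀ l, l ≠ p → U l = y l := fun l hl => by simp [hU, hl]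
  set a := poleParam p z θ with ha
  obtain ⟨t, hat⟩ : ∃ t, a = mob t (y z.1) := by
    rcases Int.units_eq_one_or z.2 with h | h <;> by_cases hlt : p < z.1
    · exact ⟨2, by simp [ha, hθ, poleParam, inSign, hlt, mob]⟩
    · exact ⟨0, by simp [ha, hθ, poleParam, inSign, hlt, h, mob]⟩
    · exact ⟨2, by simp [ha, hθ, poleParam, inSign, hlt, mob]⟩
    · exact ⟨1, by simp [ha, hθ, poleParam, inSign, hlt, h, mob]⟩
  have ha0 : a ≠ 0 := by
    rw [hat]; exact mob_ne_zero (hgenL.ne_zero _ (Finset.mem_univ _)) (hgenL.ne_one _ (Finset.mem_univ _)) _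
  have ha1 : 1 - a ≠ 0 := by
    rw [ha, poleParam]
    split_ifs
    · rw [sub_ne_zero]
      intro h
      rw [eq_comm, inv_eq_one] at h
      exact h1 (by rw [h, sub_self])
    · exact h1
  have ha2 : 2 * a - 1 ≠ 0 := by
    intro h
    refine hgenL.ne_half z.1 (Finset.mem_univ _) t ?_
    rw [← hat]
    exact eq_inv_of_mul_eq_one_left (by linear_combination h)
  have hroots : ∀ l ∈ (Finset.univ.erase p).erase z.1, ∀ t, a ≠ algebraMap K (RatFun k) (mob t (yK l)) := by
    intro l hl t' h
    rw [map_mob, hyK l (hR l hl).1 (hR l hl).2, hat] at h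
    exact (hR l hl).2 (hgenL.inj _ (Finset.mem_univ _) _ (Finset.mem_univ _) _ _ h).1.symm
  have hUR : ∀ l ∈ (Finset.univ.erase p).erase z.1, U l = algebraMap K (RatFun k) (yK l) :=
    fun l hl => by rw [hUl l (hR l hl).1, hyK l (hR l hl).1 (hR l hl).2]
  -- In either case the earlier of the two positions plays the part of i.
  rcases lt_or_gt_of_ne hz with hlt | hlt
  · have hnlt : ¬ p < z.1 := not_lt.2 hlt.le
    have haθ : a = θ := by simp [ha, poleParam, hnlt]
    rw [Finset.erase_right_comm] at hgen hroots hUR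
    obtain ⟨N, e, M, he, hM, hN, h⟩ := exists_phiAt_div_offDen (E := RatFun k) hkn hlt z.2 yK hgen
    obtain ⟨G, hG, hGe⟩ := exists_aeval_eq (E := RatFun k) N hN he hM
    refine ⟨G, M, hG, ?_⟩
    rw [offDen_comm, h a U ha0 ha1 ha2 hroots ?_ ?_ hUR, haθ, hGe θ h0]
    · rw [hUl _ hz, haθ, hθ, inSign, if_neg hnlt, sgnSub_sgnSub]
    · rw [hUp, outSign, if_neg hnlt, sgnSub_one, haθ]
  · have haθ : a = θ⁻¹ := by simp [ha, poleParam, hlt]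
    obtain ⟨N, e, M, he, hM, hN, h⟩ := exists_phiAt_div_offDen (E := RatFun k) hkn hlt z.2 yK hgen
    obtain ⟨G, hG, hGe⟩ := exists_aeval_inv_eq (E := RatFun k) N hN he hM
    refine ⟨G, M, hG, ?_⟩
    rw [h a U ha0 ha1 ha2 hroots ?_ ?_ hUR, haθ, hGe θ h0 h1]
    · rw [hUp, haθ, outSign, if_pos hlt]
    · rw [hUl _ hz, haθ, inv_inv, hθ, inSign, if_pos hlt, sgnSub_one]

end

section

variable {k : ℕ}

/-! ### The residuand is invariant under flips -/

open Polynomial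

theorem F_eq (n k : ℕ) : F n k = phiAt x / gogDen n (x : Fin k → RatFun k) := by
  have h : algebraMap (Poly k) (RatFun k) (Phi k) = phiAt x := by
    rw [← aeval_Phi]
    have : (IsScalarTower.toAlgHom ℚ (Poly k) (RatFun k)) = MvPolynomial.aeval x :=
      MvPolynomial.algHom_ext fun i => by rw [MvPolynomial.aeval_X]; rfl
    exact DFunLike.congr_fun this (Phi k)
  rw [F, h, gogDen, ← prod_Ioi_eq_pairProd]
  rfl

theorem act_F (n : ℕ) (g : SignedPerm k) : g.act (F n k)
    = phiAt (fun l => sgnSub (g.2 (g.1 l)) (x (g.1 l))) /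
      gogDen n (fun l => sgnSub (g.2 (g.1 l)) (x (g.1 l))) := by
  have h : g.act ∘ x = fun l => sgnSub (g.2 (g.1 l)) (x (g.1 l)) := funext fun l => act_x g l
  have h1 : g.act (gogDen n x) = gogDen n (g.act ∘ x) := by
    rw [gogDen, gogDen, map_mul, map_prod, map_pairProd]
    simp only [gogOne, map_mul, map_pow, map_sub, map_one, Function.comp_apply]
    congr 1
    refine pairProd_congr fun i _ j _ => ?_
    simp only [gogPair, map_mul, map_sub, map_one, Function.comp_apply]
  rw [F_eq, map_div₀, map_phiAt, h1, h]

theorem restDen_mem {S : Set (Fin k)} (n : ℕ) {y : Fin k → RatFun k} {p : Fin k}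
    (hy : ∀ l, l ≠ p → y l ∈ fr S) : restDen n y p ∈ fr S := by
  have hy' : ∀ l ∈ Finset.univ.erase p, y l ∈ fr S := fun l hl => hy l (Finset.ne_of_mem_erase hl)
  refine mul_mem (prod_mem fun l hl => ?_) (prod_mem fun l hl => prod_mem fun l' hl' => ?_)
  · exact mul_mem (pow_mem (hy' l hl) _) (pow_mem (sub_mem (one_mem _) (hy' l hl)) _)
  · have h1 := hy' l hl
    have h2 := hy' l' (Finset.mem_filter.1 hl').1
    exact mul_mem (sub_mem (one_mem _) (mul_mem h1 h2))
      (sub_mem (one_mem _) (mul_mem (sub_mem (one_mem _) h1) h2))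

theorem good_aeval_div {v i : Fin k} (hvi : v ≠ i) (s' : ℤˣ) (G : (fr ({v, i} : Set (Fin k)))[X])
    {M : ℕ} (hM : G.natDegree + 2 ≤ M) :
    Good v i s' (aeval (sgnSub s' (x i)) G / (1 - sgnSub s' (x i)) ^ M) := by
  obtain ⟨c, hc⟩ := exists_eq_sum_inv_pow (E := RatFun k) G hM
  rw [hc _ (one_sub_sgnSub_x_ne_zero s' i)]
  refine Good.sum fun d _ s => ?_
  rw [mul_assoc]
  exact iterRes_mul_pow_mul_piece hvi s s' (SetLike.coe_mem (c d)) _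

theorem flipInvariant_phiAt_div {n : ℕ} (hkn : k ≤ n) {p v : Fin k} {ε : Fin k → ℤˣ}
    {π : Equiv.Perm (Fin k)} (hv : π p = v) (hε : ε p = 1) {y : Fin k → RatFun k}
    (hy : y = fun l => sgnSub (ε l) (x (π l))) : FlipInvariant v (phiAt y / gogDen n y) := by
  have hyp : y p = x v := by simp [hy, hε, hv]
  have hmem : ∀ l, l ≠ p → y l ∈ fr ({v} : Set (Fin k)) := fun l hl => by
    rw [hy]
    exact sgnSub_mem _ _ (x_mem_singleton fun h => hl (π.injective (h.trans hv.symm)))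
  have h := flipInvariant_of_good hv hε hy (c := (restDen n y p)⁻¹) (A := n) (B := n + (p : ℕ) + 1)
    (inv_mem (restDen_mem n hmem)) (by omega) fun z hz => by
      obtain ⟨G, M, hM, hG⟩ := exists_poleCoeff_eq hkn hv hy hz rfl
      rw [hG, hy, ← sgnSub_mul]
      exact good_aeval_div (fun h => hz (π.injective (h.symm.trans hv.symm))) _ G hM
  rwa [gogDen_eq n y p, hyp, div_mul_eq_div_div, div_eq_mul_inv (phiAt y), mul_comm (phiAt y), mul_div_assoc]

theorem flip_flip (v : Fin k) (f : RatFun k) : flip v (flip v f) = f := by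
  refine ringHom_ext_x (φ := (flip v).comp (flip v)) (ψ := RingHom.id _) (fun i => ?_) f
  rw [RingHom.comp_apply, RingHom.id_apply]
  by_cases h : i = v
  · subst h
    rw [flip_x_self, map_sub, map_one, flip_x_self, sub_sub_cancel]
  · rw [flip_x_of_ne h, flip_x_of_ne h]

/-- The partial fraction argument assumes that x_v enters unflipped; the other case follows because
the flip is an involution. -/
theorem iterRes_flip_act_F {n : ℕ} (hkn : k ≤ n) (g : SignedPerm k) (v : Fin k) :
    iterRes (flip v (g.act (F n k))) = iterRes (g.act (F n k)) := by
  have key : ∀ g : SignedPerm k, g.2 v = 1 →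
      iterRes (flip v (g.act (F n k))) = iterRes (g.act (F n k)) := fun g hg => by
    rw [act_F]
    exact flipInvariant_phiAt_div hkn (p := g.1.symm v) (Equiv.apply_symm_apply _ _)
      (ε := fun l => g.2 (g.1 l)) (by simpa using hg) rfl
  rcases Int.units_eq_one_or (g.2 v) with h | h
  · exact key g h
  · have h1 := key (g.1, Pi.mulSingle v (-1) * g.2) (by simp [h])
    rw [← flip_act, flip_flip] at h1
    exact h1.symm

theorem iterRes_act_F_sign {n : ℕ} (hkn : k ≤ n) (g : SignedPerm k) :
    iterRes (g.act (F n k)) = iterRes (SignedPerm.act (g.1, 1) (F n k)) := by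
  have key : ∀ S : Finset (Fin k), iterRes (SignedPerm.act (g.1, fun i => if i ∈ S then -1 else 1) (F n k))
      = iterRes (SignedPerm.act (g.1, 1) (F n k)) := by
    intro S
    induction S using Finset.induction_on with
    | empty => rfl
    | insert v S hv ih =>
      rw [← ih, ← iterRes_flip_act_F hkn _ v, flip_act]
      congr 4
      funext i
      by_cases h : i = v
      · subst h; simp [hv]
      · simp [h]
  rw [← key (Finset.univ.filter fun i => g.2 i = -1)]
  congr 3
  refine Prod.ext rfl (funext fun i => ?_)
  rcases Int.units_eq_one_or (g.2 i) with h | h <;> simp [h, show (1 : ℤˣ) ≠ -1 by decide]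

/-! ### The antisymmetric case -/

theorem Good.of_regularAt {v i : Fin k} (hvi : v ≠ i) {h ρ c : RatFun k} (hh : h ∈ fr {v, i})
    (hρ : ρ ∈ fr ({i}ᶜ : Set (Fin k))) (hreg : RegularAt i c ρ) : Good v i 1 (h * ρ) := fun s => by
  rw [mul_assoc]
  exact iterRes_mul_piece_one hvi s hh hρ hreg

theorem good_aeval_mul {v i : Fin k} (hvi : v ≠ i) {h ρ c : RatFun k} (hh : h ∈ fr {v, i})
    (G : (fr ({v, i} : Set (Fin k)))[X]) (hρ : ρ ∈ fr ({i}ᶜ : Set (Fin k))) (hreg : RegularAt i c ρ) :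
    Good v i 1 (h * (aeval (x i) G * ρ)) := by
  rw [aeval_eq_sum_range, Finset.sum_mul, Finset.mul_sum]
  refine Good.sum fun m _ => ?_
  have e : h * (G.coeff m • x i ^ m * ρ) = (h * (G.coeff m : RatFun k)) * (x i ^ m * ρ) := by
    rw [Subfield.smul_def, smul_eq_mul]
    ring
  rw [e]
  refine Good.of_regularAt hvi ((fr ({v, i} : Set (Fin k))).mul_mem hh (SetLike.coe_mem _))
    ((fr ({i}ᶜ : Set (Fin k))).mul_mem (pow_mem (x_mem_compl (Set.mem_singleton _)) _) hρ)
    ((RegularAt.x.pow m).mul hreg)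

/-- The part of the denominator of the residuand without the powers of the variables. -/
def unitDen {A : Type*} [CommRing A] (n : ℕ) (u : Fin k → A) : A :=
  (∏ l : Fin k, (1 - u l) ^ (n + (l : ℕ) + 1)) * pairProd Finset.univ (gogPair u)

theorem flip_antisymm {v : Fin k} {f : RatFun k} (h : FlipInvariant v f) (h' : flip v f = -f) :
    iterRes f = 0 := by
  rw [FlipInvariant, h', iterRes_neg] at h
  exact self_eq_neg.1 h.symm

theorem phiAt_comp_flip (v : Fin k) : flip v (phiAt x) = -phiAt (x : Fin k → RatFun k) := by
  rw [map_phiAt]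
  have h : flip v ∘ x = Function.update (x : Fin k → RatFun k) v (sgnSub (-1) (x v)) := by
    funext l
    by_cases h : l = v
    · subst h; simp [flip_x_self]
    · simp [flip_x_of_ne h, h]
  rw [h, phiAt_update_sgnSub, Function.update_eq_self]
  simp

/-- In the first variable x_p the denominator has equal powers of x_p and 1 - x_p and pair factors
symmetric under the flip, while `Phi` changes sign. So the function is antisymmetric under the flip
of x_p, and flip invariance of its residue forces zero. The pole coefficients differ from those of
`F` by simple factors, and α_l ≤ n for l ≠ p keeps them without a pole at 0. -/
theorem iterRes_phiAt_div_eq_zero {n : ℕ} (hkn : k ≤ n) {p : Fin k} (hp : (p : ℕ) = 0) {α : Fin k → ℕ}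
    (hαp : α p = n + 1) (hα : ∀ l, l ≠ p → α l ≤ n) :
    iterRes (phiAt x / (unitDen n x * ∏ l, (x l : RatFun k) ^ α l)) = 0 := by
  have hmem : ∀ l, l ≠ p → (x l : RatFun k) ∈ fr ({p} : Set (Fin k)) := fun l hl =>
    x_mem_singleton hl
  set y : Fin k → RatFun k := x with hy
  have hy' : y = fun l => sgnSub ((1 : Fin k → ℤˣ) l) (x ((1 : Equiv.Perm (Fin k)) l)) := by
    funext l; simp [hy]
  have hlt : ∀ z : Fin k × ℤˣ, z.1 ≠ p → p < z.1 := fun z hz => by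
    refine lt_of_le_of_ne ?_ hz.symm
    rw [Fin.le_def, hp]
    exact Nat.zero_le _
  -- The quotient of the factors of `gogOne n` by the present denominators, for the variables other
  -- than x_p.
  set h : Fin k → RatFun k := fun l => (1 - y l) * y l ^ (n + 1 - α l) with hh
  have hhmem : ∀ S : Set (Fin k), ∀ l, l ∉ S → h l ∈ fr S := fun S l hl =>
    (fr S).mul_mem (sub_mem (one_mem _) (x_mem_fr hl)) (pow_mem (x_mem_fr hl) _)
  set c := (restDen n y p)⁻¹ * ∏ l ∈ Finset.univ.erase p, h l with hc
  have hcmem : c ∈ fr ({p} : Set (Fin k)) := (fr ({p} : Set (Fin k))).mul_mem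
    (inv_mem (restDen_mem n hmem))
    (prod_mem fun l hl => hhmem _ l (by simpa using Finset.ne_of_mem_erase hl))
  have hF := flipInvariant_of_good (p := p) (v := p) (ε := 1) (π := 1) rfl rfl hy' hcmem (A := n)
    (B := n) (by omega) fun z hz => by
      obtain ⟨G, M, hM, hG⟩ := exists_poleCoeff_eq (v := p) (π := 1) hkn rfl hy' hz rfl
      have hin : inSign p z = 1 := if_pos (hlt z hz)
      have hout : outSign p z = z.2 := if_pos (hlt z hz)
      rw [hin, Pi.one_apply, mul_one, Equiv.Perm.one_apply]
      rw [hin, sgnSub_one, hp, add_zero] at hG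
      have hx0 : y z.1 ≠ 0 := x_ne_zero z.1
      have hx1 : 1 - y z.1 ≠ 0 := one_sub_x_ne_zero z.1
      set r := sgnSub z.2 (y z.1)⁻¹ with hr
      -- The factor 1 - r may have a pole at 0 in this variable, but one more power of the variable,
      -- available from `h` because α ≤ n there, removes it.
      obtain ⟨q, qc, hq, hqmem, hqreg⟩ : ∃ q qc : RatFun k, y z.1 * (1 - r) = q ∧
          q ∈ fr ({z.1}ᶜ : Set (Fin k)) ∧ RegularAt z.1 qc q := by
        have h1 : (x z.1 : RatFun k) ∈ fr ({z.1}ᶜ : Set (Fin k)) := x_mem_compl (Set.mem_singleton _)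
        rcases Int.units_eq_one_or z.2 with h2 | h2
        · refine ⟨x z.1 - 1, _, ?_, sub_mem h1 (one_mem _), RegularAt.x.sub RegularAt.one⟩
          rw [hr, h2, sgnSub_one, mul_sub, mul_inv_cancel₀ hx0, mul_one]
        · refine ⟨1, _, ?_, one_mem _, RegularAt.one⟩
          rw [hr, h2, sgnSub_neg_one, sub_sub_cancel, mul_inv_cancel₀ hx0]
      have hr1 : 1 - r ≠ 0 := by
        rcases Int.units_eq_one_or z.2 with h2 | h2
        · rw [hr, h2, sgnSub_one, sub_ne_zero]
          intro h3
          rw [eq_comm, inv_eq_one] at h3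
          exact hx1 (by rw [h3, sub_self])
        · rw [hr, h2, sgnSub_neg_one, sub_sub_cancel]
          exact inv_ne_zero hx0
      -- The exponent of 1 - x_p is one less than in `F`, which multiplies the pole coefficient by 1
      -- - r.
      have hpole : poleCoeff p n n y z = (1 - r) * poleCoeff p n (n + 1) y z := by
        simp only [poleCoeff, hin, hout, sgnSub_one, ← hr]
        rw [pow_succ (1 - r) (n + 1)]
        simp only [div_eq_mul_inv, mul_inv]
        have h3 : (1 - r) * (1 - r)⁻¹ = 1 := mul_inv_cancel₀ hr1
        generalize (1 - r)⁻¹ = t at h3 ⊢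
        linear_combination (-(phiAt (Function.update y p r) * ((y z.1)⁻¹ * ((r ^ (n + 1))⁻¹ *
          ((1 - r) ^ (n + 1))⁻¹ * (∏ z' ∈ (poleIndex p).erase z,
            (1 - sgnSub (outSign p z') r * sgnSub (inSign p z') (y z'.1)))⁻¹)))) * h3
      have hαz := hα z.1 hz
      have hzmem : z.1 ∈ Finset.univ.erase p := by simpa using hz
      have e : c * poleCoeff p n n y z = (∏ l ∈ (Finset.univ.erase p).erase z.1, h l) *
          (aeval (x z.1) G * ((1 - x z.1) * x z.1 ^ (n - α z.1) * q * ((1 - x z.1) ^ M)⁻¹)) := by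
        have h4 : h z.1 * (1 - r) = (1 - x z.1) * x z.1 ^ (n - α z.1) * q := by
          rw [hh, ← hq]
          dsimp only
          rw [show n + 1 - α z.1 = (n - α z.1) + 1 by omega, pow_succ, hy]
          ring
        rw [← h4, hc, hpole, ← Finset.mul_prod_erase _ _ hzmem, ← hy]
        rw [div_eq_mul_inv] at hG
        linear_combination (h z.1 * (∏ l ∈ (Finset.univ.erase p).erase z.1, h l) * (1 - r)) * hG
      rw [e]
      have hx1mem : 1 - x z.1 ∈ fr ({z.1}ᶜ : Set (Fin k)) :=
        sub_mem (one_mem _) (x_mem_compl (Set.mem_singleton _))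
      have hreg1 : RegularAt z.1 (1 - 0) (1 - x z.1) := RegularAt.one.sub RegularAt.x
      refine good_aeval_mul hz.symm ?_ G ?_ (((hreg1.mul (RegularAt.x.pow (n - α z.1))).mul hqreg).mul
        ((hreg1.pow M).inv (by simp)))
      · refine prod_mem fun l hl => hhmem _ l ?_
        have h5 := Finset.ne_of_mem_erase hl
        have h6 := Finset.ne_of_mem_erase (Finset.mem_of_mem_erase hl)
        simp [h5, h6]
      · exact mul_mem (mul_mem (mul_mem hx1mem (pow_mem (x_mem_compl (Set.mem_singleton _)) _)) hqmem)
          (inv_mem (pow_mem hx1mem _))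
  have hfe : phiAt y / (unitDen n y * ∏ l, y l ^ α l) = c * (phiAt y / (x p ^ (n + 1) *
      (1 - x p) ^ (n + 1) * ∏ l ∈ Finset.univ.erase p, sortPair (gogPair y) p l)) := by
    have e1 : ∏ l ∈ Finset.univ.erase p, gogOne n y l = (∏ l ∈ Finset.univ.erase p, h l) *
        ((∏ l ∈ Finset.univ.erase p, (1 - y l) ^ (n + (l : ℕ) + 1)) *
          ∏ l ∈ Finset.univ.erase p, y l ^ α l) := by
      rw [← Finset.prod_mul_distrib, ← Finset.prod_mul_distrib]
      refine Finset.prod_congr rfl fun l hl => ?_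
      obtain ⟨d, hd⟩ := Nat.exists_eq_add_of_le (hα l (Finset.ne_of_mem_erase hl))
      rw [gogOne, hh]
      dsimp only
      rw [show n + 1 - α l = d + 1 by omega]
      nth_rewrite 1 [show n + 1 = d + 1 + α l by omega]
      ring
    have hhne : ∏ l ∈ Finset.univ.erase p, h l ≠ 0 := Finset.prod_ne_zero_iff.2 fun l _ =>
      mul_ne_zero (one_sub_x_ne_zero l) (pow_ne_zero _ (x_ne_zero l))
    rw [hc, unitDen, restDen, e1, ← Finset.mul_prod_erase _ (fun l => y l ^ α l) (Finset.mem_univ p),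
      ← Finset.mul_prod_erase _ (fun l : Fin k => (1 - y l) ^ (n + (l : ℕ) + 1)) (Finset.mem_univ p),
      pairProd_univ_split p, hαp, hp, add_zero]
    generalize (∏ l ∈ Finset.univ.erase p, h l) = H at hhne ⊢
    generalize (∏ l ∈ Finset.univ.erase p, (1 - y l) ^ (n + (l : ℕ) + 1)) = H1
    generalize (∏ l ∈ Finset.univ.erase p, y l ^ α l) = H2
    generalize pairProd (Finset.univ.erase p) (gogPair y) = H3
    generalize (∏ l ∈ Finset.univ.erase p, sortPair (gogPair y) p l) = H4
    rw [← hy]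
    simp only [div_eq_mul_inv, mul_inv]
    have h7 := inv_mul_cancel₀ hhne
    linear_combination (-(phiAt y * (y p ^ (n + 1))⁻¹ * ((1 - y p) ^ (n + 1))⁻¹ * H1⁻¹ * H2⁻¹ * H3⁻¹ *
      H4⁻¹)) * h7
  rw [hfe]
  refine flip_antisymm hF ?_
  clear_value c
  have hflip : flip p (∏ l ∈ Finset.univ.erase p, sortPair (gogPair y) p l)
      = ∏ l ∈ Finset.univ.erase p, sortPair (gogPair y) p l := by
    rw [map_prod]
    refine Finset.prod_congr rfl fun l hl => ?_
    have hl' := Finset.ne_of_mem_erase hl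
    have hpl : p < l := hlt (l, 1) hl'
    simp only [sortPair, if_pos hpl, gogPair, map_mul, map_sub, map_one, hy, flip_x_self,
      flip_x_of_ne hl']
    ring
  rw [map_mul, map_div₀, map_mul, map_mul, map_pow, map_pow, map_sub, map_one, hflip,
    phiAt_comp_flip, flip_x_self, flip_of_mem (Set.mem_singleton p) hcmem, sub_sub_cancel,
    mul_comm ((1 - x p) ^ (n + 1)), neg_div, mul_neg]

end

/-! ### Residues as power series coefficients -/

section

variable {k : ℕ}

/-! ### Rational functions with a power series expansion at the origin -/

/-- `s` is the power series expansion of `f` at the origin. -/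
def HasExp (f : RatFun k) (s : MvPowerSeries (Fin k) ℚ) : Prop :=
  ∃ P U : Poly k, MvPolynomial.constantCoeff U ≠ 0 ∧
    f * algebraMap (Poly k) (RatFun k) U = algebraMap (Poly k) (RatFun k) P ∧
      s * (U : MvPowerSeries (Fin k) ℚ) = P

theorem constantCoeff_coe_poly (U : Poly k) :
    MvPowerSeries.constantCoeff (U : MvPowerSeries (Fin k) ℚ) = MvPolynomial.constantCoeff U :=
  MvPolynomial.coeff_coe U 0

namespace HasExp

variable {f g : RatFun k} {s t : MvPowerSeries (Fin k) ℚ}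

theorem of_poly (P : Poly k) : HasExp (algebraMap (Poly k) (RatFun k) P) P :=
  ⟨P, 1, by simp, by simp, by simp⟩

theorem one : HasExp (1 : RatFun k) 1 := by simpa using of_poly (1 : Poly k)

theorem x (i : Fin k) : HasExp (Gog.x i) (MvPowerSeries.X i) := by
  have h := of_poly (MvPolynomial.X i : Poly k)
  rw [MvPolynomial.coe_X] at h
  exact h

theorem add (hf : HasExp f s) (hg : HasExp g t) : HasExp (f + g) (s + t) := by
  obtain ⟨P, U, h1, h2, h3⟩ := hf
  obtain ⟨Q, V, h4, h5, h6⟩ := hg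
  refine ⟨P * V + Q * U, U * V, ?_, ?_, ?_⟩
  · rw [map_mul]; exact mul_ne_zero h1 h4
  · rw [map_mul, map_add, map_mul, map_mul, ← h2, ← h5]; ring
  · push_cast
    rw [← h3, ← h6]; ring

theorem mul (hf : HasExp f s) (hg : HasExp g t) : HasExp (f * g) (s * t) := by
  obtain ⟨P, U, h1, h2, h3⟩ := hf
  obtain ⟨Q, V, h4, h5, h6⟩ := hg
  refine ⟨P * Q, U * V, ?_, ?_, ?_⟩
  · rw [map_mul]; exact mul_ne_zero h1 h4
  · rw [map_mul, map_mul, ← h2, ← h5]; ring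
  · push_cast
    rw [← h3, ← h6]; ring

theorem neg (hf : HasExp f s) : HasExp (-f) (-s) := by
  obtain ⟨P, U, h1, h2, h3⟩ := hf
  refine ⟨-P, U, h1, by rw [neg_mul, h2, map_neg], ?_⟩
  rw [neg_mul, h3]
  exact (map_neg (MvPolynomial.coeToMvPowerSeries.ringHom (σ := Fin k) (R := ℚ)) P).symm

theorem inv (hf : HasExp f s) (hs : MvPowerSeries.constantCoeff s ≠ 0) : HasExp f⁻¹ s⁻¹ := by
  obtain ⟨P, U, h1, h2, h3⟩ := hf
  have hP : MvPolynomial.constantCoeff P ≠ 0 := by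
    rw [← constantCoeff_coe_poly, ← h3, map_mul, constantCoeff_coe_poly]
    exact mul_ne_zero hs h1
  have hf0 : f ≠ 0 := by
    rintro rfl
    rw [zero_mul, eq_comm, map_eq_zero_iff _ (IsFractionRing.injective (Poly k) (RatFun k))] at h2
    exact hP (by rw [h2, map_zero])
  refine ⟨U, P, hP, ?_, ?_⟩
  · rw [← h2, inv_mul_cancel_left₀ hf0]
  · rw [← h3, ← mul_assoc, MvPowerSeries.inv_mul_cancel _ hs, one_mul]

end HasExp

/-- The ring of rational functions that are defined at the origin. -/
def originRing (k : ℕ) : Subring (RatFun k) where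
  carrier := {f | ∃ s, HasExp f s}
  mul_mem' := fun ⟨_, hf⟩ ⟨_, hg⟩ => ⟨_, hf.mul hg⟩
  one_mem' := ⟨_, HasExp.one⟩
  add_mem' := fun ⟨_, hf⟩ ⟨_, hg⟩ => ⟨_, hf.add hg⟩
  zero_mem' := ⟨0, by simpa using HasExp.of_poly (0 : Poly k)⟩
  neg_mem' := fun ⟨_, hf⟩ => ⟨_, hf.neg⟩

theorem x_mem_originRing (i : Fin k) : x i ∈ originRing k := ⟨_, HasExp.x i⟩

theorem algebraMap_inv_mem_originRing {U : Poly k} (hU : MvPolynomial.constantCoeff U ≠ 0) :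
    (algebraMap (Poly k) (RatFun k) U)⁻¹ ∈ originRing k :=
  ⟨_, (HasExp.of_poly U).inv (by rwa [constantCoeff_coe_poly])⟩

/-- The substitution of `0` for `x_j`. -/
def killVar (j : Fin k) : Poly k →ₐ[ℚ] Poly k :=
  MvPolynomial.aeval fun i => if i = j then 0 else MvPolynomial.X i

theorem constantCoeff_killVar (j : Fin k) (p : Poly k) :
    MvPolynomial.constantCoeff (killVar j p) = MvPolynomial.constantCoeff p := by
  have h : (MvPolynomial.constantCoeff : Poly k →+* ℚ).comp (killVar j).toRingHom
      = MvPolynomial.constantCoeff := by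
    refine MvPolynomial.ringHom_ext (fun r => ?_) fun i => ?_
    · simp [killVar]
    · by_cases hi : i = j <;> simp [killVar, hi]
  exact RingHom.congr_fun h p

theorem ringHom_ext_poly {R : Type*} [Ring R] {φ ψ : Poly k →+* R}
    (h : ∀ i, φ (MvPolynomial.X i) = ψ (MvPolynomial.X i)) (p : Poly k) : φ p = ψ p := by
  induction p using MvPolynomial.induction_on with
  | C a => exact RingHom.congr_fun (RingHom.ext_rat (φ.comp MvPolynomial.C) (ψ.comp MvPolynomial.C)) a
  | add p q hp hq => rw [map_add, map_add, hp, hq]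
  | mul_X p i hp => rw [map_mul, map_mul, hp, h i]

/-- The expansion of polynomials in powers of `x_j`. -/
def polyToSeries (j : Fin k) : Poly k →+* PowerSeries (originRing k) :=
  MvPolynomial.eval₂Hom
    ((PowerSeries.C).comp ((algebraMap (Poly k) (RatFun k)).comp MvPolynomial.C |>.codRestrict
      (originRing k) fun _ => ⟨_, HasExp.of_poly _⟩))
    fun i => if i = j then PowerSeries.X else PowerSeries.C ⟨x i, x_mem_originRing i⟩

theorem laurentExpansion_eq_polyToSeries (j : Fin k) (p : Poly k) :
    laurentExpansion j (algebraMap (Poly k) (RatFun k) p) = HahnSeries.ofPowerSeries ℤ (RatFun k)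
      (PowerSeries.map (originRing k).subtype (polyToSeries j p)) := by
  refine ringHom_ext_poly (φ := (laurentExpansion j).comp (algebraMap (Poly k) (RatFun k)))
    (ψ := ((HahnSeries.ofPowerSeries ℤ (RatFun k)).comp (PowerSeries.map (originRing k).subtype)).comp
      (polyToSeries j)) (fun i => ?_) p
  change laurentExpansion j (x i) = HahnSeries.ofPowerSeries ℤ (RatFun k)
      (PowerSeries.map (originRing k).subtype (polyToSeries j (MvPolynomial.X i)))
  rw [polyToSeries, MvPolynomial.coe_eval₂Hom, MvPolynomial.eval₂_X]
  by_cases h : i = j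
  · subst h
    rw [if_pos rfl, PowerSeries.map_X, HahnSeries.ofPowerSeries_X, laurentExpansion_x_self]
  · rw [if_neg h, PowerSeries.map_C, HahnSeries.ofPowerSeries_C, laurentExpansion_x_of_ne h]
    rfl

theorem constantCoeff_polyToSeries (j : Fin k) (p : Poly k) :
    ((PowerSeries.constantCoeff (polyToSeries j p) : originRing k) : RatFun k)
      = algebraMap (Poly k) (RatFun k) (killVar j p) := by
  refine ringHom_ext_poly (φ := ((originRing k).subtype.comp PowerSeries.constantCoeff).comp
    (polyToSeries j)) (ψ := (algebraMap (Poly k) (RatFun k)).comp (killVar j).toRingHom) (fun i => ?_) p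
  change ((PowerSeries.constantCoeff (polyToSeries j (MvPolynomial.X i)) : originRing k) : RatFun k)
    = algebraMap (Poly k) (RatFun k) (killVar j (MvPolynomial.X i))
  rw [polyToSeries, MvPolynomial.coe_eval₂Hom, MvPolynomial.eval₂_X, killVar, MvPolynomial.aeval_X]
  by_cases h : i = j
  · simp [h]
  · rw [if_neg h, if_neg h, PowerSeries.constantCoeff_C]
    rfl

/-- Write f = P/U with U nonzero at the origin. As a series in x_j, U has constant term U at x_j =
0, which is invertible in `originRing`; so U is invertible and the expansion has coefficients in
`originRing`. -/
theorem exists_series_of_mem {f : RatFun k} (hf : f ∈ originRing k) (j : Fin k) :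
    ∃ p : PowerSeries (originRing k), laurentExpansion j f = HahnSeries.ofPowerSeries ℤ (RatFun k)
      (PowerSeries.map (originRing k).subtype p) := by
  obtain ⟨s, P, U, hU, hf, -⟩ := hf
  set u := polyToSeries j U with hu
  have h1 : ((PowerSeries.constantCoeff u : originRing k) : RatFun k) ≠ 0 := by
    rw [constantCoeff_polyToSeries, ne_eq, map_eq_zero_iff _ (IsFractionRing.injective (Poly k) (RatFun k))]
    intro h
    have := constantCoeff_killVar j U
    rw [h, map_zero] at this
    exact hU this.symm
  have h2 : IsUnit u := by
    rw [PowerSeries.isUnit_iff_constantCoeff]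
    refine IsUnit.of_mul_eq_one ⟨_, algebraMap_inv_mem_originRing (U := killVar j U) ?_⟩
      (Subtype.ext ?_)
    · rwa [constantCoeff_killVar]
    · change _ * (algebraMap (Poly k) (RatFun k) (killVar j U))⁻¹ = 1
      rw [← constantCoeff_polyToSeries]
      exact mul_inv_cancel₀ h1
  obtain ⟨w, hw⟩ := h2.exists_right_inv
  refine ⟨polyToSeries j P * w, ?_⟩
  have h3 := congrArg (laurentExpansion j) hf
  rw [map_mul, laurentExpansion_eq_polyToSeries, laurentExpansion_eq_polyToSeries] at h3
  rw [map_mul, map_mul, ← h3, mul_assoc, ← map_mul, ← map_mul, ← hu, hw, map_one, map_one, mul_one]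

theorem res_zpow_mul {f : RatFun k} (hf : f ∈ originRing k) (j : Fin k) (a : ℤ) :
    res j (x j ^ (-a) * f) ∈ originRing k ∧ (a ≤ 0 → res j (x j ^ (-a) * f) = 0) := by
  obtain ⟨p, hp⟩ := exists_series_of_mem hf j
  have h1 : laurentExpansion j (x j ^ (-a)) = HahnSeries.single (-a) 1 := by
    rw [map_zpow₀, laurentExpansion_x_self, ← RatFunc.single_zpow]
  have h2 : res j (x j ^ (-a) * f) = if a - 1 < 0 then 0 else
      ((PowerSeries.coeff (a - 1).natAbs p : originRing k) : RatFun k) := by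
    have h := HahnSeries.coeff_single_mul (r := (1 : RatFun k)) (b := -a)
      (x := HahnSeries.ofPowerSeries ℤ (RatFun k) (PowerSeries.map (originRing k).subtype p)) (a := -1)
    rw [res, map_mul, hp, h1, h, one_mul, show (-1 : ℤ) - -a = a - 1 by ring]
    refine (PowerSeries.coeff_coe _ (a - 1)).trans ?_
    simp
  rw [h2]
  refine ⟨?_, fun ha => if_pos (by omega)⟩
  split_ifs
  · exact zero_mem _
  · exact SetLike.coe_mem _

/-- Regularity at the origin survives each residue, so the next one again meets a regular function
times a power of its variable; a power without pole gives zero. -/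
theorem lres_mul_prod_zpow {f : RatFun k} (hf : f ∈ originRing k) (α : Fin k → ℤ) (l : List (Fin k))
    (hl : l.Nodup) : lres l (f * (l.map fun i => x i ^ (-α i)).prod) ∈ originRing k ∧
      ((∃ j ∈ l, α j ≤ 0) → lres l (f * (l.map fun i => x i ^ (-α i)).prod) = 0) := by
  induction l with
  | nil => simpa [lres] using hf
  | cons j l ih =>
    obtain ⟨hjl, hl⟩ := List.nodup_cons.1 hl
    obtain ⟨ih1, ih2⟩ := ih hl
    have e : lres (j :: l) (f * ((j :: l).map fun i => x i ^ (-α i)).prod)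
        = res j (x j ^ (-α j) * lres l (f * (l.map fun i => x i ^ (-α i)).prod)) := by
      rw [lres_cons, List.map_cons, List.prod_cons, mul_left_comm,
        lres_mul l (S := {i | i ∈ l}) (fun _ h => h) (zpow_mem (x_mem_fr hjl) _)]
    rw [e]
    obtain ⟨h1, h2⟩ := res_zpow_mul ih1 j (α j)
    refine ⟨h1, ?_⟩
    rintro ⟨i, hi, hαi⟩
    rcases List.mem_cons.1 hi with rfl | hi
    · exact h2 hαi
    · rw [ih2 ⟨i, hi, hαi⟩, mul_zero, res_zero]

theorem iterRes_mul_prod_zpow_eq_zero {f : RatFun k} (hf : f ∈ originRing k) (α : Fin k → ℤ)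
    {j : Fin k} (hj : α j ≤ 0) : iterRes (f * ∏ i, x i ^ (-α i)) = 0 := by
  rw [iterRes_eq_lres, ← List.prod_ofFn, List.ofFn_eq_map]
  exact (lres_mul_prod_zpow hf α _ (List.nodup_finRange k)).2 ⟨j, List.mem_finRange j, hj⟩

theorem res_zpow (j : Fin k) (a : ℤ) : res j (x j ^ (-a)) = if a = 1 then 1 else 0 := by
  rw [res, map_zpow₀, laurentExpansion_x_self, ← RatFunc.single_zpow, HahnSeries.coeff_single]
  split_ifs with h1 h2 h2
  · rfl
  · omega
  · omega
  · rfl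

theorem iterRes_monomial (α : Fin k → ℤ) :
    iterRes (∏ i : Fin k, x i ^ (-α i)) = if ∀ i, α i = 1 then 1 else 0 := by
  have h : ∀ l : List (Fin k), l.Nodup → lres l (l.map fun i => x i ^ (-α i)).prod
      = if ∀ i ∈ l, α i = 1 then 1 else 0 := by
    intro l hl
    induction l with
    | nil => simp [lres]
    | cons j l ih =>
      obtain ⟨hjl, hl⟩ := List.nodup_cons.1 hl
      rw [lres_cons, List.map_cons, List.prod_cons,
        lres_mul l (S := {i | i ∈ l}) (fun _ h => h) (zpow_mem (x_mem_fr hjl) _), ih hl]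
      by_cases h : ∀ i ∈ l, α i = 1
      · rw [if_pos h, mul_one, res_zpow]
        exact if_congr (by simpa using fun _ => h) rfl rfl
      · rw [if_neg h, mul_zero, res_zero, if_neg fun h' => h fun i hi => h' i (List.mem_cons_of_mem _ hi)]
  rw [iterRes_eq_lres, ← List.prod_ofFn, List.ofFn_eq_map, h _ (List.nodup_finRange k)]
  simp

theorem algebraMap_eq_sum (P : Poly k) : algebraMap (Poly k) (RatFun k) P
    = ∑ d ∈ P.support, ((P.coeff d : ℚ) : RatFun k) * ∏ i, x i ^ d i := by
  conv_lhs => rw [P.as_sum]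
  rw [map_sum]
  refine Finset.sum_congr rfl fun d _ => ?_
  rw [MvPolynomial.monomial_eq, map_mul, Finsupp.prod_fintype _ _ (by simp), map_prod]
  congr 1
  · exact RingHom.congr_fun (RingHom.ext_rat ((algebraMap (Poly k) (RatFun k)).comp MvPolynomial.C)
        (Rat.castHom (RatFun k))) _
  · exact Finset.prod_congr rfl fun i _ => by rw [map_pow]; rfl

/-- The iterated residue picks a coefficient of the expansion at the origin. -/
theorem iterRes_div_eq_coeff {f : RatFun k} {s : MvPowerSeries (Fin k) ℚ} (hf : HasExp f s)
    (β : Fin k →₀ ℕ) : iterRes (f / ∏ i, x i ^ (β i + 1)) = ((MvPowerSeries.coeff β s : ℚ) : RatFun k) := by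
  obtain ⟨P, U, hU, h1, h2⟩ := hf
  set T := MvPowerSeries.trunc' ℚ β s with hT
  have hU0 : algebraMap (Poly k) (RatFun k) U ≠ 0 := by
    rw [ne_eq, map_eq_zero_iff _ (IsFractionRing.injective (Poly k) (RatFun k))]
    rintro rfl
    exact hU (map_zero _)
  have hf : f = algebraMap (Poly k) (RatFun k) T +
      algebraMap (Poly k) (RatFun k) (P - T * U) * (algebraMap (Poly k) (RatFun k) U)⁻¹ := by
    rw [map_sub, map_mul, sub_mul, mul_inv_cancel_right₀ hU0, ← h1, mul_inv_cancel_right₀ hU0]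
    ring
  -- The polynomial T agrees with s up to exponent β, so P - T U has no monomial below β. Each of
  -- its monomials cancels the whole pole in some variable and contributes nothing.
  have hcoeff : ∀ d ∈ (P - T * U).support, ∃ j, β j < d j := by
    intro d hd
    by_contra! hle
    refine (MvPolynomial.mem_support_iff.1 hd) ?_
    rw [MvPolynomial.coeff_sub, sub_eq_zero, ← MvPolynomial.coeff_coe, ← MvPolynomial.coeff_coe, ← h2,
      MvPolynomial.coe_mul, MvPowerSeries.coeff_mul, MvPowerSeries.coeff_mul]
    refine Finset.sum_congr rfl fun z hz => ?_
    have hz' : z.1 ≤ β := fun i => by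
      have := DFunLike.congr_fun (Finset.HasAntidiagonal.mem_antidiagonal.1 hz) i
      have h3 := hle i
      simp only [Finsupp.add_apply] at this
      omega
    rw [MvPolynomial.coeff_coe T, hT, MvPowerSeries.coeff_trunc', if_pos hz']
  have hpow : ∀ d : Fin k →₀ ℕ, (∏ i, (x i : RatFun k) ^ d i) / ∏ i, x i ^ (β i + 1)
      = ∏ i, x i ^ (-((β i : ℤ) + 1 - d i)) := by
    intro d
    rw [← Finset.prod_div_distrib]
    refine Finset.prod_congr rfl fun i _ => ?_
    rw [show (-((β i : ℤ) + 1 - d i)) = (d i : ℤ) - ((β i + 1 : ℕ) : ℤ) by push_cast; ring,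
      zpow_sub₀ (x_ne_zero i), zpow_natCast, zpow_natCast]
  rw [hf, add_div, iterRes_add, algebraMap_eq_sum T, algebraMap_eq_sum (P - T * U), Finset.sum_mul,
    Finset.sum_div, Finset.sum_div, iterRes_sum, iterRes_sum, Finset.sum_eq_zero (s := (P - T * U).support),
    add_zero]
  · have e : ∀ d ∈ T.support, iterRes (((T.coeff d : ℚ) : RatFun k) * (∏ i, x i ^ d i) / ∏ i, x i ^ (β i + 1))
        = if d = β then ((T.coeff d : ℚ) : RatFun k) else 0 := by
      intro d _
      rw [mul_div_assoc, iterRes_ratCast_mul, hpow, iterRes_monomial]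
      have h3 : (∀ i, (β i : ℤ) + 1 - d i = 1) ↔ d = β := by
        rw [DFunLike.ext_iff]
        exact forall_congr' fun i => by omega
      simp [h3]
    rw [Finset.sum_congr rfl e, Finset.sum_ite_eq']
    have h4 : T.coeff β = MvPowerSeries.coeff β s := by
      rw [hT, MvPowerSeries.coeff_trunc', if_pos le_rfl]
    split_ifs with h5
    · rw [h4]
    · rw [← h4, MvPolynomial.notMem_support_iff.1 h5, Rat.cast_zero]
  · intro d hd
    obtain ⟨j, hj⟩ := hcoeff d hd
    rw [mul_assoc, mul_div_assoc, iterRes_ratCast_mul, mul_div_right_comm, hpow, mul_comm (∏ i, _),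
      iterRes_mul_prod_zpow_eq_zero (algebraMap_inv_mem_originRing hU) _ (j := j) (by omega), mul_zero]

end

section

variable {k : ℕ}

/-! ### Coefficients of power series -/

/-- The coefficient of a power series at a vector of exponents. -/
def cf (s : MvPowerSeries (Fin k) ℚ) (α : Fin k → ℕ) : ℚ :=
  MvPowerSeries.coeff (Finsupp.equivFunOnFinite.symm α) s

theorem cf_ext {s t : MvPowerSeries (Fin k) ℚ} (h : ∀ α, cf s α = cf t α) : s = t := by
  refine MvPowerSeries.ext fun d => ?_
  have := h d
  simpa [cf] using this

theorem cf_sub (s t : MvPowerSeries (Fin k) ℚ) (α : Fin k → ℕ) : cf (s - t) α = cf s α - cf t α :=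
  map_sub _ _ _

theorem cf_neg (s : MvPowerSeries (Fin k) ℚ) (α : Fin k → ℕ) : cf (-s) α = -cf s α :=
  map_neg _ _

theorem cf_X_mul (i : Fin k) (s : MvPowerSeries (Fin k) ℚ) (α : Fin k → ℕ) :
    cf (MvPowerSeries.X i * s) α = if α i = 0 then 0 else cf s (Function.update α i (α i - 1)) := by
  rw [cf, MvPowerSeries.X, MvPowerSeries.coeff_monomial_mul, one_mul]
  by_cases h : α i = 0
  · rw [if_pos h, if_neg]
    simpa [Finsupp.single_le_iff] using h
  · rw [if_neg h, if_pos (by simpa [Finsupp.single_le_iff] using Nat.one_le_iff_ne_zero.2 h), cf]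
    congr 2
    ext l
    by_cases hl : l = i
    · subst hl; simp
    · simp [hl]

theorem cf_rename (π : Equiv.Perm (Fin k)) (s : MvPowerSeries (Fin k) ℚ) (α : Fin k → ℕ) :
    cf (MvPowerSeries.rename π s) α = cf s (α ∘ π) := by
  have h := MvPowerSeries.coeff_embDomain_rename π.toEmbedding s (Finsupp.equivFunOnFinite.symm (α ∘ π))
  rw [cf, cf, ← h]
  congr 2
  ext l
  rw [← π.apply_symm_apply l]
  rw [show π (π.symm l) = π.toEmbedding (π.symm l) from rfl, Finsupp.embDomain_apply_self]
  simp

theorem cf_mul (s t : MvPowerSeries (Fin k) ℚ) (α : Fin k → ℕ) :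
    cf (s * t) α = ∑ β ∈ Finset.Iic α, cf s β * cf t (α - β) := by
  rw [cf, MvPowerSeries.coeff_mul]
  refine Finset.sum_bij' (fun z _ => ⇑z.1) (fun β _ => (Finsupp.equivFunOnFinite.symm β,
    Finsupp.equivFunOnFinite.symm (α - β))) ?_ ?_ ?_ ?_ ?_
  · intro z hz
    have h := Finset.HasAntidiagonal.mem_antidiagonal.1 hz
    rw [Finset.mem_Iic]
    intro i
    have : z.1 i + z.2 i = α i := DFunLike.congr_fun h i
    change z.1 i ≤ α i
    omega
  · intro β hβ
    rw [Finset.HasAntidiagonal.mem_antidiagonal]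
    ext i
    have : β i ≤ α i := Finset.mem_Iic.1 hβ i
    change β i + (α i - β i) = α i
    omega
  · intro z hz
    have h := Finset.HasAntidiagonal.mem_antidiagonal.1 hz
    refine Prod.ext (by ext; simp) (Finsupp.ext fun i => ?_)
    have : z.1 i + z.2 i = α i := DFunLike.congr_fun h i
    change α i - z.1 i = z.2 i
    omega
  · intro β _
    simp
  · intro z hz
    have h := Finset.HasAntidiagonal.mem_antidiagonal.1 hz
    rw [cf, cf]
    congr 3
    · ext; simp
    · refine Finsupp.ext fun i => ?_
      have : z.1 i + z.2 i = α i := DFunLike.congr_fun h i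
      change z.2 i = α i - z.1 i
      omega

theorem cf_one (α : Fin k → ℕ) : cf 1 α = if α = 0 then 1 else 0 := by
  rw [cf, MvPowerSeries.coeff_one]
  refine if_congr ?_ rfl rfl
  rw [DFunLike.ext_iff, funext_iff]
  simp

/-- The product of the geometric series. -/
def geomSeries (k : ℕ) : MvPowerSeries (Fin k) ℚ := fun _ => 1

/-- Multiplying by one factor 1 - X_j leaves exactly the coefficients with exponent 0 at j; the
factors are added one by one. -/
theorem prod_one_sub_X_mul_geomSeries (k : ℕ) :
    (∏ i : Fin k, (1 - MvPowerSeries.X i)) * geomSeries k = 1 := by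
  have h : ∀ S : Finset (Fin k), ∀ α, cf ((∏ i ∈ S, (1 - MvPowerSeries.X i)) * geomSeries k) α
      = if ∀ i ∈ S, α i = 0 then 1 else 0 := by
    intro S
    induction S using Finset.induction_on with
    | empty => intro α; simp [cf, geomSeries, MvPowerSeries.coeff_apply]
    | insert j S hj ih =>
      intro α
      rw [Finset.prod_insert hj, mul_assoc, sub_mul, one_mul, cf_sub, cf_X_mul, ih, ih]
      have h1 : (∀ i ∈ S, Function.update α j (α j - 1) i = 0) ↔ ∀ i ∈ S, α i = 0 :=
        forall₂_congr fun i hi => by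
          rw [Function.update_of_ne (fun h => hj (h ▸ hi) : i ≠ j)]
      rw [if_congr h1 rfl rfl]
      by_cases h2 : α j = 0
      · simp [h2]
      · simp [h2]
  refine cf_ext fun α => ?_
  rw [h, cf_one]
  exact if_congr (by simp [funext_iff]) rfl rfl

theorem cf_eq_sum_of_mul (s t : MvPowerSeries (Fin k) ℚ)
    (h : s * ∏ i : Fin k, (1 - MvPowerSeries.X i) = t) (α : Fin k → ℕ) :
    cf s α = ∑ β ∈ Finset.Iic α, cf t β := by
  have h1 : s = t * geomSeries k := by
    rw [← h, mul_assoc, prod_one_sub_X_mul_geomSeries, mul_one]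
  rw [h1, cf_mul]
  refine Finset.sum_congr rfl fun β _ => ?_
  have : cf (geomSeries k) (α - β) = 1 := rfl
  rw [this, mul_one]

/-- The sums over one exponent. -/
def partialSum (i : Fin k) (s : MvPowerSeries (Fin k) ℚ) : MvPowerSeries (Fin k) ℚ :=
  fun d => ∑ b ∈ Finset.range (d i + 1), cf s (Function.update d i b)

theorem cf_partialSum (i : Fin k) (s : MvPowerSeries (Fin k) ℚ) (α : Fin k → ℕ) :
    cf (partialSum i s) α = ∑ b ∈ Finset.range (α i + 1), cf s (Function.update α i b) := rfl

theorem one_sub_X_mul_partialSum (i : Fin k) (s : MvPowerSeries (Fin k) ℚ) :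
    (1 - MvPowerSeries.X i) * partialSum i s = s := by
  refine cf_ext fun α => ?_
  rw [sub_mul, one_mul, cf_sub, cf_X_mul, cf_partialSum, Finset.sum_range_succ, Function.update_eq_self]
  by_cases h : α i = 0
  · simp [h]
  · rw [if_neg h, cf_partialSum, Function.update_self]
    simp only [Function.update_idem]
    rw [Nat.sub_add_cancel (Nat.one_le_iff_ne_zero.2 h)]
    ring

/-! ### The expansion of the residuand -/

/-- The denominator of the residuand without the powers of the variables, as a polynomial. -/
def unitPoly (n k : ℕ) : Poly k := unitDen n MvPolynomial.X

theorem constantCoeff_unitPoly (n k : ℕ) : MvPolynomial.constantCoeff (unitPoly n k) = 1 := by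
  rw [unitPoly, unitDen, map_mul, map_prod, map_pairProd]
  simp [gogPair, pairProd]

theorem coe_unitPoly_ne_zero (n k : ℕ) :
    MvPowerSeries.constantCoeff (unitPoly n k : MvPowerSeries (Fin k) ℚ) ≠ 0 := by
  rw [constantCoeff_coe_poly, constantCoeff_unitPoly]
  exact one_ne_zero

/-- The expansion at the origin of the product of the variables and the residuand without the powers
of the variables in its denominator. -/
def gogSeries (n k : ℕ) : MvPowerSeries (Fin k) ℚ :=
  (∏ i, MvPowerSeries.X i) * ((Phi k : MvPowerSeries (Fin k) ℚ) *
    (unitPoly n k : MvPowerSeries (Fin k) ℚ)⁻¹)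

theorem gogSeries_mul (n k : ℕ) : gogSeries n k * (unitPoly n k : MvPowerSeries (Fin k) ℚ)
    = (∏ i, MvPowerSeries.X i) * (Phi k : MvPowerSeries (Fin k) ℚ) := by
  rw [gogSeries, mul_assoc, mul_assoc, MvPowerSeries.inv_mul_cancel _ (coe_unitPoly_ne_zero n k), mul_one]

theorem algebraMap_Phi : algebraMap (Poly k) (RatFun k) (Phi k) = phiAt x := by
  rw [← aeval_Phi]
  have : (IsScalarTower.toAlgHom ℚ (Poly k) (RatFun k)) = MvPolynomial.aeval x :=
    MvPolynomial.algHom_ext fun i => by rw [MvPolynomial.aeval_X]; rfl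
  exact DFunLike.congr_fun this (Phi k)

theorem map_unitDen {A B : Type*} [CommRing A] [CommRing B] (φ : A →+* B) (n : ℕ) (u : Fin k → A) :
    φ (unitDen n u) = unitDen n (φ ∘ u) := by
  rw [unitDen, unitDen, map_mul, map_prod, map_pairProd]
  simp only [map_pow, map_sub, map_one, Function.comp_apply]
  congr 1
  refine pairProd_congr fun i _ j _ => ?_
  simp only [gogPair, map_mul, map_sub, map_one, Function.comp_apply]

theorem hasExp_phiAt_div_unitDen (n : ℕ) : HasExp (phiAt x / unitDen n (x : Fin k → RatFun k))
    ((Phi k : MvPowerSeries (Fin k) ℚ) * (unitPoly n k : MvPowerSeries (Fin k) ℚ)⁻¹) := by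
  have h : algebraMap (Poly k) (RatFun k) (unitPoly n k) = unitDen n x := map_unitDen _ _ _
  rw [← algebraMap_Phi, ← h, div_eq_mul_inv]
  exact (HasExp.of_poly _).mul ((HasExp.of_poly _).inv (coe_unitPoly_ne_zero n k))

theorem prod_X_eq (k : ℕ) : (∏ i : Fin k, (MvPowerSeries.X i : MvPowerSeries (Fin k) ℚ))
    = MvPowerSeries.monomial (Finsupp.equivFunOnFinite.symm 1) 1 := by
  have h : ∀ S : Finset (Fin k), (∏ i ∈ S, (MvPowerSeries.X i : MvPowerSeries (Fin k) ℚ))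
      = MvPowerSeries.monomial (∑ i ∈ S, Finsupp.single i 1) 1 := by
    intro S
    induction S using Finset.induction_on with
    | empty => simp
    | insert i S hi ih =>
      rw [Finset.prod_insert hi, Finset.sum_insert hi, ih, MvPowerSeries.X,
        MvPowerSeries.monomial_mul_monomial, one_mul]
  rw [h]
  congr 2
  ext i
  simp [Finsupp.single_apply]

theorem cf_prod_X_mul (s : MvPowerSeries (Fin k) ℚ) (β : Fin k → ℕ) :
    cf ((∏ i, MvPowerSeries.X i) * s) (β + 1) = cf s β := by
  rw [cf, prod_X_eq, cf]
  have : Finsupp.equivFunOnFinite.symm (β + 1)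
      = Finsupp.equivFunOnFinite.symm 1 + Finsupp.equivFunOnFinite.symm β := by
    ext i; simp [add_comm]
  rw [this, MvPowerSeries.coeff_add_monomial_mul, one_mul]

theorem cf_gogSeries_eq_zero (n : ℕ) {α : Fin k → ℕ} {i : Fin k} (hi : α i = 0) :
    cf (gogSeries n k) α = 0 := by
  rw [gogSeries, ← Finset.mul_prod_erase _ _ (Finset.mem_univ i), mul_assoc, cf_X_mul, if_pos hi]

/-- The product of the variables in `gogSeries` makes the pole orders α themselves, and not α - 1,
the exponent of the coefficient. -/
theorem iterRes_phiAt_div (n : ℕ) {α : Fin k → ℕ} (hα : ∀ i, 1 ≤ α i) :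
    iterRes (phiAt x / (unitDen n x * ∏ l, (x l : RatFun k) ^ α l))
      = ((cf (gogSeries n k) α : ℚ) : RatFun k) := by
  obtain ⟨β, rfl⟩ : ∃ β, α = β + 1 := ⟨α - 1, by
    funext i
    have := hα i
    simp only [Pi.add_apply, Pi.sub_apply, Pi.one_apply]
    omega⟩
  rw [gogSeries, cf_prod_X_mul, cf, div_mul_eq_div_div]
  exact iterRes_div_eq_coeff (hasExp_phiAt_div_unitDen n) (Finsupp.equivFunOnFinite.symm β)

theorem cf_gogSeries_eq_zero_of_antisymm {n : ℕ} (hkn : k ≤ n) {p : Fin k} (hp : (p : ℕ) = 0)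
    {α : Fin k → ℕ} (hαp : α p = n + 1) (hα : ∀ l, l ≠ p → α l ≤ n) : cf (gogSeries n k) α = 0 := by
  by_cases h : ∀ i, 1 ≤ α i
  · have h1 := iterRes_phiAt_div n h
    rw [iterRes_phiAt_div_eq_zero hkn hp hαp hα] at h1
    exact_mod_cast h1.symm
  · push Not at h
    obtain ⟨i, hi⟩ := h
    exact cf_gogSeries_eq_zero n (i := i) (by omega)

theorem unitPoly_succ (n k : ℕ) : unitPoly (n + 1) k
    = unitPoly n k * ∏ i : Fin k, (1 - MvPolynomial.X i) := by
  rw [unitPoly, unitPoly, unitDen, unitDen, mul_right_comm, ← Finset.prod_mul_distrib]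
  congr 1
  refine Finset.prod_congr rfl fun l _ => ?_
  ring

/-- Raising n by one divides the series by ∏ (1 - X_i), and this replaces coefficients by their sums
over all smaller exponents. -/
theorem cf_gogSeries_succ (n : ℕ) (α : Fin k → ℕ) :
    cf (gogSeries (n + 1) k) α = ∑ β ∈ Finset.Iic α, cf (gogSeries n k) β := by
  refine cf_eq_sum_of_mul _ _ ?_ α
  have h := gogSeries_mul (n + 1) k
  have e : ((∏ i : Fin k, (1 - MvPolynomial.X i) : Poly k) : MvPowerSeries (Fin k) ℚ)
      = ∏ i : Fin k, (1 - MvPowerSeries.X i) := by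
    refine (map_prod (MvPolynomial.coeToMvPowerSeries.ringHom (σ := Fin k) (R := ℚ)) _ _).trans ?_
    refine Finset.prod_congr rfl fun i _ => ?_
    rw [map_sub, map_one, MvPolynomial.coeToMvPowerSeries.ringHom_apply, MvPolynomial.coe_X]
  rw [unitPoly_succ, MvPolynomial.coe_mul, e, ← gogSeries_mul n k, mul_comm (unitPoly n k : MvPowerSeries (Fin k) ℚ),
    ← mul_assoc] at h
  exact mul_right_cancel₀ (fun h0 => coe_unitPoly_ne_zero n k (by rw [h0, map_zero])) h

/-! ### Invariance under permutations -/

theorem HasExp.act {f : RatFun k} {s : MvPowerSeries (Fin k) ℚ} (hf : HasExp f s)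
    (π : Equiv.Perm (Fin k)) : HasExp (SignedPerm.act (π, 1) f) (MvPowerSeries.rename π s) := by
  have hact : ∀ p : Poly k, SignedPerm.actPoly (π, 1) p = MvPolynomial.rename π p := fun p => by
    have h : ∀ q : Poly k, signSubst (1 : Fin k → ℤˣ) q = q := fun q => by
      have : signSubst (1 : Fin k → ℤˣ) = AlgHom.id ℚ (Poly k) :=
        MvPolynomial.algHom_ext fun i => by simp [signSubst]
      rw [this]; rfl
    exact h _
  obtain ⟨P, U, h1, h2, h3⟩ := hf
  refine ⟨MvPolynomial.rename π P, MvPolynomial.rename π U, ?_, ?_, ?_⟩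
  · rwa [MvPolynomial.constantCoeff_rename]
  · rw [← hact, ← hact, ← act_algebraMap, ← act_algebraMap, ← map_mul, h2]
  · rw [← MvPowerSeries.rename_coe, ← MvPowerSeries.rename_coe, ← map_mul, h3]

theorem F_eq_div (n k : ℕ) : F n k = phiAt x / unitDen (n + 1) (x : Fin k → RatFun k) /
    ∏ i, x i ^ (n + 1) := by
  rw [F_eq, div_div, gogDen, unitDen]
  congr 1
  simp only [gogOne, Finset.prod_mul_distrib]
  have e : ∀ i : Fin k, n + ((i : ℕ) + 1) + 1 = n + 1 + (i : ℕ) + 1 := fun i => by ring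
  simp only [e]
  ring

/-- A permutation fixes ∏ x_i^(n+1) and permutes the variables of the power series; the coefficient
taken has all exponents equal and does not notice. -/
theorem iterRes_act_F (n : ℕ) (π : Equiv.Perm (Fin k)) :
    iterRes (SignedPerm.act (π, 1) (F n k)) = ((cf (gogSeries (n + 1) k) (fun _ => n + 1) : ℚ) : RatFun k) := by
  have h1 : SignedPerm.act (π, 1) (∏ i : Fin k, x i ^ (n + 1)) = ∏ i : Fin k, x i ^ (n + 1) := by
    rw [map_prod, ← Equiv.prod_comp π fun i => (x i : RatFun k) ^ (n + 1)]
    refine Finset.prod_congr rfl fun i _ => ?_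
    rw [map_pow, act_x]
    dsimp only
    rw [Pi.one_apply, sgnSub_one]
  rw [F_eq_div, map_div₀, h1]
  have h2 := iterRes_div_eq_coeff ((hasExp_phiAt_div_unitDen (k := k) (n + 1)).act π)
    (Finsupp.equivFunOnFinite.symm fun _ => n)
  have h3 : cf (gogSeries (n + 1) k) (fun _ => n + 1)
      = cf ((Phi k : MvPowerSeries (Fin k) ℚ) * (unitPoly (n + 1) k : MvPowerSeries (Fin k) ℚ)⁻¹) (fun _ => n) := by
    rw [gogSeries]
    exact cf_prod_X_mul _ fun _ => n
  rw [h3]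
  refine h2.trans ?_
  have h4 := cf_rename π ((Phi k : MvPowerSeries (Fin k) ℚ) * (unitPoly (n + 1) k : MvPowerSeries (Fin k) ℚ)⁻¹) (fun _ => n)
  rw [cf] at h4
  rw [h4]
  rfl

theorem iterRes_F (n k : ℕ) :
    iterRes (F n k) = ((cf (gogSeries (n + 1) k) (fun _ => n + 1) : ℚ) : RatFun k) := by
  have h : SignedPerm.act ((1 : Equiv.Perm (Fin k)), 1) (F n k) = F n k := by
    refine ringHom_ext_x (φ := SignedPerm.act (1, 1)) (ψ := RingHom.id (RatFun k)) (fun i => ?_) _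
    rw [act_x]
    simp
  rw [← iterRes_act_F n 1, h]

end

/-! ### Relations between the coefficients and initial values -/

section

variable {k : ℕ}

/-! ### Adjacent exponents -/

/-- The part of `unitDen` that is symmetric in two adjacent variables. -/
def symDen {A : Type*} [CommRing A] (n : ℕ) (i j : Fin k) (u : Fin k → A) : A :=
  ((1 - u i) * (1 - u j)) ^ (n + (i : ℕ) + 1) *
    (∏ l ∈ (Finset.univ.erase i).erase j, (1 - u l) ^ (n + (l : ℕ) + 1)) *
      ((1 - u i * u j) * ((∏ l ∈ (Finset.univ.erase i).erase j, sortPair (gogPair u) i l) *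
        (∏ l ∈ (Finset.univ.erase i).erase j, sortPair (gogPair u) j l)) *
          pairProd ((Finset.univ.erase i).erase j) (gogPair u))

theorem unitDen_eq_symDen_mul {A : Type*} [CommRing A] (n : ℕ) {i j : Fin k} (hij : (j : ℕ) = i + 1)
    (u : Fin k → A) :
    unitDen n u = symDen n i j u * ((1 - u j) * (1 - (1 - u i) * u j)) := by
  have hlt : i < j := by rw [Fin.lt_def]; omega
  rw [unitDen, symDen, prod_univ_split₂ hlt.ne, pairProd_univ_split₂ hlt.ne, hij,
    show sortPair (gogPair u) i j = (1 - u i * u j) * (1 - (1 - u i) * u j) from if_pos hlt, mul_pow]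
  generalize (∏ l ∈ (Finset.univ.erase i).erase j, (1 - u l) ^ (n + (l : ℕ) + 1)) = p₁
  generalize (∏ l ∈ (Finset.univ.erase i).erase j, sortPair (gogPair u) i l) = p₂
  generalize (∏ l ∈ (Finset.univ.erase i).erase j, sortPair (gogPair u) j l) = p₃
  generalize pairProd ((Finset.univ.erase i).erase j) (gogPair u) = p₄
  generalize 1 - u i * u j = p₅
  generalize 1 - (1 - u i) * u j = p₆
  ring

/-- Since i and j are adjacent, every other index lies on the same side of both, so the swap
exchanges the pair factors with i and those with j. -/
theorem symDen_swap {A : Type*} [CommRing A] (n : ℕ) {i j : Fin k} (hij : (j : ℕ) = i + 1)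
    (u : Fin k → A) : symDen n i j (u ∘ Equiv.swap i j) = symDen n i j u := by
  have hR : ∀ l ∈ (Finset.univ.erase i).erase j, (u ∘ Equiv.swap i j) l = u l := fun l hl => by
    rw [Function.comp_apply, Equiv.swap_apply_of_ne_of_ne
      (Finset.ne_of_mem_erase (Finset.mem_of_mem_erase hl)) (Finset.ne_of_mem_erase hl)]
  have hi : (u ∘ Equiv.swap i j) i = u j := by simp
  have hj : (u ∘ Equiv.swap i j) j = u i := by simp
  have hlt : ∀ l ∈ (Finset.univ.erase i).erase j, i < l ↔ j < l := fun l hl => by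
    have h1 : (l : ℕ) ≠ i := fun h => Finset.ne_of_mem_erase (Finset.mem_of_mem_erase hl) (Fin.ext h)
    have h2 : (l : ℕ) ≠ j := fun h => Finset.ne_of_mem_erase hl (Fin.ext h)
    rw [Fin.lt_def, Fin.lt_def]
    omega
  have e1 : ∏ l ∈ (Finset.univ.erase i).erase j, sortPair (gogPair (u ∘ Equiv.swap i j)) i l
      = ∏ l ∈ (Finset.univ.erase i).erase j, sortPair (gogPair u) j l :=
    Finset.prod_congr rfl fun l hl => by
      simp only [sortPair, gogPair, hlt l hl, hi, hR l hl]
  have e2 : ∏ l ∈ (Finset.univ.erase i).erase j, sortPair (gogPair (u ∘ Equiv.swap i j)) j l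
      = ∏ l ∈ (Finset.univ.erase i).erase j, sortPair (gogPair u) i l :=
    Finset.prod_congr rfl fun l hl => by
      simp only [sortPair, gogPair, hlt l hl, hj, hR l hl]
  have e3 : pairProd ((Finset.univ.erase i).erase j) (gogPair (u ∘ Equiv.swap i j))
      = pairProd ((Finset.univ.erase i).erase j) (gogPair u) :=
    pairProd_congr fun l hl l' hl' => by rw [gogPair, gogPair, hR l hl, hR l' hl']
  rw [symDen, symDen, e1, e2, e3, hi, hj, Finset.prod_congr rfl fun l hl => by rw [hR l hl]]
  ring

theorem rename_Phi (π : Equiv.Perm (Fin k)) :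
    MvPolynomial.rename π (Phi k) = ((Equiv.Perm.sign π : ℤ) : Poly k) * Phi k := by
  have h1 : Phi k = phiAt (MvPolynomial.X : Fin k → Poly k) := by
    rw [← aeval_Phi, MvPolynomial.aeval_X_left, AlgHom.id_apply]
  have h2 : (MvPolynomial.rename π : Poly k →ₐ[ℚ] Poly k) ∘ MvPolynomial.X
      = SignedPerm.pt (π, 1) (MvPolynomial.X : Fin k → Poly k) := by
    funext l
    simp [SignedPerm.pt]
  rw [h1, map_phiAt, h2, phiAt_pt]
  simp [SignedPerm.sgn]

theorem map_symDen {A B : Type*} [CommRing A] [CommRing B] (φ : A →+* B) (n : ℕ) (i j : Fin k)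
    (u : Fin k → A) : φ (symDen n i j u) = symDen n i j (φ ∘ u) := by
  have h : ∀ l l', φ (gogPair u l l') = gogPair (φ ∘ u) l l' := fun l l' => by
    simp only [gogPair, map_mul, map_sub, map_one, Function.comp_apply]
  have h' : ∀ l l', φ (sortPair (gogPair u) l l') = sortPair (gogPair (φ ∘ u)) l l' := fun l l' => by
    rw [sortPair, sortPair]
    split_ifs
    · exact h _ _
    · exact h _ _
  simp only [symDen, map_mul, map_prod, map_pow, map_sub, map_one, map_pairProd, h, h',
    Function.comp_apply]

/-- The antisymmetry relation between the coefficients for adjacent variables. -/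
theorem sum_cf_gogSeries_update (n : ℕ) {i j : Fin k} (hij : (j : ℕ) = i + 1) {α : Fin k → ℕ}
    (hα : α i = α j) : ∑ b ∈ Finset.range (α i + 1), cf (gogSeries n k) (Function.update α i b)
      = cf (gogSeries n k) (Function.update α j (α j - 1)) := by
  have hne : i ≠ j := fun h => by rw [h] at hij; omega
  set σ := Equiv.swap i j with hσ
  set S := gogSeries n k with hS
  let ρ : MvPowerSeries (Fin k) ℚ →ₐ[ℚ] MvPowerSeries (Fin k) ℚ := MvPowerSeries.rename σ
  let D : Poly k := symDen n i j MvPolynomial.X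
  set Y : MvPowerSeries (Fin k) ℚ := (D : MvPowerSeries (Fin k) ℚ) with hY
  set xi : MvPowerSeries (Fin k) ℚ := MvPowerSeries.X i with hxi
  set xj : MvPowerSeries (Fin k) ℚ := MvPowerSeries.X j with hxj
  have hρi : ρ xi = xj := by simp [ρ, hxi, hxj, hσ]
  have hρj : ρ xj = xi := by simp [ρ, hxi, hxj, hσ]
  have hρY : ρ Y = Y := by
    have h1 : MvPolynomial.rename σ (symDen n i j (MvPolynomial.X : Fin k → Poly k))
        = symDen n i j (MvPolynomial.X : Fin k → Poly k) := by
      have h2 := map_symDen (MvPolynomial.rename (R := ℚ) σ).toRingHom n i j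
        (MvPolynomial.X : Fin k → Poly k)
      refine h2.trans ?_
      rw [← symDen_swap n hij (MvPolynomial.X : Fin k → Poly k)]
      congr 1
      funext l
      simp [hσ]
    change MvPowerSeries.rename σ _ = _
    rw [MvPowerSeries.rename_coe, h1]
  have hY0 : Y ≠ 0 := by
    intro h
    refine coe_unitPoly_ne_zero n k ?_
    rw [unitPoly, unitDen_eq_symDen_mul n hij, MvPolynomial.coe_mul, ← hY, h, zero_mul, map_zero]
  have h1 : S * (Y * ((1 - xj) * (1 - (1 - xi) * xj))) = (∏ i, MvPowerSeries.X i) * (Phi k : MvPowerSeries (Fin k) ℚ) := by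
    rw [← gogSeries_mul n k, unitPoly, unitDen_eq_symDen_mul n hij]
    have h2 : (((1 - MvPolynomial.X j) * (1 - (1 - MvPolynomial.X i) * MvPolynomial.X j) : Poly k) :
        MvPowerSeries (Fin k) ℚ) = (1 - xj) * (1 - (1 - xi) * xj) := by
      change MvPolynomial.coeToMvPowerSeries.ringHom _ = _
      simp only [map_mul, map_sub, map_one, MvPolynomial.coeToMvPowerSeries.ringHom_apply, MvPolynomial.coe_X]
      rfl
    rw [MvPolynomial.coe_mul, h2]
  have h2 : ρ S * (Y * ((1 - xi) * (1 - (1 - xj) * xi)))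
      = -((∏ i, MvPowerSeries.X i) * (Phi k : MvPowerSeries (Fin k) ℚ)) := by
    have h3 := congrArg ρ h1
    have h4 : ρ (∏ i, MvPowerSeries.X i) = ∏ i, MvPowerSeries.X i := by
      rw [map_prod, ← Equiv.prod_comp σ fun i => (MvPowerSeries.X i : MvPowerSeries (Fin k) ℚ)]
      exact Finset.prod_congr rfl fun l _ => MvPowerSeries.rename_X σ l
    have h5 : ρ (Phi k : MvPowerSeries (Fin k) ℚ) = -(Phi k : MvPowerSeries (Fin k) ℚ) := by
      change MvPowerSeries.rename σ _ = _
      rw [MvPowerSeries.rename_coe, rename_Phi, hσ, Equiv.Perm.sign_swap hne]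
      have : (((-1 : ℤˣ) : ℤ) : Poly k) * Phi k = -Phi k := by simp
      rw [this]
      exact map_neg (MvPolynomial.coeToMvPowerSeries.ringHom (σ := Fin k) (R := ℚ)) _
    rw [map_mul, map_mul, map_mul, map_mul, h4, h5, hρY, map_sub, map_sub, map_mul, map_sub, map_one,
      hρi, hρj, mul_neg] at h3
    exact h3
  have h3 : S * ((1 - xj) * (1 - (1 - xi) * xj)) = -(ρ S * ((1 - xi) * (1 - (1 - xj) * xi))) := by
    refine mul_left_cancel₀ hY0 ?_
    linear_combination h1 + h2
  set G := partialSum i S with hG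
  have hGS : (1 - xi) * G = S := one_sub_X_mul_partialSum i S
  -- This is S (1 - (1 - x_i) x_j) / (1 - x_i). Multiplied by the symmetric (1 - x_i)(1 - x_j), it
  -- becomes the antisymmetric numerator over the symmetric part of the denominator, so B is
  -- antisymmetric under the swap.
  set B := G - xj * S with hB
  have h4 : (1 - xi) * (1 - xj) * B = S * ((1 - xj) * (1 - (1 - xi) * xj)) := by
    rw [hB]
    linear_combination (1 - xj) * hGS
  have h5 : (1 - xi) * (1 - xj) * ρ B = ρ S * ((1 - xi) * (1 - (1 - xj) * xi)) := by
    have h6 := congrArg ρ h4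
    simp only [map_mul, map_sub, map_one, hρi, hρj] at h6
    rw [mul_comm (1 - xi)]
    exact h6
  have hunit : (1 - xi) * (1 - xj) ≠ 0 := by
    intro h
    have := congrArg MvPowerSeries.constantCoeff h
    simp [hxi, hxj] at this
  have h6 : ρ B = -B := by
    refine mul_left_cancel₀ hunit ?_
    linear_combination h5 + h4 + h3
  -- An antisymmetric series has coefficient zero where the two exponents are equal; written out for
  -- B, this is the relation.
  have h7 : cf B α = 0 := by
    have h8 : cf (ρ B) α = cf B (α ∘ σ) := cf_rename σ B α
    have h9 : α ∘ σ = α := by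
      funext l
      rw [Function.comp_apply, hσ, Equiv.swap_apply_def]
      split_ifs with h h
      · rw [h, hα]
      · rw [h, hα]
      · rfl
    rw [h6, h9, cf_neg] at h8
    linarith
  rw [hB, cf_sub, hG, cf_partialSum, cf_X_mul, sub_eq_zero] at h7
  rw [h7]
  split_ifs with h
  · rw [eq_comm]
    exact cf_gogSeries_eq_zero n (i := j) (by simp [h])
  · rfl

/-! ### The coefficients with small exponents -/

/-- Antisymmetric functions of exponents. -/
def Antisymm (c : (Fin k → ℕ) → ℚ) : Prop :=
  ∀ i j, i ≠ j → ∀ α, c (α ∘ Equiv.swap i j) = -c α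

theorem Antisymm.comp_perm {c : (Fin k → ℕ) → ℚ} (hc : Antisymm c) (π : Equiv.Perm (Fin k))
    (α : Fin k → ℕ) : c (α ∘ π) = ((Equiv.Perm.sign π : ℤ) : ℚ) * c α := by
  induction π using Equiv.Perm.swap_induction_on generalizing α with
  | one => simp
  | swap_mul f x y hxy ih =>
    have h : α ∘ (Equiv.swap x y * f : Equiv.Perm (Fin k)) = (α ∘ Equiv.swap x y) ∘ f := rfl
    rw [h, ih, hc x y hxy, Equiv.Perm.sign_mul, Equiv.Perm.sign_swap hxy]
    simp

theorem Antisymm.eq_zero {c : (Fin k → ℕ) → ℚ} (hc : Antisymm c) {α : Fin k → ℕ}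
    (hα : ¬ Function.Injective α) : c α = 0 := by
  rw [Function.Injective] at hα
  push Not at hα
  obtain ⟨i, j, h, hij⟩ := hα
  have h1 := hc i j hij α
  have h2 : α ∘ Equiv.swap i j = α := by
    funext l
    rw [Function.comp_apply, Equiv.swap_apply_def]
    split_ifs with h3 h3
    · rw [h3, h]
    · rw [h3, h]
    · rfl
  rw [h2] at h1
  linarith

/-- The exponents `k - 1, …, 1, 0`. -/
def stair (k : ℕ) (i : Fin k) : ℕ := k - 1 - i

/-- An injective vector with k entries below k is a permutation of the staircase, and on the other
vectors both functions vanish. -/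
theorem Antisymm.eq_of_stair {c c' : (Fin k → ℕ) → ℚ} (hc : Antisymm c) (hc' : Antisymm c')
    (h : c (stair k) = c' (stair k)) {α : Fin k → ℕ} (hα : ∀ i, α i < k) : c α = c' α := by
  by_cases hi : Function.Injective α
  · let f : Fin k → Fin k := fun i => ⟨k - 1 - α i, by have := hα i; omega⟩
    have hf : Function.Injective f := fun i j hij => hi (by
      have h1 : k - 1 - α i = k - 1 - α j := congrArg Fin.val hij
      have := hα i
      have := hα j
      omega)
    let π : Equiv.Perm (Fin k) := Equiv.ofBijective f (Finite.injective_iff_bijective.1 hf)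
    have hπ : α = stair k ∘ π := by
      funext i
      change α i = k - 1 - (k - 1 - α i)
      have := hα i
      omega
    rw [hπ, hc.comp_perm, hc'.comp_perm, h]
  · rw [hc.eq_zero hi, hc'.eq_zero hi]

theorem Antisymm.of_rename {s : MvPowerSeries (Fin k) ℚ}
    (h : ∀ i j : Fin k, i ≠ j → MvPowerSeries.rename (Equiv.swap i j) s = -s) : Antisymm (cf s) :=
  fun i j hij α => by rw [← cf_rename, h i j hij, cf_neg]

theorem rename_coe_Phi {i j : Fin k} (hij : i ≠ j) : MvPowerSeries.rename (Equiv.swap i j)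
    (Phi k : MvPowerSeries (Fin k) ℚ) = -(Phi k : MvPowerSeries (Fin k) ℚ) := by
  rw [MvPowerSeries.rename_coe, rename_Phi, Equiv.Perm.sign_swap hij]
  have : (((-1 : ℤˣ) : ℤ) : Poly k) * Phi k = -Phi k := by simp
  rw [this]
  exact map_neg (MvPolynomial.coeToMvPowerSeries.ringHom (σ := Fin k) (R := ℚ)) _

theorem antisymm_cf_Phi : Antisymm (cf (Phi k : MvPowerSeries (Fin k) ℚ)) :=
  Antisymm.of_rename fun _ _ hij => rename_coe_Phi hij

end

section

variable {k : ℕ}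

/-! ### The lowest coefficient of `Phi` -/

theorem prod_X_pow_eq (a : Fin k → ℕ) : (∏ i : Fin k, (MvPowerSeries.X i : MvPowerSeries (Fin k) ℚ) ^ a i)
    = MvPowerSeries.monomial (Finsupp.equivFunOnFinite.symm a) 1 := by
  have h : ∀ S : Finset (Fin k), (∏ i ∈ S, (MvPowerSeries.X i : MvPowerSeries (Fin k) ℚ) ^ a i)
      = MvPowerSeries.monomial (∑ i ∈ S, Finsupp.single i (a i)) 1 := by
    intro S
    induction S using Finset.induction_on with
    | empty => simp
    | insert i S hi ih =>
      rw [Finset.prod_insert hi, Finset.sum_insert hi, ih, MvPowerSeries.X_pow_eq,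
        MvPowerSeries.monomial_mul_monomial, one_mul]
  rw [h]
  congr 2
  ext i
  simp [Finsupp.single_apply]

theorem cf_zero_right (s : MvPowerSeries (Fin k) ℚ) : cf s 0 = MvPowerSeries.constantCoeff s := by
  rw [cf, ← MvPowerSeries.coeff_zero_eq_constantCoeff_apply]
  congr 2
  exact Finsupp.ext fun _ => rfl

open scoped Classical in
theorem cf_prod_X_pow_mul (a : Fin k → ℕ) (s : MvPowerSeries (Fin k) ℚ) (α : Fin k → ℕ) :
    cf ((∏ i, MvPowerSeries.X i ^ a i) * s) α = if a ≤ α then cf s (α - a) else 0 := by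
  rw [cf, prod_X_pow_eq, MvPowerSeries.coeff_monomial_mul, one_mul]
  refine if_congr Iff.rfl ?_ rfl
  rw [cf]
  congr 2
  exact Finsupp.ext fun _ => rfl

theorem cf_X_pow_mul_eq_zero {i : Fin k} {e : ℕ} (s : MvPowerSeries (Fin k) ℚ) {α : Fin k → ℕ}
    (h : α i < e) : cf (MvPowerSeries.X i ^ e * s) α = 0 := by
  have h1 : (∏ l, (MvPowerSeries.X l : MvPowerSeries (Fin k) ℚ) ^ (Pi.single i e : Fin k → ℕ) l)
      = MvPowerSeries.X i ^ e := by
    rw [Finset.prod_eq_single i (fun l _ hl => by simp [hl]) (by simp)]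
    simp
  rw [← h1, cf_prod_X_pow_mul, if_neg]
  intro h2
  have := h2 i
  simp only [Pi.single_eq_same] at this
  omega

/-- An unflipped variable occurs with its full power k in the summand. -/
theorem cf_phiTermAt_of_sign_eq_one {g : SignedPerm k} {i : Fin k} (hg : g.2 (g.1 i) = 1)
    {α : Fin k → ℕ} (hα : α (g.1 i) < k) :
    cf (phiTermAt (g.pt (MvPowerSeries.X : Fin k → MvPowerSeries (Fin k) ℚ))) α = 0 := by
  rw [phiTermAt, ← Finset.mul_prod_erase _ _ (Finset.mem_univ i)]
  have h : g.pt (MvPowerSeries.X : Fin k → MvPowerSeries (Fin k) ℚ) i = MvPowerSeries.X (g.1 i) := by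
    simp [SignedPerm.pt, hg]
  rw [h, mul_comm (_ ^ _), mul_assoc, mul_assoc]
  exact cf_X_pow_mul_eq_zero _ hα

theorem perm_eq_one_of_le {π : Equiv.Perm (Fin k)} (h : ∀ l, l ≤ π l) : π = 1 := by
  have h1 := (Finset.sum_eq_sum_iff_of_le (s := Finset.univ) (f := fun l : Fin k => (l : ℕ))
    (g := fun l => (π l : ℕ)) fun l _ => h l).1 (Equiv.sum_comp π fun l : Fin k => (l : ℕ)).symm
  ext l
  exact (h1 l (Finset.mem_univ l)).symm

/-- With all variables flipped, the summand is the monomial with exponents `stair k` permuted, times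
a series with constant term 1. A permuted staircase lies below the staircase only if the permutation
is trivial. -/
theorem cf_phiTermAt_neg (π : Equiv.Perm (Fin k)) :
    cf (phiTermAt (SignedPerm.pt (π, fun _ => -1) (MvPowerSeries.X : Fin k → MvPowerSeries (Fin k) ℚ)))
      (stair k) = if π = 1 then 1 else 0 := by
  have h : SignedPerm.pt (π, fun _ => -1) (MvPowerSeries.X : Fin k → MvPowerSeries (Fin k) ℚ)
      = fun i => 1 - MvPowerSeries.X (π i) := by
    funext i
    simp [SignedPerm.pt, sgnSub]
  rw [h, phiTermAt, Finset.prod_mul_distrib]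
  have h1 : ∏ i : Fin k, (1 - (1 - (MvPowerSeries.X (π i) : MvPowerSeries (Fin k) ℚ))) ^ (k - ((i : ℕ) + 1))
      = ∏ l, MvPowerSeries.X l ^ stair k (π.symm l) := by
    rw [← Equiv.prod_comp π fun l => (MvPowerSeries.X l : MvPowerSeries (Fin k) ℚ) ^ stair k (π.symm l)]
    refine Finset.prod_congr rfl fun i _ => ?_
    rw [sub_sub_cancel, Equiv.symm_apply_apply, stair, Nat.sub_sub, add_comm]
  rw [h1, mul_assoc, cf_prod_X_pow_mul]
  by_cases hπ : π = 1
  · have h2 : (fun l => stair k (π.symm l)) = stair k := by rw [hπ]; rfl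
    rw [if_pos hπ, h2, if_pos le_rfl]
    rw [tsub_self, cf_zero_right, map_mul, map_prod, map_pairProd]
    simp [phiPair, pairProd]
  · rw [if_neg hπ, if_neg]
    intro h2
    refine hπ ?_
    have h3 : π.symm = 1 := perm_eq_one_of_le fun l => by
      have := h2 l
      simp only [stair] at this
      rw [Fin.le_def]
      omega
    rw [← Equiv.symm_symm π, h3]
    rfl

theorem cf_coe_sum {ι : Type*} (S : Finset ι) (f : ι → MvPowerSeries (Fin k) ℚ) (α : Fin k → ℕ) :
    cf (∑ i ∈ S, f i) α = ∑ i ∈ S, cf (f i) α := map_sum _ _ _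

theorem cf_Phi_stair (k : ℕ) : cf (Phi k : MvPowerSeries (Fin k) ℚ) (stair k) = 1 := by
  have h1 : (Phi k : MvPowerSeries (Fin k) ℚ) = phiAt MvPowerSeries.X := by
    have h2 : Phi k = phiAt (MvPolynomial.X : Fin k → Poly k) := by
      rw [← aeval_Phi, MvPolynomial.aeval_X_left, AlgHom.id_apply]
    change MvPolynomial.coeToMvPowerSeries.ringHom (Phi k) = _
    rw [h2, map_phiAt]
    congr 1
    funext i
    exact MvPolynomial.coe_X i
  have h3 : ∀ (c : ℤ) (s : MvPowerSeries (Fin k) ℚ) (α : Fin k → ℕ), cf ((c : MvPowerSeries (Fin k) ℚ) * s) α = c * cf s α := by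
    intro c s α
    rw [← zsmul_eq_mul, ← zsmul_eq_mul]
    exact map_zsmul _ _ _
  have h4 : ((-1) ^ k : MvPowerSeries (Fin k) ℚ) = (((-1) ^ k : ℤ) : MvPowerSeries (Fin k) ℚ) := by
    push_cast; rfl
  have hlt : ∀ i : Fin k, stair k i < k := fun i => by have := i.2; rw [stair]; omega
  rw [h1, phiAt, h4, h3, cf_coe_sum, Finset.sum_eq_single (1, fun _ => -1), h3, cf_phiTermAt_neg,
    if_pos rfl]
  · simp [SignedPerm.sgn, ← mul_pow]
  · rintro ⟨π, ε⟩ - hg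
    rw [h3]
    by_cases hε : ε = fun _ => -1
    · subst hε
      rw [cf_phiTermAt_neg, if_neg, mul_zero]
      rintro rfl
      exact hg rfl
    · obtain ⟨m, hm⟩ : ∃ m, ε m ≠ -1 := by
        by_contra hcon
        push Not at hcon
        exact hε (funext hcon)
      have hm1 : ε m = 1 := (Int.units_eq_one_or (ε m)).resolve_right hm
      rw [cf_phiTermAt_of_sign_eq_one (i := π.symm m) (by simpa using hm1) (hlt _), mul_zero]
  · simp

/-! ### The initial values -/

/-- After removal of ∏ X_i the exponents are below k - 1, so by pigeonhole two exponents in `Phi`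
coincide. -/
theorem cf_gogSeries_eq_zero_of_lt (n : ℕ) {α : Fin k → ℕ} (hk : 0 < k) (hα : ∀ i, α i < k) :
    cf (gogSeries n k) α = 0 := by
  by_cases h : ∃ i, α i = 0
  · obtain ⟨i, hi⟩ := h
    exact cf_gogSeries_eq_zero n hi
  push Not at h
  obtain ⟨β, rfl⟩ : ∃ β, α = β + 1 := ⟨α - 1, by
    funext i
    have := h i
    simp only [Pi.add_apply, Pi.sub_apply, Pi.one_apply]
    omega⟩
  rw [gogSeries, cf_prod_X_mul, cf_mul]
  refine Finset.sum_eq_zero fun γ hγ => ?_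
  rw [antisymm_cf_Phi.eq_zero, zero_mul]
  intro hinj
  have h1 : ∀ i, γ i < k - 1 := fun i => by
    have h2 : γ i ≤ β i := Finset.mem_Iic.1 hγ i
    have h3 : β i + 1 < k := hα i
    omega
  have h2 := Fintype.card_le_of_injective (fun i => (⟨γ i, h1 i⟩ : Fin (k - 1)))
    fun i j hij => hinj (congrArg Fin.val hij)
  simp only [Fintype.card_fin] at h2
  omega

/-- Setting the first variable to zero shifts the exponent of 1 - u_l by one through its index, and
the pair factor with the first variable contributes one more power. -/
theorem unitDen_cons_zero {A : Type*} [CommRing A] (n : ℕ) (u : Fin k → A) :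
    unitDen n (Fin.cons 0 u : Fin (k + 1) → A) = unitDen (n + 2) u := by
  rw [unitDen, unitDen, ← prod_Ioi_eq_pairProd, ← prod_Ioi_eq_pairProd, Fin.prod_univ_succ,
    Fin.prod_univ_succ, Fin.prod_Ioi_zero]
  simp only [Fin.prod_Ioi_succ, gogPair, Fin.cons_zero, Fin.cons_succ, zero_mul, sub_zero, one_pow,
    one_mul, Fin.val_succ]
  rw [← mul_assoc, ← Finset.prod_mul_distrib]
  congr 1
  refine Finset.prod_congr rfl fun l _ => ?_
  ring

theorem cf_killCompl (s : MvPowerSeries (Fin (k + 1)) ℚ) (c : Fin k → ℕ) :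
    cf (MvPowerSeries.killCompl (Fin.succEmb k) s) c = cf s (Fin.cons 0 c) := by
  rw [cf, MvPowerSeries.coeff_killCompl, cf]
  congr 2
  refine Finsupp.ext fun i => ?_
  refine Fin.cases ?_ (fun j => ?_) i
  · rw [Finsupp.embDomain_of_notMem_range]
    · simp
    · rintro ⟨j, hj⟩
      exact Fin.succ_ne_zero j hj
  · have : Fin.succ j = Fin.succEmb k j := rfl
    rw [this, Finsupp.embDomain_apply_self]
    simp

theorem coe_unitPoly (n k : ℕ) : (unitPoly n k : MvPowerSeries (Fin k) ℚ) = unitDen n MvPowerSeries.X := by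
  refine (map_unitDen (MvPolynomial.coeToMvPowerSeries.ringHom (σ := Fin k) (R := ℚ)) n _).trans ?_
  congr 1
  funext i
  exact MvPolynomial.coe_X i

theorem killCompl_unitPoly (n k : ℕ) : MvPowerSeries.killCompl (Fin.succEmb k)
    (unitPoly n (k + 1) : MvPowerSeries (Fin (k + 1)) ℚ)
      = (unitPoly (n + 2) k : MvPowerSeries (Fin k) ℚ) := by
  rw [coe_unitPoly, coe_unitPoly, ← unitDen_cons_zero]
  refine (map_unitDen (MvPowerSeries.killCompl (R := ℚ) (Fin.succEmb k)).toRingHom n _).trans ?_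
  congr 1
  funext i
  refine Fin.cases ?_ (fun j => ?_) i
  · refine MvPowerSeries.killCompl_X_eq_zero ?_
    rintro ⟨j, hj⟩
    exact Fin.succ_ne_zero j hj
  · exact MvPowerSeries.killCompl_X j

theorem killCompl_unitPoly_inv (n k : ℕ) : MvPowerSeries.killCompl (Fin.succEmb k)
    (unitPoly n (k + 1) : MvPowerSeries (Fin (k + 1)) ℚ)⁻¹
      = (unitPoly (n + 2) k : MvPowerSeries (Fin k) ℚ)⁻¹ := by
  rw [MvPowerSeries.eq_inv_iff_mul_eq_one (coe_unitPoly_ne_zero _ _), ← killCompl_unitPoly, ← map_mul,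
    MvPowerSeries.inv_mul_cancel _ (coe_unitPoly_ne_zero _ _), map_one]

theorem antisymm_cf_Phi_cons : Antisymm fun γ : Fin k → ℕ =>
    cf (Phi (k + 1) : MvPowerSeries (Fin (k + 1)) ℚ) (Fin.cons k γ) := by
  intro i j hij γ
  have h := antisymm_cf_Phi (k := k + 1) i.succ j.succ (fun h => hij (Fin.succ_injective _ h)) (Fin.cons k γ)
  rw [← h]
  refine congrArg (cf _) ?_
  funext l
  refine Fin.cases ?_ (fun l => ?_) l
  · rw [Function.comp_apply, Equiv.swap_apply_of_ne_of_ne (Fin.succ_ne_zero i).symm (Fin.succ_ne_zero j).symm]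
    rfl
  · rw [Function.comp_apply, ← Function.Injective.map_swap (Fin.succ_injective k)]
    rfl

/-- The numerator when the parameter of the denominator is raised by two. -/
def liftedPhi (k : ℕ) : MvPowerSeries (Fin k) ℚ := (Phi k : MvPowerSeries (Fin k) ℚ) *
  ∏ i : Fin k, (1 - MvPowerSeries.X i) ^ 2

theorem liftedPhi_mul_inv (n k : ℕ) : liftedPhi k * (unitPoly (n + 2) k : MvPowerSeries (Fin k) ℚ)⁻¹
    = (Phi k : MvPowerSeries (Fin k) ℚ) * (unitPoly n k : MvPowerSeries (Fin k) ℚ)⁻¹ := by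
  have h : (unitPoly (n + 2) k : MvPowerSeries (Fin k) ℚ)
      = (unitPoly n k : MvPowerSeries (Fin k) ℚ) * ∏ i : Fin k, (1 - MvPowerSeries.X i) ^ 2 := by
    rw [coe_unitPoly, coe_unitPoly, unitDen, unitDen, mul_right_comm, ← Finset.prod_mul_distrib]
    congr 1
    refine Finset.prod_congr rfl fun l _ => ?_
    ring
  rw [eq_comm, MvPowerSeries.eq_mul_inv_iff_mul_eq (coe_unitPoly_ne_zero _ _), h, liftedPhi, mul_assoc,
    ← mul_assoc _⁻¹, MvPowerSeries.inv_mul_cancel _ (coe_unitPoly_ne_zero _ _), one_mul]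

theorem antisymm_cf_liftedPhi : Antisymm (cf (liftedPhi k)) := by
  refine Antisymm.of_rename fun i j hij => ?_
  have h : MvPowerSeries.rename (Equiv.swap i j)
      (∏ l : Fin k, (1 - MvPowerSeries.X l : MvPowerSeries (Fin k) ℚ) ^ 2)
        = ∏ l : Fin k, (1 - MvPowerSeries.X l) ^ 2 := by
    rw [map_prod, ← Equiv.prod_comp (Equiv.swap i j) fun l => (1 - MvPowerSeries.X l : MvPowerSeries (Fin k) ℚ) ^ 2]
    refine Finset.prod_congr rfl fun l _ => ?_
    rw [map_pow, map_sub, map_one, MvPowerSeries.rename_X]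
  rw [liftedPhi, map_mul, h, rename_coe_Phi hij, neg_mul]

theorem not_injective_of_lt_stair {γ : Fin k → ℕ} (h : γ < stair k) : ¬ Function.Injective γ := by
  intro hinj
  have hlt : ∀ i, γ i ≤ k - 1 - i := fun i => h.le i
  let f : Fin k → Fin k := fun i => ⟨k - 1 - γ i, by have := i.2; omega⟩
  have hf : Function.Injective f := fun i j hij => hinj (by
    have h1 : k - 1 - γ i = k - 1 - γ j := congrArg Fin.val hij
    have := hlt i
    have := hlt j
    omega)
  have h1 : Equiv.ofBijective f (Finite.injective_iff_bijective.1 hf) = 1 := by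
    refine perm_eq_one_of_le fun l => ?_
    have := hlt l
    have := l.2
    change (l : ℕ) ≤ k - 1 - γ l
    omega
  refine h.ne (funext fun i => ?_)
  have h2 : k - 1 - γ i = i := congrArg Fin.val (Equiv.congr_fun h1 i)
  have := hlt i
  have := i.2
  rw [stair]
  omega

theorem cf_liftedPhi_stair (k : ℕ) : cf (liftedPhi k) (stair k) = 1 := by
  rw [liftedPhi, cf_mul, Finset.sum_eq_single (stair k)]
  · rw [cf_Phi_stair, one_mul, tsub_self, cf_zero_right, map_prod]
    simp
  · intro γ hγ hne
    rw [antisymm_cf_Phi.eq_zero (not_injective_of_lt_stair (lt_of_le_of_ne (Finset.mem_Iic.1 hγ) hne)), zero_mul]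
  · simp

/-- Let the exponents of `Phi (k + 1)` be bounded by (k, b) with b < k. Pigeonhole forces the first
one to be k, so the inverse denominator enters with its first variable zero and becomes the one with
k variables and parameter raised by two. The numerators γ ↦ coefficient of `Phi (k + 1)` at (k, γ)
and `liftedPhi k` are both antisymmetric and agree at the staircase, hence at all exponents below k.
-/
theorem cf_gogSeries_cons {a : Fin k → ℕ} (ha : ∀ i, a i ≤ k) :
    cf (gogSeries (k + 1) (k + 1)) (Fin.cons (k + 1) a) = cf (gogSeries (k + 1) k) a := by
  by_cases h : ∃ i, a i = 0
  · obtain ⟨i, hi⟩ := h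
    rw [cf_gogSeries_eq_zero _ hi, cf_gogSeries_eq_zero _ (i := i.succ) (by simpa using hi)]
  push Not at h
  obtain ⟨b, rfl⟩ : ∃ b, a = b + 1 := ⟨a - 1, by
    funext i
    have := h i
    simp only [Pi.add_apply, Pi.sub_apply, Pi.one_apply]
    omega⟩
  have hb : ∀ i, b i < k := ha
  have h1 : (Fin.cons (k + 1) (b + 1) : Fin (k + 1) → ℕ) = (Fin.cons k b : Fin (k + 1) → ℕ) + 1 := by
    funext i
    exact Fin.cases rfl (fun _ => rfl) i
  rw [h1, gogSeries, cf_prod_X_mul, gogSeries, cf_prod_X_mul, ← liftedPhi_mul_inv (k + 1) k, cf_mul, cf_mul, eq_comm]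
  have hle : ∀ γ : Fin k → ℕ, ∀ c, (Fin.cons c γ : Fin (k + 1) → ℕ) ≤ Fin.cons k b ↔ c ≤ k ∧ γ ≤ b :=
    fun γ c => Fin.cons_le_cons
  refine Finset.sum_of_injOn (fun γ => Fin.cons k γ) (fun γ _ γ' _ hh => (Fin.cons_injective2 hh).2)
    (fun γ hγ => ?_) (fun γ hγ hn => ?_) (fun γ hγ => ?_)
  · rw [Finset.coe_Iic, Set.mem_Iic] at hγ ⊢
    exact (hle _ _).2 ⟨le_rfl, hγ⟩
  -- The terms whose first exponent is below k: then k + 1 exponents are all below k and two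
  -- coincide.
  · rw [antisymm_cf_Phi.eq_zero, zero_mul]
    intro hinj
    rw [← Fin.cons_self_tail γ, Finset.mem_Iic, hle] at hγ
    have h2 : γ 0 < k := lt_of_le_of_ne hγ.1 fun h0 => hn ⟨Fin.tail γ, by simpa using hγ.2, 
      (congrArg (fun c => (Fin.cons c (Fin.tail γ) : Fin (k + 1) → ℕ)) h0.symm).trans (Fin.cons_self_tail γ)⟩
    have h3 : ∀ i, γ i < k := fun i => Fin.cases h2 (fun j => (hγ.2 j).trans_lt (hb j)) i
    have h4 := Fintype.card_le_of_injective (fun i => (⟨γ i, h3 i⟩ : Fin k))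
      fun i j hij => hinj (congrArg Fin.val hij)
    simp at h4
  · have h2 : (Fin.cons k b : Fin (k + 1) → ℕ) - Fin.cons k γ = Fin.cons 0 (b - γ) := by
      funext i
      refine Fin.cases ?_ (fun j => ?_) i
      · simp
      · simp
    rw [h2, ← cf_killCompl, killCompl_unitPoly_inv]
    congr 1
    refine antisymm_cf_liftedPhi.eq_of_stair antisymm_cf_Phi_cons ?_ fun i => ?_
    · have h3 : (Fin.cons k (stair k) : Fin (k + 1) → ℕ) = stair (k + 1) := by
        funext i
        refine Fin.cases (by simp [stair]) (fun j => ?_) i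
        simp only [Fin.cons_succ, stair, Fin.val_succ]
        omega
      rw [h3, cf_liftedPhi_stair, cf_Phi_stair]
    · have h3 : γ i ≤ b i := Finset.mem_Iic.1 hγ i
      exact h3.trans_lt (hb i)

end

/-! ### From coefficients to chains and Gog trapezoids -/

section

variable {k : ℕ}

/-! ### Sums over monotone exponents -/

open scoped Classical in
/-- Decrease every entry that is equal to the next one. -/
def dec (a : Fin k → ℕ) (i : Fin k) : ℕ :=
  if ∃ j : Fin k, (j : ℕ) = i + 1 ∧ a i = a j then a i - 1 else a i

theorem dec_le (a : Fin k → ℕ) : dec a ≤ a := fun i => by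
  rw [dec]
  split_ifs
  · exact Nat.sub_le _ _
  · exact le_rfl

theorem dec_of_eq {a : Fin k → ℕ} {i j : Fin k} (hij : (j : ℕ) = i + 1) (h : a i = a j) :
    dec a i = a i - 1 := if_pos ⟨j, hij, h⟩

theorem dec_of_ne {a : Fin k → ℕ} {i j : Fin k} (hij : (j : ℕ) = i + 1) (h : a i ≠ a j) :
    dec a i = a i := by
  refine if_neg ?_
  rintro ⟨j', hj', h'⟩
  rw [show j' = j from Fin.ext (hj'.trans hij.symm)] at h'
  exact h h'

theorem dec_of_last {a : Fin k → ℕ} {i : Fin k} (hi : (i : ℕ) + 1 = k) : dec a i = a i := by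
  refine if_neg ?_
  rintro ⟨j, hj, -⟩
  have := j.2
  omega

theorem dec_cons_cons (b c : ℕ) (γ : Fin k → ℕ) :
    dec (Fin.cons b (Fin.cons c γ : Fin (k + 1) → ℕ) : Fin (k + 2) → ℕ)
      = Fin.cons (if c = b then b - 1 else b) (dec (Fin.cons c γ : Fin (k + 1) → ℕ)) := by
  funext i
  refine Fin.cases ?_ (fun i => ?_) i
  · rw [Fin.cons_zero]
    split_ifs with h
    · rw [dec_of_eq (j := 1) rfl (by simpa using h.symm)]
      rfl
    · rw [dec_of_ne (j := 1) rfl (by simpa using Ne.symm h)]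
      rfl
  · rw [Fin.cons_succ, dec, dec]
    refine if_congr ⟨?_, ?_⟩ rfl rfl
    · rintro ⟨j, hj, h⟩
      obtain ⟨j, rfl⟩ := Fin.exists_succ_eq.2 (show j ≠ 0 by rintro rfl; simp at hj)
      refine ⟨j, ?_, h⟩
      simp only [Fin.val_succ] at hj
      omega
    · rintro ⟨j, hj, h⟩
      refine ⟨j.succ, ?_, h⟩
      simp only [Fin.val_succ]
      omega

theorem sum_Iic_cons {M : Type*} [AddCommMonoid M] (a : ℕ) (α : Fin k → ℕ)
    (f : (Fin (k + 1) → ℕ) → M) : ∑ β ∈ Finset.Iic (Fin.cons a α : Fin (k + 1) → ℕ), f β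
      = ∑ c ∈ Finset.range (a + 1), ∑ γ ∈ Finset.Iic α, f (Fin.cons c γ) := by
  rw [← Finset.sum_product']
  refine Finset.sum_bij' (fun β _ => (β 0, Fin.tail β)) (fun z _ => Fin.cons z.1 z.2) ?_ ?_ ?_ ?_ ?_
  · intro β hβ
    rw [Finset.mem_Iic] at hβ
    rw [Finset.mem_product, Finset.mem_range, Finset.mem_Iic]
    exact ⟨Nat.lt_succ_of_le (hβ 0), fun i => hβ i.succ⟩
  · intro z hz
    rw [Finset.mem_product, Finset.mem_range, Finset.mem_Iic] at hz
    rw [Finset.mem_Iic, Fin.cons_le_cons]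
    exact ⟨Nat.le_of_lt_succ hz.1, hz.2⟩
  · exact fun β _ => Fin.cons_self_tail β
  · exact fun z _ => rfl
  · exact fun β _ => by rw [Fin.cons_self_tail]

/-- The relations between the values at adjacent arguments. -/
def Adjacent (f : (Fin k → ℕ) → ℚ) : Prop :=
  ∀ i j : Fin k, (j : ℕ) = i + 1 → ∀ α : Fin k → ℕ, α i = α j →
    ∑ b ∈ Finset.range (α j + 1), f (Function.update α j b) = f (Function.update α i (α i - 1))

theorem Adjacent.cons {f : (Fin (k + 1) → ℕ) → ℚ} (hf : Adjacent f) (b : ℕ) :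
    Adjacent fun γ : Fin k → ℕ => f (Fin.cons b γ) := by
  intro i j hij α h
  have := hf i.succ j.succ (by simp only [Fin.val_succ]; omega) (Fin.cons b α) h
  simpa only [Fin.cons_succ, Fin.cons_update] using this

theorem monotone_cons_cons {b c : ℕ} {γ : Fin k → ℕ} :
    Monotone (Fin.cons b (Fin.cons c γ : Fin (k + 1) → ℕ) : Fin (k + 2) → ℕ)
      ↔ b ≤ c ∧ Monotone (Fin.cons c γ : Fin (k + 1) → ℕ) :=
  monotone_vecCons

theorem monotone_cons_of_le {a c : ℕ} {α : Fin k → ℕ} (hα : Monotone (Fin.cons a α : Fin (k + 1) → ℕ))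
    (hca : c ≤ a) : Monotone (Fin.cons c α : Fin (k + 1) → ℕ) := by
  intro i j hij
  have h2 := hα hij
  revert h2 hij
  refine Fin.cases (fun _ => ?_) (fun i => ?_) i
  · refine Fin.cases (fun _ => le_rfl) (fun j h2 => ?_) j
    exact hca.trans h2
  · refine Fin.cases (fun h => ?_) (fun j h h2 => h2) j
    exact absurd h (by simp)

/-- The terms with c ≤ b of the full sum are gathered in the single term c = b. -/
theorem sum_range_ite {h : ℕ → ℚ} {e : ℚ} {b : ℕ} (he : ∑ c ∈ Finset.range (b + 1), h c = e)
    {a : ℕ} (hab : b ≤ a) : ∑ c ∈ Finset.range (a + 1), (if b ≤ c then if c = b then e else h c else 0)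
      = ∑ c ∈ Finset.range (a + 1), h c := by
  induction a, hab using Nat.le_induction with
  | base =>
    rw [he, Finset.sum_range_succ, Finset.sum_eq_zero, if_pos le_rfl, if_pos rfl, zero_add]
    intro c hc
    rw [if_neg (by have := Finset.mem_range.1 hc; omega)]
  | succ a hab ih =>
    rw [Finset.sum_range_succ, ih, Finset.sum_range_succ _ (a + 1), if_pos (by omega), if_neg (by omega)]

open scoped Classical in
-- Let the first entry be b and the second run through c. By adjacency the terms with c ≤ b sum to
-- the value at (b - 1, b, …), which is what `dec` makes of a vector starting with b, b. So the sum
-- over all c becomes one over c ≥ b, and induction on the number of variables treats the later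
-- entries.
theorem sum_monotone_cons {f : (Fin (k + 1) → ℕ) → ℚ} (hf : Adjacent f) {b : ℕ} {α : Fin k → ℕ}
    (hα : Monotone (Fin.cons b α : Fin (k + 1) → ℕ)) :
    ∑ γ ∈ Finset.Iic α, (if Monotone (Fin.cons b γ : Fin (k + 1) → ℕ) then
      f (dec (Fin.cons b γ : Fin (k + 1) → ℕ)) else 0) = ∑ β ∈ Finset.Iic α, f (Fin.cons b β) := by
  induction k generalizing b with
  | zero =>
    refine Finset.sum_congr rfl fun γ _ => ?_
    rw [if_pos (Subsingleton.monotone (α := Fin 1) _)]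
    congr 1
  | succ k ih =>
    obtain ⟨a, α, rfl⟩ : ∃ a α', α = Fin.cons a α' := ⟨α 0, Fin.tail α, (Fin.cons_self_tail α).symm⟩
    rw [monotone_cons_cons] at hα
    rw [sum_Iic_cons, sum_Iic_cons]
    have h1 : ∀ c ∈ Finset.range (a + 1), ∑ γ ∈ Finset.Iic α,
        (if Monotone (Fin.cons b (Fin.cons c γ : Fin (k + 1) → ℕ) : Fin (k + 2) → ℕ) then
          f (dec (Fin.cons b (Fin.cons c γ : Fin (k + 1) → ℕ) : Fin (k + 2) → ℕ)) else 0)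
        = ∑ γ ∈ Finset.Iic α, if b ≤ c then if c = b then f (Fin.cons (b - 1) (Fin.cons c γ : Fin (k + 1) → ℕ))
          else f (Fin.cons b (Fin.cons c γ : Fin (k + 1) → ℕ)) else 0 := by
      intro c hc
      have hca : c ≤ a := Nat.le_of_lt_succ (Finset.mem_range.1 hc)
      have hcα : Monotone (Fin.cons c α : Fin (k + 1) → ℕ) := monotone_cons_of_le hα.2 hca
      by_cases hbc : b ≤ c
      · simp only [monotone_cons_cons, hbc, true_and, dec_cons_cons, if_true]
        by_cases hcb : c = b
        · simp only [hcb, if_true]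
          subst hcb
          exact ih (hf.cons (c - 1)) hcα
        · simp only [hcb, if_false]
          exact ih (hf.cons b) hcα
      · simp only [monotone_cons_cons, hbc, false_and, if_false]
    rw [Finset.sum_congr rfl h1, Finset.sum_comm, Finset.sum_comm (s := Finset.range (a + 1))]
    refine Finset.sum_congr rfl fun γ _ => ?_
    rw [← sum_range_ite (h := fun c => f (Fin.cons b (Fin.cons c γ : Fin (k + 1) → ℕ)))
      (e := f (Fin.cons (b - 1) (Fin.cons b γ : Fin (k + 1) → ℕ))) ?_ hα.1]
    · refine Finset.sum_congr rfl fun c _ => ?_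
      by_cases hcb : c = b
      · rw [hcb]
      · simp only [hcb, if_false]
    -- The adjacency relation for the first two entries, both equal to b.
    · have h2 := hf 0 1 rfl (Fin.cons b (Fin.cons b γ : Fin (k + 1) → ℕ)) rfl
      have h3 : ∀ c, Function.update (Fin.cons b (Fin.cons b γ : Fin (k + 1) → ℕ) : Fin (k + 2) → ℕ) 1 c
          = Fin.cons b (Fin.cons c γ : Fin (k + 1) → ℕ) := fun c => by
        have : (1 : Fin (k + 2)) = Fin.succ 0 := rfl
        rw [this, ← Fin.cons_update, Fin.update_cons_zero]
      simp only [h3, Fin.update_cons_zero] at h2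
      exact h2

open scoped Classical in
theorem sum_monotone {f : (Fin k → ℕ) → ℚ} (hf : Adjacent f) {α : Fin k → ℕ} (hα : Monotone α) :
    ∑ β ∈ Finset.Iic α, (if Monotone β then f (dec β) else 0) = ∑ β ∈ Finset.Iic α, f β := by
  cases k with
  | zero =>
    refine Finset.sum_congr rfl fun γ _ => ?_
    rw [if_pos (Subsingleton.monotone _), Subsingleton.elim (dec γ) γ]
  | succ k =>
    obtain ⟨a, α, rfl⟩ : ∃ a α', α = Fin.cons a α' := ⟨α 0, Fin.tail α, (Fin.cons_self_tail α).symm⟩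
    rw [sum_Iic_cons, sum_Iic_cons]
    refine Finset.sum_congr rfl fun c hc => ?_
    exact sum_monotone_cons hf (monotone_cons_of_le hα (Nat.le_of_lt_succ (Finset.mem_range.1 hc)))

end

section

variable {k : ℕ}

/-! ### Coefficients with the exponents in reverse order -/

/-- The coefficients of `gogSeries`, with the exponents in reverse order. -/
def revCoeff (n k : ℕ) (α : Fin k → ℕ) : ℚ := cf (gogSeries n k) (α ∘ Fin.rev)

theorem revCoeff_eq_zero (n : ℕ) {α : Fin k → ℕ} {i : Fin k} (hi : α i = 0) : revCoeff n k α = 0 :=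
  cf_gogSeries_eq_zero n (i := i.rev) (by simpa using hi)

theorem revCoeff_eq_zero_of_lt (n : ℕ) {α : Fin k → ℕ} (hk : 0 < k) (hα : ∀ i, α i < k) :
    revCoeff n k α = 0 :=
  cf_gogSeries_eq_zero_of_lt n hk fun _ => hα _

theorem revCoeff_eq_zero_of_last {n : ℕ} (hkn : k ≤ n) {p : Fin k} (hp : (p : ℕ) + 1 = k)
    {α : Fin k → ℕ} (hαp : α p = n + 1) (hα : ∀ l, l ≠ p → α l ≤ n) : revCoeff n k α = 0 := by
  refine cf_gogSeries_eq_zero_of_antisymm hkn (p := p.rev) ?_ ?_ fun l hl => hα _ fun h => hl ?_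
  · rw [Fin.val_rev]; omega
  · rw [Function.comp_apply, Fin.rev_rev, hαp]
  · rw [← h, Fin.rev_rev]

theorem revCoeff_succ (n : ℕ) (α : Fin k → ℕ) :
    revCoeff (n + 1) k α = ∑ β ∈ Finset.Iic α, revCoeff n k β := by
  rw [revCoeff, cf_gogSeries_succ]
  have hrev : ∀ γ : Fin k → ℕ, (γ ∘ Fin.rev) ∘ Fin.rev = γ := fun γ => by
    funext i
    simp
  refine Finset.sum_bij' (fun β _ => β ∘ Fin.rev) (fun β _ => β ∘ Fin.rev) (fun β hβ => ?_)
    (fun β hβ => ?_) (fun β _ => hrev β) (fun β _ => hrev β) fun β _ => ?_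
  · rw [Finset.mem_Iic] at hβ ⊢
    intro i
    simpa using hβ i.rev
  · rw [Finset.mem_Iic] at hβ ⊢
    exact fun i => hβ i.rev
  · rw [revCoeff, hrev]

theorem update_comp_rev (α : Fin k → ℕ) (i : Fin k) (b : ℕ) :
    Function.update α i b ∘ Fin.rev = Function.update (α ∘ Fin.rev) i.rev b := by
  funext l
  by_cases h : l = i.rev
  · subst h; simp
  · have h' : l.rev ≠ i := fun h' => h (by rw [← h', Fin.rev_rev])
    simp [h, h']

theorem adjacent_revCoeff (n k : ℕ) : Adjacent (revCoeff n k) := by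
  intro i j hij α hα
  have h := sum_cf_gogSeries_update n (i := j.rev) (j := i.rev)
    (by rw [Fin.val_rev, Fin.val_rev]; have := j.2; omega) (α := α ∘ Fin.rev) (by simp [hα])
  simpa only [revCoeff, update_comp_rev, Function.comp_apply, Fin.rev_rev] using h

theorem revCoeff_snoc {a : Fin k → ℕ} (ha : ∀ i, a i ≤ k) :
    revCoeff (k + 1) (k + 1) (Fin.snoc a (k + 1)) = revCoeff (k + 1) k a := by
  rw [revCoeff, revCoeff, ← cf_gogSeries_cons (a := a ∘ Fin.rev) fun i => ha _]
  congr 1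
  funext i
  refine Fin.cases ?_ (fun j => ?_) i
  · simp
  · rw [Function.comp_apply, Fin.rev_succ, Fin.snoc_castSucc, Fin.cons_succ, Function.comp_apply]

/-- As a partial sum over β ≤ α, the coefficient loses only terms with last entry n + 1 and other
entries at most n, and these vanish. -/
theorem revCoeff_update_last {n : ℕ} (hkn : k ≤ n) {p : Fin k} (hp : (p : ℕ) + 1 = k)
    {α : Fin k → ℕ} (hαp : α p = n + 1) (hα : ∀ l, l ≠ p → α l ≤ n) :
    revCoeff (n + 1) k (Function.update α p n) = revCoeff (n + 1) k α := by
  rw [revCoeff_succ, revCoeff_succ]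
  refine Finset.sum_subset ?_ fun β hβ hβ' => ?_
  · refine Finset.Iic_subset_Iic.2 ?_
    rw [update_le_self_iff]
    omega
  · rw [Finset.mem_Iic] at hβ hβ'
    refine revCoeff_eq_zero_of_last hkn hp ?_ fun l hl => (hβ l).trans (hα l hl)
    by_contra hne
    refine hβ' fun l => ?_
    by_cases hl : l = p
    · subst hl
      rw [Function.update_self]
      have h1 : β l ≤ α l := hβ l
      change β l ≤ n
      omega
    · rw [Function.update_of_ne hl]
      exact hβ l

theorem revCoeff_zero_zero (α : Fin 0 → ℕ) : revCoeff 0 0 α = 1 := by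
  rw [revCoeff, Subsingleton.elim (α ∘ Fin.rev) 0, cf_zero_right, gogSeries, map_mul, map_mul,
    ← cf_zero_right (Phi 0 : MvPowerSeries (Fin 0) ℚ), Subsingleton.elim 0 (stair 0), cf_Phi_stair]
  simp [constantCoeff_coe_poly, constantCoeff_unitPoly]

theorem dec_apply_le (a : Fin k → ℕ) (i : Fin k) : dec a i ≤ a i := dec_le a i

theorem monotone_dec {a : Fin k → ℕ} (ha : Monotone a) : Monotone (dec a) := by
  intro i j hij
  rcases hij.eq_or_lt with rfl | hlt
  · exact le_rfl
  have h1 := ha hij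
  by_cases hj : ∃ l : Fin k, (l : ℕ) = j + 1 ∧ a j = a l
  · obtain ⟨l, hl, h2⟩ := hj
    rw [dec_of_eq hl h2]
    have hs : (i : ℕ) + 1 < k := by have := j.2; rw [Fin.lt_def] at hlt; omega
    have h3 : a i ≤ a ⟨i + 1, hs⟩ := ha (by rw [Fin.le_def]; simp)
    have h4 : a ⟨i + 1, hs⟩ ≤ a j := ha hlt
    by_cases h5 : a i = a ⟨i + 1, hs⟩
    · rw [dec_of_eq (j := ⟨i + 1, hs⟩) rfl h5]
      omega
    · have := dec_apply_le a i
      omega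
  · have : dec a j = a j := if_neg hj
    rw [this]
    exact (dec_apply_le a i).trans h1

theorem dec_le_of_not_last {n : ℕ} {a : Fin k → ℕ} (ha : Monotone a) (han : ∀ i, a i ≤ n + 1)
    {i : Fin k} (hi : (i : ℕ) + 1 ≠ k) : dec a i ≤ n := by
  have hs : (i : ℕ) + 1 < k := by have := i.2; omega
  have h3 : a i ≤ a ⟨i + 1, hs⟩ := ha (by rw [Fin.le_def]; simp)
  have h4 := han ⟨i + 1, hs⟩
  by_cases h5 : a i = a ⟨i + 1, hs⟩
  · rw [dec_of_eq (j := ⟨i + 1, hs⟩) rfl h5]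
    omega
  · have := dec_apply_le a i
    omega

/-! ### Chains of monotone vectors -/

/-- The possible members of a chain at a given time. -/
structure Valid (t : ℕ) (a : Fin k → ℕ) : Prop where
  mono : Monotone a
  le : ∀ i, a i ≤ t
  eq : ∀ i : Fin k, t ≤ i + 1 → a i = t

/-- The relation between consecutive members of a chain. -/
structure Rel (b a : Fin k → ℕ) : Prop where
  le : b ≤ a
  lt : ∀ i j : Fin k, (j : ℕ) = i + 1 → b i < a j

open scoped Classical in
/-- The number of chains of length `n` that end with a given vector. -/
def chains (k : ℕ) : ℕ → (Fin k → ℕ) → ℕ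
  | 0, a => if a = 0 then 1 else 0
  | t + 1, a => if Valid (t + 1) a then ∑ b ∈ Finset.Iic a, if Rel b a then chains k t b else 0 else 0

theorem chains_eq_zero {n : ℕ} {a : Fin k → ℕ} (h : ¬ Valid n a) : chains k n a = 0 := by
  cases n with
  | zero =>
    refine if_neg ?_
    rintro rfl
    exact h ⟨monotone_const, fun i => le_rfl, fun i _ => rfl⟩
  | succ n => exact if_neg h

theorem valid_snoc {n : ℕ} {b : Fin k → ℕ} :
    Valid n (Fin.snoc b n : Fin (k + 1) → ℕ) ↔ Valid n b := by
  constructor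
  · intro h
    refine ⟨fun i j hij => ?_, fun i => ?_, fun i hi => ?_⟩
    · simpa using h.mono (Fin.castSucc_le_castSucc_iff.2 hij)
    · simpa using h.le i.castSucc
    · simpa using h.eq i.castSucc hi
  · intro h
    have hle : ∀ i, (Fin.snoc b n : Fin (k + 1) → ℕ) i ≤ n := fun i => by
      refine Fin.lastCases ?_ (fun j => ?_) i
      · simp
      · simpa using h.le j
    refine ⟨fun i j => ?_, hle, fun i => ?_⟩
    · refine Fin.lastCases (fun _ => by simpa using hle i) (fun j => ?_) j
      refine Fin.lastCases (fun h1 => ?_) (fun i h1 => ?_) i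
      · exact absurd h1 (not_le.2 (Fin.castSucc_lt_last j))
      · simpa using h.mono (Fin.castSucc_le_castSucc_iff.1 h1)
    · refine Fin.lastCases (fun _ => by simp) (fun i hi => ?_) i
      simpa using h.eq i hi

theorem rel_snoc {t : ℕ} {b a : Fin k → ℕ} (hb : Valid t b) :
    Rel (Fin.snoc b t : Fin (k + 1) → ℕ) (Fin.snoc a (t + 1)) ↔ Rel b a := by
  constructor
  · intro h
    refine ⟨fun i => ?_, fun i j hij => ?_⟩
    · simpa using h.le i.castSucc
    · simpa using h.lt i.castSucc j.castSucc hij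
  · intro h
    refine ⟨fun i => ?_, fun i j => ?_⟩
    · refine Fin.lastCases (by simp) (fun i => ?_) i
      simpa using h.le i
    · refine Fin.lastCases (fun h1 => ?_) (fun i => ?_) i
      · have := j.2
        rw [Fin.val_last] at h1
        omega
      · refine Fin.lastCases (fun _ => ?_) (fun j h1 => ?_) j
        · simpa using Nat.lt_succ_of_le (hb.le i)
        · simpa using h.lt i j h1

theorem snoc_le_snoc {a b : Fin k → ℕ} {c d : ℕ} :
    (Fin.snoc a c : Fin (k + 1) → ℕ) ≤ Fin.snoc b d ↔ a ≤ b ∧ c ≤ d := by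
  constructor
  · intro h
    exact ⟨fun i => by simpa using h i.castSucc, by simpa using h (Fin.last k)⟩
  · rintro ⟨h1, h2⟩ i
    refine Fin.lastCases (by simpa using h2) (fun i => ?_) i
    simpa using h1 i

/-- As long as n ≤ k + 1, the additional last coordinate of a chain is forced to equal the time at
every step, and it imposes no condition on the others. -/
theorem chains_snoc {n : ℕ} (hn : n ≤ k + 1) (a : Fin k → ℕ) :
    chains (k + 1) n (Fin.snoc a n) = chains k n a := by
  induction n generalizing a with
  | zero =>
    rw [chains, chains]
    refine if_congr ⟨?_, ?_⟩ rfl rfl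
    · intro h
      funext i
      simpa using congrFun h i.castSucc
    · rintro rfl
      funext i
      refine Fin.lastCases (by simp) (fun i => by simp) i
  | succ t ih =>
    rw [chains, chains]
    classical
    refine if_congr valid_snoc ?_ rfl
    rw [eq_comm]
    refine Finset.sum_of_injOn (fun γ => Fin.snoc γ t) ?_ ?_ ?_ ?_
    · intro γ _ γ' _ h
      funext i
      simpa using congrFun h i.castSucc
    · intro γ hγ
      rw [Finset.coe_Iic, Set.mem_Iic] at hγ ⊢
      exact snoc_le_snoc.2 ⟨hγ, Nat.le_succ t⟩
    · intro γ hγ hn'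
      rw [chains_eq_zero, ite_self]
      intro hv
      -- Here t ≤ k, so validity leaves no choice for the last coordinate.
      have h1 : γ (Fin.last k) = t := hv.eq _ (by rw [Fin.val_last]; omega)
      have h2 : Fin.snoc (Fin.init γ) t = γ := by
        conv_rhs => rw [← Fin.snoc_init_self γ, h1]
      refine hn' ⟨Fin.init γ, ?_, h2⟩
      rw [Finset.mem_Iic, ← h2, snoc_le_snoc] at hγ
      simpa using hγ.1
    · intro γ _
      rw [ih (by omega)]
      by_cases hv : Valid t γ
      · exact if_congr (rel_snoc hv).symm rfl rfl
      · rw [chains_eq_zero hv, ite_self, ite_self]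

/-- The numbers of chains are the coefficients of `gogSeries`. -/
def ChainsEq (n k : ℕ) : Prop :=
  ∀ a : Fin k → ℕ, Monotone a → (∀ i, a i ≤ n) → (chains k n a : ℚ) = revCoeff n k (dec a)

/-- Chains vanish off the monotone vectors, so `sum_monotone` turns their sum into an unrestricted
sum of coefficients, which is a coefficient for n + 1. Entries up to n + 1 are allowed in the bound
because the final evaluation is at (n+1, …, n+1). -/
theorem ChainsEq.sum {n : ℕ} (h : ChainsEq n k) (hkn : k ≤ n) {c : Fin k → ℕ} (hc : Monotone c)
    (hcn : ∀ i, c i ≤ n + 1) : (∑ b ∈ Finset.Iic c, (chains k n b : ℚ)) = revCoeff (n + 1) k c := by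
  classical
  rw [revCoeff_succ, ← sum_monotone (adjacent_revCoeff n k) hc]
  refine Finset.sum_congr rfl fun b hb => ?_
  rw [Finset.mem_Iic] at hb
  split_ifs with hm
  · by_cases hbn : ∀ i, b i ≤ n
    · exact h b hm hbn
    · rw [chains_eq_zero fun hv => hbn hv.le, Nat.cast_zero]
      push Not at hbn
      obtain ⟨i, hi⟩ := hbn
      have hb' : ∀ i, b i ≤ n + 1 := fun i => (hb i).trans (hcn i)
      have hk : k - 1 < k := by have := i.2; omega
      have hp : ((⟨k - 1, hk⟩ : Fin k) : ℕ) + 1 = k := by simp only; omega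
      -- A monotone b with an entry n + 1 has last entry n + 1, and `dec` lowers all earlier entries
      -- to at most n; this is the vanishing caused by flip antisymmetry.
      refine (revCoeff_eq_zero_of_last hkn hp ?_ fun l hl => ?_).symm
      · rw [dec_of_last hp]
        have h1 : b i ≤ b ⟨k - 1, hk⟩ := hm (by rw [Fin.le_def]; simp only; omega)
        have h2 := hb' ⟨k - 1, hk⟩
        omega
      · refine dec_le_of_not_last hm hb' fun h1 => hl (Fin.ext ?_)
        simp only
        omega
  · rw [chains_eq_zero fun hv => hm hv.mono, Nat.cast_zero]

theorem dec_eq_zero {a : Fin k → ℕ} {i : Fin k} (h : a i = 0) : dec a i = 0 :=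
  Nat.le_zero.1 (h ▸ dec_apply_le a i)

/-- Only where a_i = a_(i+1) is the strict inequality b_i < a_(i+1) stronger than b_i ≤ a_i. Entries
0 are excluded because `dec` cannot lower them, whereas the strict inequality would be impossible.
-/
theorem rel_iff_le_dec {a b : Fin k → ℕ} (ha : Monotone a) (h0 : ∀ i, a i ≠ 0) :
    Rel b a ↔ b ≤ dec a := by
  constructor
  · intro h i
    have h1 : b i ≤ a i := h.le i
    by_cases hj : ∃ l : Fin k, (l : ℕ) = i + 1 ∧ a i = a l
    · obtain ⟨l, hl, h2⟩ := hj
      have := h.lt i l hl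
      rw [dec_of_eq hl h2]
      exact Nat.le_sub_one_of_lt (h2 ▸ this)
    · have : dec a i = a i := if_neg hj
      rwa [this]
  · intro h
    refine ⟨h.trans (dec_le a), fun i j hij => ?_⟩
    have h1 : b i ≤ dec a i := h i
    have h2 := h0 i
    have h3 : a i ≤ a j := ha (by rw [Fin.le_def]; omega)
    by_cases h4 : a i = a j
    · rw [dec_of_eq hij h4] at h1
      omega
    · rw [dec_of_ne hij h4] at h1
      omega

theorem ChainsEq.succ {n : ℕ} (h : ChainsEq n k) (hkn : k ≤ n) : ChainsEq (n + 1) k := by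
  classical
  intro a ha han
  -- For k ≤ n no index is large enough for the condition that forces an entry to be n + 1.
  have hv : Valid (n + 1) a := ⟨ha, han, fun i hi => by have := i.2; omega⟩
  rw [chains, if_pos hv]
  by_cases h0 : ∃ i, a i = 0
  · obtain ⟨i, hi⟩ := h0
    rw [revCoeff_eq_zero _ (dec_eq_zero hi), Finset.sum_eq_zero, Nat.cast_zero]
    intro b hb
    by_cases hvb : Valid n b
    · have hbi : b i = 0 := Nat.le_zero.1 (hi ▸ Finset.mem_Iic.1 hb i)
      have : (chains k n b : ℚ) = 0 := by
        rw [h b hvb.mono hvb.le, revCoeff_eq_zero _ (dec_eq_zero hbi)]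
      rw [Nat.cast_eq_zero.1 this, ite_self]
    · rw [chains_eq_zero hvb, ite_self]
  · push Not at h0
    rw [← h.sum hkn (monotone_dec ha) fun i => (dec_apply_le a i).trans (han i), ← Finset.sum_filter,
      Nat.cast_sum]
    refine Finset.sum_congr (Finset.ext fun b => ?_) fun _ _ => rfl
    rw [Finset.mem_filter, Finset.mem_Iic, Finset.mem_Iic, rel_iff_le_dec ha h0]
    exact ⟨fun h => h.2, fun h => ⟨h.trans (dec_le a), h⟩⟩

theorem dec_snoc (b : Fin k → ℕ) (c : ℕ) : dec (Fin.snoc b c : Fin (k + 1) → ℕ)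
    = Fin.snoc (fun i => if (i : ℕ) + 1 = k then (if b i = c then b i - 1 else b i) else dec b i) c := by
  funext i
  refine Fin.lastCases ?_ (fun i => ?_) i
  · rw [dec_of_last (by simp)]
    simp
  · rw [Fin.snoc_castSucc]
    split_ifs with h1 h2
    · rw [dec_of_eq (j := Fin.last k) (by simp [h1]) (by simpa using h2), Fin.snoc_castSucc]
    · rw [dec_of_ne (j := Fin.last k) (by simp [h1]) (by simpa using h2), Fin.snoc_castSucc]
    · have hs : (i : ℕ) + 1 < k := by have := i.2; omega
      have e : (Fin.snoc b c : Fin (k + 1) → ℕ) (Fin.castSucc ⟨i + 1, hs⟩) = b ⟨i + 1, hs⟩ :=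
        Fin.snoc_castSucc (α := fun _ => ℕ) c b ⟨i + 1, hs⟩
      by_cases h2 : b i = b ⟨i + 1, hs⟩
      · rw [dec_of_eq (i := i) (j := ⟨i + 1, hs⟩) rfl h2,
          dec_of_eq (j := Fin.castSucc ⟨i + 1, hs⟩) rfl (by rw [e, Fin.snoc_castSucc, h2]), Fin.snoc_castSucc]
      · rw [dec_of_ne (i := i) (j := ⟨i + 1, hs⟩) rfl h2,
          dec_of_ne (j := Fin.castSucc ⟨i + 1, hs⟩) rfl (by rw [e, Fin.snoc_castSucc]; exact h2), Fin.snoc_castSucc]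

/-- Appending k + 1 makes `dec` also lower the last entry of b when that entry is k + 1. By
`revCoeff_update_last` the change from k + 1 to k does not affect the coefficient, and
`revCoeff_snoc` removes the appended entry. -/
theorem revCoeff_dec_snoc {b : Fin k → ℕ} (hb : Monotone b) (hbk : ∀ i, b i ≤ k + 1) :
    revCoeff (k + 1) (k + 1) (dec (Fin.snoc b (k + 1))) = revCoeff (k + 1) k (dec b) := by
  rw [dec_snoc, revCoeff_snoc]
  · by_cases h : ∃ i : Fin k, (i : ℕ) + 1 = k ∧ b i = k + 1
    · obtain ⟨p, hp, hbp⟩ := h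
      rw [← revCoeff_update_last le_rfl hp (α := dec b) (by rw [dec_of_last hp, hbp])
        fun l hl => dec_le_of_not_last hb hbk fun h => hl (Fin.ext (by omega))]
      congr 1
      funext i
      by_cases hi : i = p
      · subst hi
        rw [if_pos hp, if_pos hbp, Function.update_self, hbp]
        rfl
      · rw [if_neg fun h => hi (Fin.ext (by omega)), Function.update_of_ne hi]
    · congr 1
      funext i
      split_ifs with h1 h2
      · exact absurd ⟨i, h1, h2⟩ h
      · rw [dec_of_last h1]
      · rfl
  · intro i
    have := hbk i
    split_ifs with h1 h2
    · omega
    · omega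
    · exact dec_le_of_not_last hb hbk h1

/-- Induction on k, and for each k on n. The first case for k + 1 variables is n = k + 1: vectors
ending in k + 1 reduce to k variables with the same n, and for all others both sides are zero. -/
theorem chainsEq {n : ℕ} (hkn : k ≤ n) : ChainsEq n k := by
  induction k generalizing n with
  | zero =>
    induction n with
    | zero =>
      intro a _ _
      rw [revCoeff_zero_zero, chains, if_pos (Subsingleton.elim _ _), Nat.cast_one]
    | succ n ih => exact (ih (Nat.zero_le n)).succ (Nat.zero_le n)
  | succ k ih =>
    induction n, hkn using Nat.le_induction with
    | base =>
      intro a ha hak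
      by_cases hl : a (Fin.last k) = k + 1
      · obtain ⟨b, rfl⟩ : ∃ b : Fin k → ℕ, a = Fin.snoc b (k + 1) := ⟨Fin.init a, by
          conv_lhs => rw [← Fin.snoc_init_self a, hl]⟩
        have hb : Monotone b := fun i j hij => by
          simpa using ha (Fin.castSucc_le_castSucc_iff.2 hij)
        have hbk : ∀ i, b i ≤ k + 1 := fun i => by simpa using hak i.castSucc
        rw [chains_snoc le_rfl, revCoeff_dec_snoc hb hbk]
        exact ih (Nat.le_succ k) b hb hbk
      · rw [chains_eq_zero fun hv => hl (hv.eq _ (by simp)), Nat.cast_zero,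
          revCoeff_eq_zero_of_lt _ (Nat.succ_pos k)]
        intro i
        have h1 := dec_apply_le a i
        have h2 : a i ≤ a (Fin.last k) := ha (Fin.le_last i)
        have h3 := hak (Fin.last k)
        omega
    | succ n hkn ihn => exact ihn.succ hkn

/-- A chain of length n has entries at most n, so the bound n + 1 adds nothing to the sum but makes
it the coefficient that is the residue of `F`. -/
theorem sum_chains {n : ℕ} (hkn : k ≤ n) :
    ((∑ b ∈ Finset.Iic fun _ => n + 1, chains k n b : ℕ) : ℚ)
      = cf (gogSeries (n + 1) k) fun _ => n + 1 := by
  rw [Nat.cast_sum, (chainsEq hkn).sum hkn monotone_const fun _ => le_rfl]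
  rfl

end

section

variable {k : ℕ}

/-! ### Gog trapezoids as chains -/

/-- `s` is a chain of length `n`. -/
structure IsChain (n : ℕ) (s : ℕ → Fin k → ℕ) : Prop where
  valid : ∀ t, t ≤ n → Valid t (s t)
  rel : ∀ t, t < n → Rel (s t) (s (t + 1))
  tail : ∀ t, n < t → s t = 0

open scoped Classical in
/-- The set of chains of length `n` that end with a given vector. -/
def chainSet (k : ℕ) : ℕ → (Fin k → ℕ) → Finset (ℕ → Fin k → ℕ)
  | 0, a => if a = 0 then {0} else ∅
  | t + 1, a => if Valid (t + 1) a then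
      ((Finset.Iic a).filter fun b => Rel b a).biUnion fun b =>
        (chainSet k t b).image fun s => Function.update s (t + 1) a
      else ∅

theorem mem_chainSet {n : ℕ} {a : Fin k → ℕ} {s : ℕ → Fin k → ℕ} :
    s ∈ chainSet k n a ↔ IsChain n s ∧ s n = a := by
  classical
  induction n generalizing a s with
  | zero =>
    have hv : ∀ b : Fin k → ℕ, Valid 0 b ↔ b = 0 := fun b =>
      ⟨fun h => funext fun i => Nat.le_zero.1 (h.le i), by
        rintro rfl
        exact ⟨monotone_const, fun i => le_rfl, fun i _ => rfl⟩⟩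
    rw [chainSet]
    constructor
    · intro h
      split_ifs at h with ha
      · rw [Finset.mem_singleton] at h
        subst h ha
        exact ⟨⟨fun t ht => by rw [Nat.le_zero.1 ht, hv]; rfl, fun t ht => absurd ht (Nat.not_lt_zero t),
          fun t _ => rfl⟩, rfl⟩
      · exact absurd h (Finset.notMem_empty s)
    · rintro ⟨h, rfl⟩
      have h0 : s 0 = 0 := (hv _).1 (h.valid 0 le_rfl)
      rw [if_pos h0, Finset.mem_singleton]
      funext t
      rcases Nat.eq_zero_or_pos t with rfl | ht
      · exact h0
      · exact h.tail t ht
  | succ n ih =>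
    rw [chainSet]
    constructor
    · intro h
      split_ifs at h with ha
      · simp only [Finset.mem_biUnion, Finset.mem_filter, Finset.mem_image] at h
        obtain ⟨b, ⟨-, hb⟩, s', hs', rfl⟩ := h
        obtain ⟨h1, rfl⟩ := ih.1 hs'
        refine ⟨⟨fun t ht => ?_, fun t ht => ?_, fun t ht => ?_⟩, Function.update_self ..⟩
        · rcases ht.eq_or_lt with rfl | ht
          · rwa [Function.update_self]
          · rw [Function.update_of_ne ht.ne]
            exact h1.valid t (Nat.le_of_lt_succ ht)
        · rw [Function.update_of_ne ht.ne]
          rcases (Nat.le_of_lt_succ ht).eq_or_lt with rfl | ht'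
          · rwa [Function.update_self]
          · rw [Function.update_of_ne (by omega)]
            exact h1.rel t ht'
        · rw [Function.update_of_ne ht.ne']
          exact h1.tail t (by omega)
      · exact absurd h (Finset.notMem_empty s)
    · rintro ⟨h, rfl⟩
      rw [if_pos (h.valid _ le_rfl)]
      simp only [Finset.mem_biUnion, Finset.mem_filter, Finset.mem_image, Finset.mem_Iic]
      have hr := h.rel n (Nat.lt_succ_self n)
      -- The shorter chain is s with member n + 1 reset to 0, as the normalization beyond the last
      -- time requires.
      refine ⟨s n, ⟨hr.le, hr⟩, Function.update s (n + 1) 0, ih.2 ⟨⟨fun t ht => ?_, fun t ht => ?_,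
        fun t ht => ?_⟩, Function.update_of_ne (by omega) _ _⟩, ?_⟩
      · rw [Function.update_of_ne (by omega)]
        exact h.valid t (by omega)
      · rw [Function.update_of_ne (by omega), Function.update_of_ne (by omega)]
        exact h.rel t (by omega)
      · by_cases ht' : t = n + 1
        · subst ht'
          exact Function.update_self ..
        · rw [Function.update_of_ne ht']
          exact h.tail t (by omega)
      · rw [Function.update_idem, Function.update_eq_self]

theorem card_chainSet (n : ℕ) (a : Fin k → ℕ) : (chainSet k n a).card = chains k n a := by
  classical
  induction n generalizing a with
  | zero =>
    rw [chainSet, chains]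
    split_ifs
    · rfl
    · rfl
  | succ n ih =>
    rw [chainSet, chains]
    split_ifs
    · rw [Finset.card_biUnion, ← Finset.sum_filter]
      · refine Finset.sum_congr (by ext; simp) fun b _ => ?_
        rw [← ih, Finset.card_image_of_injOn]
        intro s hs s' hs' h
        have h1 := (mem_chainSet.1 hs).1.tail (n + 1) (Nat.lt_succ_self n)
        have h2 := (mem_chainSet.1 hs').1.tail (n + 1) (Nat.lt_succ_self n)
        funext t
        by_cases ht : t = n + 1
        · rw [ht, h1, h2]
        · have := congrFun h t
          simpa only [Function.update_of_ne ht] using this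
      · intro b _ b' _ hbb'
        rw [Function.onFun, Finset.disjoint_left]
        intro s hs hs'
        rw [Finset.mem_image] at hs hs'
        obtain ⟨u, hu, rfl⟩ := hs
        obtain ⟨u', hu', h⟩ := hs'
        refine hbb' ?_
        rw [← (mem_chainSet.1 hu).2, ← (mem_chainSet.1 hu').2]
        have := congrFun h n
        simpa only [Function.update_of_ne (show n ≠ n + 1 by omega)] using this.symm
    · rfl

theorem sum_chains_eq_ncard (n : ℕ) : ∑ b ∈ Finset.Iic fun _ : Fin k => n + 1, chains k n b
    = Set.ncard {s : ℕ → Fin k → ℕ | IsChain n s} := by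
  classical
  have h : {s : ℕ → Fin k → ℕ | IsChain n s}
      = ((Finset.Iic fun _ : Fin k => n + 1).biUnion fun b => chainSet k n b : Finset _) := by
    ext s
    simp only [Set.mem_ofPred_eq, Finset.coe_biUnion, Set.mem_iUnion, Finset.mem_coe, mem_chainSet,
      Finset.mem_Iic]
    exact ⟨fun hs => ⟨s n, fun i => ((hs.valid n le_rfl).le i).trans (Nat.le_succ n), hs, rfl⟩,
      fun ⟨b, _, hs, _⟩ => hs⟩
  rw [h, Set.ncard_coe_finset, Finset.card_biUnion]
  · exact Finset.sum_congr rfl fun b _ => (card_chainSet n b).symm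
  · intro b _ b' _ hbb'
    rw [Function.onFun, Finset.disjoint_left]
    intro s hs hs'
    exact hbb' ((mem_chainSet.1 hs).2.symm.trans (mem_chainSet.1 hs').2)

theorem Cell.bounds {n : ℕ} (c : Cell n k) : 1 ≤ c.1.1 ∧ 1 ≤ c.1.2 ∧ c.1.2 ≤ k ∧ c.1.1 + c.1.2 ≤ n + 1 := by
  obtain ⟨⟨i, j⟩, h1, h2, h3, h4⟩ := c
  simp only at *
  omega

/-- The array whose diagonals are the members of a chain. -/
def chainArray (n : ℕ) (s : ℕ → Fin k → ℕ) (c : Cell n k) : ℤ :=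
  s (c.1.1 + c.1.2 - 1) ⟨c.1.2 - 1, by have := c.bounds; omega⟩

/-- The member at time t is the antidiagonal i + j = t + 1. Monotonicity is the diagonal condition,
`Rel` gives the column and row conditions, and the bound by t and the forced value t give the last
column and the first row. -/
theorem isGogTrapezoid_chainArray {n : ℕ} {s : ℕ → Fin k → ℕ} (hs : IsChain n s) :
    IsGogTrapezoid n k (chainArray n s) := by
  refine ⟨fun c c' h => ?_, fun c c' h => ?_, fun c c' h h' => ?_, fun c h => ?_, fun c h => ?_⟩
  · have hc := c.bounds
    have hc' := c'.bounds
    simp only [chainArray, h] at hc' ⊢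
    obtain ⟨t, ht⟩ : ∃ t, c.1.1 + c.1.2 - 1 = t := ⟨_, rfl⟩
    have e : c.1.1 + (c.1.2 + 1) - 1 = t + 1 := by omega
    rw [ht, e]
    exact_mod_cast (hs.rel t (by omega)).lt ⟨c.1.2 - 1, by omega⟩ ⟨c.1.2 + 1 - 1, by omega⟩
      (by simp only; omega)
  · have hc := c.bounds
    have hc' := c'.bounds
    simp only [chainArray, h] at hc' ⊢
    obtain ⟨t, ht⟩ : ∃ t, c.1.1 + c.1.2 - 1 = t := ⟨_, rfl⟩
    have e : c.1.1 + 1 + c.1.2 - 1 = t + 1 := by omega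
    rw [ht, e]
    have h1 := (hs.rel t (by omega)).le (⟨c.1.2 - 1, by omega⟩ : Fin k)
    exact_mod_cast h1
  · have hc := c.bounds
    have hc' := c'.bounds
    have e : c'.1.1 + c'.1.2 - 1 = c.1.1 + c.1.2 - 1 := by omega
    simp only [chainArray]
    rw [e]
    have h1 : (⟨c'.1.2 - 1, by omega⟩ : Fin k) ≤ ⟨c.1.2 - 1, by omega⟩ := by
      rw [Fin.le_def]
      simp only
      omega
    exact_mod_cast (hs.valid (c.1.1 + c.1.2 - 1) (by omega)).mono h1
  · have hc := c.bounds
    have e : c.1.1 + c.1.2 - 1 = c.1.2 := by omega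
    have h1 := (hs.valid c.1.2 (by omega)).eq ⟨c.1.2 - 1, by omega⟩ (by simp only; omega)
    simp only [chainArray]
    rw [e]
    exact_mod_cast h1
  · have hc := c.bounds
    have h1 := (hs.valid (c.1.1 + c.1.2 - 1) (by omega)).le ⟨c.1.2 - 1, by omega⟩
    simp only [chainArray]
    omega

theorem chainArray_injOn (n : ℕ) :
    Set.InjOn (chainArray n) {s : ℕ → Fin k → ℕ | IsChain n s} := by
  intro s hs s' hs' h
  funext t j
  by_cases htn : t ≤ n
  · by_cases hj : (j : ℕ) + 1 ≤ t
    · have hjk := j.2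
      -- For j + 1 ≤ t the entry is visible in the array; for larger j it is forced to be t.
      let c : Cell n k := ⟨(t - j, j + 1), by simp only [le_min_iff]; omega⟩
      have h1 : ∀ u : ℕ → Fin k → ℕ, chainArray n u c = u t j := fun u => by
        have e : t - (j : ℕ) + (j + 1) - 1 = t := by omega
        change ((u (t - (j : ℕ) + (j + 1) - 1) j : ℕ) : ℤ) = _
        rw [e]
      have h2 := congrFun h c
      rw [h1, h1] at h2
      exact_mod_cast h2
    · rw [(hs.valid t htn).eq j (by omega), (hs'.valid t htn).eq j (by omega)]
  · rw [hs.tail t (by omega), hs'.tail t (by omega)]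

section

variable {n : ℕ} {d : Cell n k → ℤ}

/-- The entries of an array along the diagonals, continued by constants. -/
def diagEntry (d : Cell n k → ℤ) (t j : ℕ) : ℤ :=
  if h : j + 1 ≤ t ∧ t ≤ n ∧ j < k then
    d ⟨(t - j, j + 1), by simp only [le_min_iff]; omega⟩ else t

theorem diagEntry_of_le {t j : ℕ} (h : t ≤ j) : diagEntry d t j = t := dif_neg (by omega)

theorem diagEntry_eq {t j : ℕ} (c : Cell n k) (h1 : c.1.1 + j = t) (h2 : c.1.2 = j + 1) :
    diagEntry d t j = d c := by
  have hc := c.bounds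
  rw [diagEntry, dif_pos (by omega)]
  congr 1
  refine Subtype.ext (Prod.ext ?_ ?_)
  · simp only; omega
  · exact h2.symm

theorem exists_cell {t j : ℕ} (h1 : j + 1 ≤ t) (h2 : t ≤ n) (h3 : j < k) :
    ∃ c : Cell n k, c.1 = (t - j, j + 1) := ⟨⟨(t - j, j + 1), by simp only [le_min_iff]; omega⟩, rfl⟩

theorem diagEntry_of_eq (hd : IsGogTrapezoid n k d) {t j : ℕ} (h : t = j + 1) (htn : t ≤ n) (hj : j < k) :
    diagEntry d t j = t := by
  obtain ⟨c, hc⟩ := exists_cell (n := n) (k := k) h.ge htn hj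
  have h1 : c.1.1 = t - j := congrArg Prod.fst hc
  have h2 : c.1.2 = j + 1 := congrArg Prod.snd hc
  rw [diagEntry_eq c (by omega) h2, hd.first_row c (by omega), h2, h]

theorem diagEntry_le_succ (hd : IsGogTrapezoid n k d) {t j : ℕ} (htn : t ≤ n) (hj : j + 1 < k) :
    diagEntry d t j ≤ diagEntry d t (j + 1) := by
  rcases lt_trichotomy t (j + 1) with h | h | h
  · rw [diagEntry_of_le (by omega), diagEntry_of_le (by omega)]
  · rw [diagEntry_of_eq hd h htn (by omega), diagEntry_of_le h.le]
  · obtain ⟨c, hc⟩ := exists_cell (n := n) (k := k) (t := t) (j := j) (by omega) htn (by omega)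
    obtain ⟨c', hc'⟩ := exists_cell (n := n) (k := k) (t := t) (j := j + 1) (by omega) htn (by omega)
    have h1 : c.1.1 = t - j := congrArg Prod.fst hc
    have h2 : c.1.2 = j + 1 := congrArg Prod.snd hc
    have h3 : c'.1.1 = t - (j + 1) := congrArg Prod.fst hc'
    have h4 : c'.1.2 = j + 1 + 1 := congrArg Prod.snd hc'
    rw [diagEntry_eq c (by omega) h2, diagEntry_eq c' (by omega) h4]
    exact hd.diag_ge c' c (by omega) (by omega)

theorem diagEntry_mono (hd : IsGogTrapezoid n k d) {t j j' : ℕ} (htn : t ≤ n) (h : j ≤ j') (hj : j' < k) :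
    diagEntry d t j ≤ diagEntry d t j' := by
  induction j', h using Nat.le_induction with
  | base => exact le_rfl
  | succ j' h ih => exact (ih (by omega)).trans (diagEntry_le_succ hd htn hj)

/-- Entries grow along the diagonal, so the one in column k is the largest. It is bounded by
`last_col`, or it lies outside the array, where its value is t. -/
theorem diagEntry_le (hd : IsGogTrapezoid n k d) {t j : ℕ} (htn : t ≤ n) (hj : j < k) : diagEntry d t j ≤ t := by
  refine (diagEntry_mono hd htn (show j ≤ k - 1 by omega) (by omega)).trans ?_
  by_cases h : k ≤ t
  · obtain ⟨c, hc⟩ := exists_cell (n := n) (k := k) (t := t) (j := k - 1) (by omega) htn (by omega)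
    have h1 : c.1.1 = t - (k - 1) := congrArg Prod.fst hc
    have h2 : c.1.2 = k - 1 + 1 := congrArg Prod.snd hc
    rw [diagEntry_eq c (by omega) h2]
    have := hd.last_col c (by omega)
    omega
  · rw [diagEntry_of_le (by omega)]

theorem diagEntry_le_diagEntry (hd : IsGogTrapezoid n k d) {t j : ℕ} (htn : t + 1 ≤ n) (hj : j < k) :
    diagEntry d t j ≤ diagEntry d (t + 1) j := by
  rcases lt_trichotomy t j with h | h | h
  · rw [diagEntry_of_le h.le, diagEntry_of_le h]
    omega
  · rw [diagEntry_of_le h.le, diagEntry_of_eq hd (by omega) htn hj]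
    omega
  · obtain ⟨c, hc⟩ := exists_cell (n := n) (k := k) (t := t) (j := j) (by omega) (by omega) (by omega)
    obtain ⟨c', hc'⟩ := exists_cell (n := n) (k := k) (t := t + 1) (j := j) (by omega) htn (by omega)
    have h1 : c.1.1 = t - j := congrArg Prod.fst hc
    have h2 : c.1.2 = j + 1 := congrArg Prod.snd hc
    have h3 : c'.1.1 = t + 1 - j := congrArg Prod.fst hc'
    have h4 : c'.1.2 = j + 1 := congrArg Prod.snd hc'
    rw [diagEntry_eq c (by omega) h2, diagEntry_eq c' (by omega) h4]
    exact hd.col_le c c' (Prod.ext (by simp only; omega) (by simp only; omega))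

theorem diagEntry_lt_diagEntry (hd : IsGogTrapezoid n k d) {t j : ℕ} (htn : t + 1 ≤ n) (hj : j + 1 < k) :
    diagEntry d t j < diagEntry d (t + 1) (j + 1) := by
  by_cases h : t ≤ j
  · rw [diagEntry_of_le h, diagEntry_of_le (by omega)]
    omega
  · obtain ⟨c, hc⟩ := exists_cell (n := n) (k := k) (t := t) (j := j) (by omega) (by omega) (by omega)
    obtain ⟨c', hc'⟩ := exists_cell (n := n) (k := k) (t := t + 1) (j := j + 1) (by omega) htn (by omega)
    have h1 : c.1.1 = t - j := congrArg Prod.fst hc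
    have h2 : c.1.2 = j + 1 := congrArg Prod.snd hc
    have h3 : c'.1.1 = t + 1 - (j + 1) := congrArg Prod.fst hc'
    have h4 : c'.1.2 = j + 1 + 1 := congrArg Prod.snd hc'
    rw [diagEntry_eq c (by omega) h2, diagEntry_eq c' (by omega) h4]
    exact hd.row_lt c c' (Prod.ext (by simp only; omega) (by simp only; omega))

/-- At time 0 the value is 0, and it can only grow with t. This makes the passage from integers to
natural numbers in `exists_isChain` harmless. -/
theorem diagEntry_nonneg (hd : IsGogTrapezoid n k d) {t j : ℕ} (htn : t ≤ n) (hj : j < k) : 0 ≤ diagEntry d t j := by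
  induction t with
  | zero => rw [diagEntry_of_le (Nat.zero_le j)]; rfl
  | succ t ih => exact (ih (by omega)).trans (diagEntry_le_diagEntry hd htn hj)

theorem exists_isChain (hd : IsGogTrapezoid n k d) : ∃ s : ℕ → Fin k → ℕ, IsChain n s ∧ chainArray n s = d := by
  refine ⟨fun t j => if t ≤ n then (diagEntry d t j).toNat else 0, ⟨fun t ht => ?_, fun t ht => ?_,
    fun t ht => ?_⟩, ?_⟩
  · simp only [if_pos ht]
    refine ⟨fun i j hij => Int.toNat_le_toNat (diagEntry_mono hd ht hij j.2), fun i => ?_, fun i hi => ?_⟩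
    · have := diagEntry_le hd ht i.2
      omega
    · rcases hi.eq_or_lt with h | h
      · rw [diagEntry_of_eq hd h ht i.2, Int.toNat_natCast]
      · rw [diagEntry_of_le (Nat.le_of_lt_succ h), Int.toNat_natCast]
  · simp only [if_pos ht.le, if_pos (Nat.succ_le_of_lt ht)]
    refine ⟨fun i => Int.toNat_le_toNat (diagEntry_le_diagEntry hd ht i.2), fun i j hij => ?_⟩
    have h1 := diagEntry_lt_diagEntry hd (Nat.succ_le_of_lt ht) (hij ▸ j.2)
    have h2 := diagEntry_nonneg hd ht.le i.2
    rw [hij]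
    omega
  · funext j
    exact if_neg (by omega)
  · funext c
    have hc := c.bounds
    rw [chainArray, if_pos (by omega), Int.toNat_of_nonneg (diagEntry_nonneg hd (by omega) (by simp only; omega))]
    exact diagEntry_eq c (by simp only; omega) (by simp only; omega)

end

theorem m_eq_sum_chains (n k : ℕ) : m k n = ∑ b ∈ Finset.Iic fun _ : Fin k => n + 1, chains k n b := by
  rw [sum_chains_eq_ncard, m, ← (chainArray_injOn n).ncard_image]
  congr 1
  ext d
  exact ⟨fun hd => exists_isChain hd, fun ⟨_, hs, h⟩ => h ▸ isGogTrapezoid_chainArray hs⟩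

end

end Gog

end

theorem mainTheorem7 (n k : ℕ) (hk : 1 ≤ k) (hkn : k ≤ n) (g : Gog.SignedPerm k) :
    Gog.iterRes (g.act (Gog.F n k)) = Gog.iterRes (Gog.F n k) ∧
      Gog.iterRes (Gog.F n k) = ((Gog.m k n : ℕ) : Gog.RatFun k) := by
  refine ⟨?_, ?_⟩
  -- The signs are removed by flips, and the remaining permutation does not change the coefficient.
  · rw [Gog.iterRes_act_F_sign hkn, Gog.iterRes_act_F, Gog.iterRes_F]
  · rw [Gog.iterRes_F, ← Gog.sum_chains hkn, ← Gog.m_eq_sum_chains, Rat.cast_natCast]
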